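/- Let $\Lambda\subset\mathbb{C}$ be such that the system $\{e^{i\lambda t}\}_{\lambda\in\Lambda}$ is complete and minimal in $L^2(-\pi,\pi)$, i.e. its closed linear span is $L^2(-\pi,\pi)$ but the closed linear span of $\{e^{i\lambda t}\}_{\lambda\in\Lambda\setminus\{\mu\}}$ is a proper subspace for every $\mu\in\Lambda$. Assume that $\Lambda\cap\mathbb{Z}=\emptyset$, and let $$G(z)=\lim_{R\to\infty}\prod_{\lambda\in\Lambda,\,|\lambda|<R}\Bigl(1-\frac{z}{\lambda}\Bigr),\qquad z\in\mathbb{C},$$ be the generating function of the system. Assume that $$\sum_{n\in\mathbb{Z}}\frac{|G(n)|^2+|G(n)|}{|n|+1}<\infty .$$ Let $I_k=[\rho_k-d_k,\rho_k+d_k]$, $k\in\mathbb{N}$, be intervals with $d_k>0$, $2\rho_k\le\rho_{k+1}$ and $d_k\le 0.1\,\rho_k$ for all $k$, and put $g_k=\sum_{n\in\mathbb{Z}\cap I_k}|G(n)|^2$. Assume that there is a constant $C>0$ such that for all $k$ (i) $\displaystyle\sum_{n\in\mathbb{Z}\setminus I_k}\frac{|G(n)|^2}{|n-\rho_k|}\le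 C\,\frac{g_k}{d_k}$; (ii) $\displaystyle\sqrt{\frac{g_k}{d_k}}\le C\,|G(x)|$ for all $x\in I_k$; and that (iii) $\displaystyle\sum_{k}\frac{d_k}{\rho_k}=\infty$. Then the system $\{e^{i\lambda t}\}_{\lambda\in\Lambda}$ is hereditarily complete: if $\{w_\lambda\}_{\lambda\in\Lambda}\subset L^2(-\pi,\pi)$ denotes its (unique) biorthogonal system, $(e^{i\lambda t},w_\mu)=\delta_{\lambda\mu}$, then for every partition $\Lambda=A\cup B$, $A\cap B=\emptyset$, the mixed system $\{e^{i\lambda t}\}_{\lambda\in A}\cup\{w_\lambda\}_{\lambda\in B}$ is complete in $L^2(-\pi,\pi)$. -/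

import Mathlib

open MeasureTheory Filter Topology

noncomputable section

namespace ExpSystem

section Abstract

variable {ι H : Type*} [NormedAddCommGroup H] [InnerProductSpace ℂ H]

/-- A set of vectors is complete if its closed linear span is the whole space. -/
def IsComplete (s : Set H) : Prop :=
  (Submodule.span ℂ s).topologicalClosure = ⊤

/-- A system is complete and minimal: its closed linear span is the whole space, and this fails
as soon as any one vector is removed. -/
def IsCompleteMinimal (v : ι → H) : Prop :=
  IsComplete (Set.range v) ∧ ∀ m : ι, ¬ IsComplete (v '' {n | n ≠ m})

/-- `(v_n, w_m) = δ_{nm}`. -/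
def IsBiorthogonal (v w : ι → H) : Prop :=
  (∀ n, inner ℂ (v n) (w n) = 1) ∧ ∀ n m, n ≠ m → inner ℂ (v n) (w m) = 0

/-- A complete and minimal system `v` is hereditarily complete if, with its (unique) biorthogonal
system `w`, every mixed system `{v_n}_{n ∈ A} ∪ {w_n}_{n ∉ A}` is complete. -/
def IsHereditarilyComplete (v : ι → H) : Prop :=
  IsCompleteMinimal v ∧
    ∃ w : ι → H, IsBiorthogonal v w ∧ ∀ A : Set ι, IsComplete (v '' A ∪ w '' Aᶜ)

end Abstract

/-- Lebesgue measure on `(-π, π)`. -/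
abbrev intervalMeasure : Measure ℝ := volume.restrict (Set.Ioo (-Real.pi) Real.pi)

/-- The complex Hilbert space `L²(-π, π)`. -/
abbrev L2 : Type := Lp ℂ 2 intervalMeasure

theorem memLp_exp (μ : ℂ) :
    MemLp (fun t : ℝ => Complex.exp (Complex.I * μ * t)) 2 intervalMeasure := by
  have hc : Continuous (fun t : ℝ => Complex.exp (Complex.I * μ * t)) := by fun_prop
  obtain ⟨C, hC⟩ := (isCompact_Icc (a := -Real.pi) (b := Real.pi)).exists_bound_of_continuousOn
    hc.continuousOn
  refine MemLp.of_bound hc.aestronglyMeasurable C ?_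
  filter_upwards [ae_restrict_mem measurableSet_Ioo] with t ht
  exact hC t (Set.Ioo_subset_Icc_self ht)

/-- The system `{e^{iμt}}_{μ ∈ Λ}` in `L²(-π, π)`, indexed by `Λ`. -/
def expSystem (Λ : Set ℂ) : Λ → L2 := fun μ => (memLp_exp (μ : ℂ)).toLp _

/-- `G` is the generating function of `Λ`: the principal value product
`G(z) = lim_{R → ∞} ∏_{μ ∈ Λ, |μ| < R} (1 - z / μ)`.
The products are finite whenever `{e^{iμt}}_{μ ∈ Λ}` is complete and minimal. -/
def IsGeneratingFunction (Λ : Set ℂ) (G : ℂ → ℂ) : Prop :=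
  ∀ z : ℂ, Tendsto (fun R : ℝ => ∏ᶠ μ ∈ {μ : ℂ | μ ∈ Λ ∧ ‖μ‖ < R}, (1 - z / μ)) atTop (𝓝 (G z))

/-- `∑ |G(n)|²` over the integers `n ∈ [ρ - d, ρ + d]`. -/
def localMass (G : ℂ → ℂ) (ρ d : ℝ) : ℝ :=
  ∑ n ∈ Finset.Icc ⌈ρ - d⌉ ⌊ρ + d⌋, ‖G (n : ℂ)‖ ^ 2

end ExpSystem

end

/-! The problem is moved to entire functions by h(z) = ∫ e^{izt} conj χ(t) dt. Completeness and
minimality yield a function E with simple zeros exactly at Λ and E(0) = 1, such that every function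
X + zY, with X and Y Fourier transforms, that vanishes on Λ is a multiple of E
(`exists_isGenerator`). The biorthogonal vectors then have transforms proportional to E/(z − λ).

Suppose χ ≠ 0 is orthogonal to a mixed system. Then h vanishes on A, and by Parseval at the integers
Σ E(n) conj h(n)/(z − n) vanishes on B. The difference h Σ E(n) conj h(n)/(z − n) − E Σ |h(n)|²/(z −
n) has no poles, since the residues at each integer cancel, and it vanishes on Λ. Uniqueness of E
gives a constant c with E (c + Σ |h(n)|²/(z − n)) = h Σ E(n) conj h(n)/(z − n)
(`IsGenerator.exists_const`).

This identity is tested near ρ_k. If h has mass below δ d_k/ρ_k in the window [0.8 ρ_k, 1.2 ρ_k],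
over the integers and over the line, then Chebyshev's inequality and the weak type bound for Cauchy
transforms provide a point x in the middle half of I_k where h and the local sums are small. With
(i) for the distant terms and (ii) for a lower bound of |E(x)|, the bracket on the left is at most a
quantity that vanishes with δ, divided by ρ_k (`exists_norm_const_add_le`). But if c = 0, the terms
to the left of the window are positive and a fixed h(n₀) ≠ 0 alone contributes about |h(n₀)|²/ρ_k;
if c ≠ 0, the bracket stays near c. So for a small fixed δ every late window has mass at least δ
d_k/ρ_k. The windows are disjoint and the total mass is finite, hence Σ d_k/ρ_k converges, against
(iii) (`summable_of_identity`).

The hypotheses concern G rather than E, and it remains to see that |G| = |E| on the real line. The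
principal value product gives G e^{αz} = E with α the limit of E'(0) + Σ_{|λ|<R} 1/λ, so the point
is Re α = 0 (`IsGenerator.re_eq_zero`). A nonzero Re α makes the first cosine moment of log |E| on
|z| = r at least a constant times r. That moment is bounded by the mean gap between log |E| and its
majorant π|Im z| + log(C(1 + |z|)). The area integral of the gap over |z| < ρ is o(ρ³), because the
type π of E cannot be lowered in either half-plane: otherwise some E e^{iσz} with σ ≠ 0 would be a
second generator. -/

noncomputable section

namespace ExpSystem

/-! ### Division by sin πz with growth bounds -/

/-- Division of entire functions when the denominator has simple zeros. -/
theorem exists_differentiable_eq_mul {N s : ℂ → ℂ} (hN : Differentiable ℂ N)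
    (hs : Differentiable ℂ s) (hs' : ∀ z, s z = 0 → deriv s z ≠ 0)
    (hNs : ∀ z, s z = 0 → N z = 0) :
    ∃ Q : ℂ → ℂ, Differentiable ℂ Q ∧ ∀ z, N z = s z * Q z := by
  classical
  refine ⟨fun z => if s z = 0 then deriv N z / deriv s z else N z / s z, fun z => ?_, fun z => ?_⟩
  · by_cases hz : s z = 0
    · have hd : ∀ {f : ℂ → ℂ}, Differentiable ℂ f → Differentiable ℂ (dslope f z) := fun {f} hf => by
        rw [← differentiableOn_univ] at hf ⊢
        exact (Complex.differentiableOn_dslope univ_mem).2 hf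
      -- Near a zero z of s, both functions carry the factor w − z; once it is cancelled the
      -- denominator takes the value s'(z) ≠ 0 at z.
      have h0 : dslope s z z ≠ 0 := by rw [dslope_same]; exact hs' z hz
      have hev : ∀ᶠ w in 𝓝 z, dslope s z w ≠ 0 := (hd hs).continuous.continuousAt.eventually_ne h0
      refine ((hd hN z).div (hd hs z) h0).congr_of_eventuallyEq ?_
      filter_upwards [hev] with w hw
      have e1 := sub_smul_dslope N z w
      have e2 := sub_smul_dslope s z w
      rw [hz, sub_zero, smul_eq_mul] at e2
      rw [hNs z hz, sub_zero, smul_eq_mul] at e1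
      by_cases hwz : w = z
      · subst hwz; simp [hz, dslope_same]
      · have : s w ≠ 0 := by rw [← e2]; exact mul_ne_zero (sub_ne_zero.2 hwz) hw
        simp only [Pi.div_apply, this, if_false]
        rw [← e1, ← e2, mul_div_mul_left _ _ (sub_ne_zero.2 hwz)]
    · have hev : ∀ᶠ w in 𝓝 z, s w ≠ 0 := hs.continuous.continuousAt.eventually_ne hz
      refine ((hN z).div (hs z) hz).congr_of_eventuallyEq ?_
      filter_upwards [hev] with w hw
      simp [hw]
  · by_cases hz : s z = 0
    · simp [hz, hNs z hz]
    · simp only [hz, if_false]; field_simp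

theorem differentiable_dslope {f : ℂ → ℂ} (hf : Differentiable ℂ f) (z : ℂ) :
    Differentiable ℂ (dslope f z) := by
  rw [← differentiableOn_univ] at hf ⊢
  exact (Complex.differentiableOn_dslope univ_mem).2 hf

theorem normSq_sin (z : ℂ) : ‖Complex.sin z‖ ^ 2 = Real.sin z.re ^ 2 + Real.sinh z.im ^ 2 := by
  conv_lhs => rw [← Complex.re_add_im z, Complex.sin_add_mul_I]
  rw [← Complex.normSq_eq_norm_sq]
  have : Complex.sin z.re * Complex.cosh z.im + Complex.cos z.re * Complex.sinh z.im * Complex.I =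
      ((Real.sin z.re * Real.cosh z.im : ℝ) : ℂ) + ((Real.cos z.re * Real.sinh z.im : ℝ) : ℂ) * Complex.I := by
    push_cast; ring
  rw [this, Complex.normSq_add_mul_I]
  have h1 := Real.sin_sq_add_cos_sq z.re
  have h2 := Real.cosh_sq z.im
  rw [mul_pow, mul_pow, h2]
  linear_combination (Real.sinh z.im) ^ 2 * h1

/-- From |sin|² = sin² + sinh²: for |Im z| ≥ 1/4 the sinh term suffices. For |Im z| < 1/4 the left
side is below 3/4, while the distance to the nearest integer forces |Re z − n| ≥ 3/8, and Jordan's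
inequality gives |sin(π Re z)| ≥ 2 · 3/8. -/
theorem le_norm_sin_of_forall_int {z : ℂ} (hz : ∀ n : ℤ, 1 / 2 ≤ ‖z - n‖) :
    1 / 4 * Real.exp (Real.pi * |z.im|) ≤ ‖Complex.sin (Real.pi * z)‖ := by
  have hpi := Real.pi_gt_three
  have hpi' := Real.pi_lt_d2
  have hsq := normSq_sin (Real.pi * z)
  simp only [Complex.re_ofReal_mul, Complex.im_ofReal_mul] at hsq
  refine le_of_sq_le_sq ?_ (norm_nonneg _)
  rw [hsq]
  rcases le_or_gt (1 / 4) |z.im| with hy | hy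
  · have h1 : |Real.sinh (Real.pi * z.im)| = Real.sinh (Real.pi * |z.im|) := by
      rw [Real.abs_sinh, abs_mul, abs_of_pos Real.pi_pos]
    have h2 : 1 / 4 * Real.exp (Real.pi * |z.im|) ≤ Real.sinh (Real.pi * |z.im|) := by
      rw [Real.sinh_eq]
      have h3 : Real.exp (-(Real.pi * |z.im|)) * 2 ≤ Real.exp (Real.pi * |z.im|) := by
        have : (2 : ℝ) ≤ Real.exp (2 * (Real.pi * |z.im|)) := by
          have := Real.add_one_le_exp (2 * (Real.pi * |z.im|))
          nlinarith
        calc Real.exp (-(Real.pi * |z.im|)) * 2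
            ≤ Real.exp (-(Real.pi * |z.im|)) * Real.exp (2 * (Real.pi * |z.im|)) := by gcongr
          _ = _ := by rw [← Real.exp_add]; congr 1; ring
      linarith
    have h4 : (1 / 4 * Real.exp (Real.pi * |z.im|)) ^ 2 ≤ Real.sinh (Real.pi * z.im) ^ 2 := by
      rw [← sq_abs (Real.sinh _), h1]
      gcongr
    nlinarith [sq_nonneg (Real.sin (Real.pi * z.re))]
  · have h5 : 1 / 4 * Real.exp (Real.pi * |z.im|) ≤ 3 / 4 := by
      have h1 : Real.exp (Real.pi * |z.im|) ≤ Real.exp 1 := by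
        apply Real.exp_le_exp.2; nlinarith
      have := Real.exp_one_lt_d9
      linarith
    set n := round z.re
    have hn : |z.re - n| ≤ 1 / 2 := abs_sub_round z.re
    have hn2 : 3 / 8 ≤ |z.re - n| := by
      have h := hz n
      have : ‖z - n‖ ^ 2 = (z.re - n) ^ 2 + z.im ^ 2 := by
        rw [← Complex.normSq_eq_norm_sq, Complex.normSq_apply]; simp; ring
      have h2 : (1 / 2 : ℝ) ^ 2 ≤ ‖z - n‖ ^ 2 := by gcongr
      rw [this, ← sq_abs (z.re - n), ← sq_abs z.im] at h2
      by_contra! h3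
      nlinarith [abs_nonneg (z.re - n), abs_nonneg z.im]
    have h6 : |Real.sin (Real.pi * z.re)| = |Real.sin (Real.pi * (z.re - n))| := by
      have : Real.pi * (z.re - n) = Real.pi * z.re - n * Real.pi := by ring
      rw [this, Real.sin_sub_int_mul_pi, abs_mul]
      simp
    have h7 : 3 / 4 ≤ |Real.sin (Real.pi * z.re)| := by
      rw [h6]
      have h8 := Real.mul_le_sin (x := Real.pi * |z.re - n|) (by positivity) (by nlinarith)
      have h9 : 2 / Real.pi * (Real.pi * |z.re - n|) = 2 * |z.re - n| := by field_simp
      have h10 : |Real.sin (Real.pi * (z.re - n))| = |Real.sin (Real.pi * |z.re - n|)| := by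
        rcases abs_choice (z.re - n) with h | h <;> rw [h]
        rw [mul_neg, Real.sin_neg, abs_neg]
      rw [h10]
      exact le_trans (by linarith) (le_abs_self _)
    have h11 : (3 / 4 : ℝ) ^ 2 ≤ Real.sin (Real.pi * z.re) ^ 2 := by
      rw [← sq_abs (Real.sin _)]; gcongr
    have h12 : (1 / 4 * Real.exp (Real.pi * |z.im|)) ^ 2 ≤ (3 / 4) ^ 2 := by gcongr
    nlinarith [sq_nonneg (Real.sinh (Real.pi * z.im))]

theorem sin_pi_mul_eq_zero_iff {z : ℂ} : Complex.sin (Real.pi * z) = 0 ↔ ∃ n : ℤ, z = n := by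
  rw [Complex.sin_eq_zero_iff]
  have hp : (Real.pi : ℂ) ≠ 0 := by exact_mod_cast Real.pi_ne_zero
  constructor
  · rintro ⟨k, hk⟩
    exact ⟨k, mul_left_cancel₀ hp (by rw [hk]; ring)⟩
  · rintro ⟨k, rfl⟩
    exact ⟨k, by ring⟩

/-- An entire function vanishing at the integers is divisible by `sin (π z)`, and the quotient
inherits growth bounds. -/
theorem exists_eq_sin_mul {N : ℂ → ℂ} (hN : Differentiable ℂ N) (h0 : ∀ n : ℤ, N n = 0) :
    ∃ Q : ℂ → ℂ, Differentiable ℂ Q ∧ ∀ z, N z = Complex.sin (Real.pi * z) * Q z := by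
  refine exists_differentiable_eq_mul hN (by fun_prop) (fun z hz => ?_) fun z hz => ?_
  · have : HasDerivAt (fun z : ℂ => Complex.sin (Real.pi * z)) (Complex.cos (Real.pi * z) * (Real.pi * 1)) z :=
      ((hasDerivAt_id z).const_mul _).csin
    rw [this.deriv]
    have hp : (Real.pi : ℂ) ≠ 0 := by exact_mod_cast Real.pi_ne_zero
    have hc : Complex.cos (Real.pi * z) ≠ 0 := fun h => by
      have := Complex.sin_sq_add_cos_sq (Real.pi * z)
      rw [hz, h] at this; norm_num at this
    simp [hp, hc]
  · obtain ⟨n, rfl⟩ := sin_pi_mul_eq_zero_iff.1 hz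
    exact h0 n

/-- Away from the discs of radius 1/2 about the integers, divide by the lower bound for the sine.
Inside such a disc apply the maximum principle on its circle, where |w| ≤ 1 + |z| and |Im w| ≤ 1;
this costs the factors 2^j and e^κ. -/
theorem norm_le_of_sin_mul {Q : ℂ → ℂ} (hQ : Differentiable ℂ Q) {M κ : ℝ} (hM : 0 ≤ M) (hκ : 0 ≤ κ)
    {j : ℕ} (h : ∀ z, ‖Complex.sin (Real.pi * z) * Q z‖ ≤
      M * (1 + ‖z‖) ^ j * Real.exp ((κ + Real.pi) * |z.im|)) (z : ℂ) :
    ‖Q z‖ ≤ 4 * M * 2 ^ j * Real.exp κ * (1 + ‖z‖) ^ j * Real.exp (κ * |z.im|) := by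
  have far : ∀ z : ℂ, (∀ n : ℤ, 1 / 2 ≤ ‖z - n‖) →
      ‖Q z‖ ≤ 4 * M * (1 + ‖z‖) ^ j * Real.exp (κ * |z.im|) := fun z hz => by
    have h1 := le_norm_sin_of_forall_int hz
    have h2 := h z
    rw [norm_mul, add_mul, Real.exp_add] at h2
    have h3 : 1 / 4 * Real.exp (Real.pi * |z.im|) * ‖Q z‖ ≤
        M * (1 + ‖z‖) ^ j * (Real.exp (κ * |z.im|) * Real.exp (Real.pi * |z.im|)) :=
      (mul_le_mul_of_nonneg_right h1 (norm_nonneg _)).trans h2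
    have h4 := Real.exp_pos (Real.pi * |z.im|)
    refine le_of_mul_le_mul_left ?_ h4
    nlinarith
  by_cases hz : ∀ n : ℤ, 1 / 2 ≤ ‖z - n‖
  · refine (far z hz).trans ?_
    have h1 : (1 : ℝ) ≤ 2 ^ j * Real.exp κ := one_le_mul_of_one_le_of_one_le
      (one_le_pow₀ (by norm_num)) (Real.one_le_exp hκ)
    have h2 : 0 ≤ 4 * M * (1 + ‖z‖) ^ j * Real.exp (κ * |z.im|) := by positivity
    nlinarith
  · push Not at hz
    obtain ⟨n, hn⟩ := hz
    have key : ‖Q z‖ ≤ 4 * M * (2 * (1 + ‖z‖)) ^ j * Real.exp κ := by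
      refine Complex.norm_le_of_forall_mem_frontier_norm_le (U := Metric.ball (n : ℂ) (1 / 2))
        Metric.isBounded_ball hQ.diffContOnCl (fun w hw => ?_)
        (subset_closure (by simpa [dist_eq_norm] using hn))
      rw [frontier_ball _ (by norm_num), mem_sphere_iff_norm] at hw
      have hwf : ∀ m : ℤ, 1 / 2 ≤ ‖w - m‖ := fun m => by
        by_cases hmn : m = n
        · subst hmn; exact hw.ge
        · have : (1 : ℝ) ≤ ‖((m - n : ℤ) : ℂ)‖ := by
            rw [Complex.norm_intCast]
            exact_mod_cast Int.one_le_abs (sub_ne_zero.2 hmn)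
          have h2 : ((m - n : ℤ) : ℂ) = (w - n) - (w - m) := by push_cast; ring
          rw [h2] at this
          have := this.trans (norm_sub_le _ _)
          linarith
      have hwz : ‖w‖ ≤ 1 + ‖z‖ := by
        have : w = (w - n) - (z - n) + z := by ring
        calc ‖w‖ = ‖(w - n) - (z - n) + z‖ := by rw [← this]
          _ ≤ ‖w - n‖ + ‖z - n‖ + ‖z‖ := (norm_add_le _ _).trans (by gcongr; exact norm_sub_le _ _)
          _ ≤ _ := by rw [hw]; linarith
      have hwi : |w.im| ≤ 1 := by
        have := Complex.abs_im_le_norm (w - n)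
        simp at this
        norm_num at hw
        linarith
      refine (far w hwf).trans ?_
      have : κ * |w.im| ≤ κ := by nlinarith
      gcongr
      linarith [norm_nonneg z]
    refine key.trans ?_
    rw [mul_pow]
    have h1 : (1 : ℝ) ≤ Real.exp (κ * |z.im|) := Real.one_le_exp (by positivity)
    have h2 : 0 ≤ 4 * M * 2 ^ j * Real.exp κ * (1 + ‖z‖) ^ j := by positivity
    nlinarith

/-! ### Fourier transforms of L²(−π, π) and their samples -/

/-- The exponential `t ↦ e^{izt}` as a vector of `L²(-π, π)`. -/
def expVec (z : ℂ) : L2 := (memLp_exp z).toLp _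

/-- The Fourier transform `z ↦ (e^{izt}, ψ)` of `ψ ∈ L²(-π, π)`, extended to the complex plane. -/
def expTransform (ψ : L2) (z : ℂ) : ℂ := inner ℂ ψ (expVec z)

theorem expTransform_eq_integral (ψ : L2) (z : ℂ) :
    expTransform ψ z =
      ∫ t : ℝ, Complex.exp (Complex.I * z * t) * (starRingEnd ℂ) (ψ t) ∂intervalMeasure := by
  rw [expTransform, L2.inner_def]
  refine integral_congr_ae ?_
  filter_upwards [(memLp_exp z).coeFn_toLp] with t ht
  rw [expVec, ht, RCLike.inner_apply]

theorem integrable_norm_L2 (ψ : L2) : Integrable (fun t => ‖ψ t‖) intervalMeasure :=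
  ((Lp.memLp ψ).integrable one_le_two).norm

theorem norm_exp_I_mul (z : ℂ) (t : ℝ) : ‖Complex.exp (Complex.I * z * t)‖ = Real.exp (-z.im * t) := by
  rw [Complex.norm_exp]; congr 1; simp

theorem ae_abs_lt_pi : ∀ᵐ t ∂intervalMeasure, |t| < Real.pi := by
  filter_upwards [ae_restrict_mem measurableSet_Ioo] with t ht
  exact abs_lt.2 ht

theorem neg_im_mul_le {z : ℂ} {t : ℝ} (ht : |t| < Real.pi) : -z.im * t ≤ Real.pi * |z.im| := by
  calc -z.im * t ≤ |-z.im * t| := le_abs_self _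
    _ = |z.im| * |t| := by rw [abs_mul, abs_neg]
    _ ≤ |z.im| * Real.pi := by gcongr
    _ = _ := mul_comm _ _

theorem norm_expTransform_le (ψ : L2) (z : ℂ) :
    ‖expTransform ψ z‖ ≤ (∫ t, ‖ψ t‖ ∂intervalMeasure) * Real.exp (Real.pi * |z.im|) := by
  rw [expTransform_eq_integral, ← integral_mul_const]
  refine norm_integral_le_of_norm_le ((integrable_norm_L2 ψ).mul_const _) ?_
  filter_upwards [ae_abs_lt_pi] with t ht
  rw [norm_mul, RCLike.norm_conj, norm_exp_I_mul, mul_comm]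
  exact mul_le_mul_of_nonneg_left (Real.exp_le_exp.2 (neg_im_mul_le ht)) (norm_nonneg _)

theorem aestronglyMeasurable_conj_L2 (ψ : L2) :
    AEStronglyMeasurable (fun t => (starRingEnd ℂ) (ψ t)) intervalMeasure :=
  Complex.continuous_conj.comp_aestronglyMeasurable (Lp.aestronglyMeasurable ψ)

theorem differentiable_expTransform (ψ : L2) : Differentiable ℂ (expTransform ψ) := by
  intro z₀
  have hfun : expTransform ψ = fun z => ∫ t : ℝ, Complex.exp (Complex.I * z * t) *
      (starRingEnd ℂ) (ψ t) ∂intervalMeasure := funext (expTransform_eq_integral ψ)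
  rw [hfun]
  have hmeas : ∀ z : ℂ, AEStronglyMeasurable (fun t : ℝ => Complex.exp (Complex.I * z * t) *
      (starRingEnd ℂ) (ψ t)) intervalMeasure := fun z =>
    (by fun_prop : Continuous fun t : ℝ => Complex.exp (Complex.I * z * t)).aestronglyMeasurable.mul
      (aestronglyMeasurable_conj_L2 ψ)
  refine (hasDerivAt_integral_of_dominated_loc_of_deriv_le (s := Metric.ball z₀ 1)
    (F' := fun z t => Complex.exp (Complex.I * z * t) * (Complex.I * t) * (starRingEnd ℂ) (ψ t))
    (bound := fun t => Real.exp (Real.pi * (|z₀.im| + 1)) * Real.pi * ‖ψ t‖)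
    (Metric.ball_mem_nhds _ one_pos) (Eventually.of_forall hmeas) ?_ ?_ ?_ ?_ ?_).2.differentiableAt
  · refine ((integrable_norm_L2 ψ).mul_const (Real.exp (Real.pi * |z₀.im|))).mono' (hmeas z₀) ?_
    filter_upwards [ae_abs_lt_pi] with t ht
    rw [norm_mul, RCLike.norm_conj, norm_exp_I_mul, mul_comm]
    exact mul_le_mul_of_nonneg_left (Real.exp_le_exp.2 (neg_im_mul_le ht)) (norm_nonneg _)
  · exact (by fun_prop : Continuous fun t : ℝ => Complex.exp (Complex.I * z₀ * t) *
      (Complex.I * t)).aestronglyMeasurable.mul (aestronglyMeasurable_conj_L2 ψ)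
  · filter_upwards [ae_abs_lt_pi] with t ht z hz
    rw [norm_mul, norm_mul, RCLike.norm_conj, norm_exp_I_mul, norm_mul, Complex.norm_I, one_mul,
      Complex.norm_real, Real.norm_eq_abs]
    have h1 : |z.im| ≤ |z₀.im| + 1 := by
      have h2 := Complex.abs_im_le_norm (z - z₀)
      rw [Metric.mem_ball, dist_eq_norm] at hz
      have h3 : z.im = z₀.im + (z - z₀).im := by simp
      rw [h3]
      exact (abs_add_le _ _).trans (by linarith)
    have h4 := (neg_im_mul_le (z := z) ht).trans (mul_le_mul_of_nonneg_left h1 Real.pi_pos.le)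
    gcongr
  · exact (integrable_norm_L2 ψ).const_mul _
  · filter_upwards with t z _
    have h1 : HasDerivAt (fun z : ℂ => Complex.I * z * t) (Complex.I * t) z := by
      simpa using ((hasDerivAt_id z).const_mul Complex.I).mul_const (t : ℂ)
    exact h1.cexp.mul_const _

/-- Dominated convergence, since e^{−(t+π)y} → 0 for t > −π. This decay is what separates Fourier
transforms from sin πz, which obeys the same exponential bound. -/
theorem tendsto_expTransform_imag (ψ : L2) :
    Tendsto (fun y : ℝ => ‖expTransform ψ (Complex.I * y)‖ * Real.exp (-(Real.pi * y))) atTop (𝓝 0) := by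
  have key : Tendsto (fun y : ℝ => ∫ t : ℝ, Complex.exp (Complex.I * (Complex.I * y) * t) *
      (starRingEnd ℂ) (ψ t) * (Real.exp (-(Real.pi * y)) : ℂ) ∂intervalMeasure) atTop
      (𝓝 (∫ _ : ℝ, (0 : ℂ) ∂intervalMeasure)) := by
    refine tendsto_integral_filter_of_dominated_convergence (fun t => ‖ψ t‖) ?_ ?_
      (integrable_norm_L2 ψ) ?_
    · refine Eventually.of_forall fun y => ?_
      exact ((by fun_prop : Continuous fun t : ℝ => Complex.exp (Complex.I * (Complex.I * y) *
        t)).aestronglyMeasurable.mul (aestronglyMeasurable_conj_L2 ψ)).mul_const _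
    · filter_upwards [eventually_ge_atTop 0] with y hy
      filter_upwards [ae_abs_lt_pi] with t ht
      rw [norm_mul, norm_mul, RCLike.norm_conj, norm_exp_I_mul, Complex.norm_real, Real.norm_eq_abs,
        abs_of_pos (Real.exp_pos _), mul_right_comm, ← Real.exp_add]
      have : Real.exp (-(Complex.I * y).im * t + -(Real.pi * y)) ≤ 1 := by
        rw [Real.exp_le_one_iff]
        simp only [Complex.I_mul_im, Complex.ofReal_re]
        nlinarith [(abs_lt.1 ht).1]
      nlinarith [norm_nonneg (ψ t)]
    · filter_upwards [ae_abs_lt_pi] with t ht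
      rw [tendsto_zero_iff_norm_tendsto_zero]
      have h1 : ∀ y : ℝ, ‖Complex.exp (Complex.I * (Complex.I * y) * t) *
          (starRingEnd ℂ) (ψ t) * (Real.exp (-(Real.pi * y)) : ℂ)‖ =
          Real.exp (-((t + Real.pi) * y)) * ‖ψ t‖ := fun y => by
        rw [norm_mul, norm_mul, RCLike.norm_conj, norm_exp_I_mul, Complex.norm_real, Real.norm_eq_abs,
          abs_of_pos (Real.exp_pos _), mul_right_comm, ← Real.exp_add]
        congr 2
        simp only [Complex.I_mul_im, Complex.ofReal_re]; ring
      simp_rw [h1]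
      have h2 : Tendsto (fun y : ℝ => (t + Real.pi) * y) atTop atTop :=
        tendsto_id.const_mul_atTop (by linarith [(abs_lt.1 ht).1])
      simpa using (Real.tendsto_exp_neg_atTop_nhds_zero.comp h2).mul_const ‖ψ t‖
  rw [integral_zero] at key
  refine key.norm.congr (fun y => ?_) |>.trans (by simp)
  rw [integral_mul_const, norm_mul, ← expTransform_eq_integral, Complex.norm_real, Real.norm_eq_abs,
    abs_of_pos (Real.exp_pos _)]

theorem inner_expVec_real (a b : ℝ) :
    inner ℂ (expVec a) (expVec b) =
      ∫ t in (-Real.pi)..Real.pi, Complex.exp ((Complex.I * (b - a)) * t) := by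
  rw [intervalIntegral.integral_of_le (by linarith [Real.pi_pos]), ← integral_Ioc_eq_integral_Ioo.symm,
    L2.inner_def]
  refine integral_congr_ae ?_
  filter_upwards [(memLp_exp a).coeFn_toLp, (memLp_exp b).coeFn_toLp] with t h1 h2
  rw [expVec, expVec, h1, h2, RCLike.inner_apply, ← Complex.exp_conj, ← Complex.exp_add]
  congr 1
  simp
  ring

/-- The normalised exponentials with frequencies in `s + ℤ`. -/
def normExp (s : ℝ) (n : ℤ) : L2 := ((√(2 * Real.pi))⁻¹ : ℂ) • expVec ((n + s : ℝ) : ℂ)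

theorem orthonormal_normExp (s : ℝ) : Orthonormal ℂ (normExp s) := by
  have hpos : (0 : ℝ) < 2 * Real.pi := by positivity
  have hs : ((√(2 * Real.pi) : ℝ) : ℂ) * ((√(2 * Real.pi) : ℝ) : ℂ) = 2 * Real.pi := by
    rw [← Complex.ofReal_mul, Real.mul_self_sqrt hpos.le]; push_cast; ring
  have hp : (Real.pi : ℂ) ≠ 0 := by exact_mod_cast Real.pi_ne_zero
  rw [orthonormal_iff_ite]
  intro n m
  rw [normExp, normExp, inner_smul_left, inner_smul_right, inner_expVec_real]
  have hc : (starRingEnd ℂ) ((√(2 * Real.pi) : ℂ)⁻¹) = (√(2 * Real.pi) : ℂ)⁻¹ := by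
    rw [map_inv₀, Complex.conj_ofReal]
  rw [hc, ← mul_assoc, ← mul_inv, hs]
  split_ifs with h
  · subst h
    simp
    field_simp
    ring
  · have hne : (Complex.I * (((m + s : ℝ) : ℂ) - ((n + s : ℝ) : ℂ))) ≠ 0 := by
      refine mul_ne_zero Complex.I_ne_zero ?_
      push_cast
      rw [add_sub_add_right_eq_sub, sub_ne_zero]
      exact_mod_cast (Ne.symm h)
    rw [integral_exp_mul_complex hne]
    have he : Complex.exp (Complex.I * (((m + s : ℝ) : ℂ) - ((n + s : ℝ) : ℂ)) * (Real.pi : ℝ)) =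
        Complex.exp (Complex.I * (((m + s : ℝ) : ℂ) - ((n + s : ℝ) : ℂ)) * ((-Real.pi : ℝ) : ℂ)) := by
      rw [Complex.exp_eq_exp_iff_exists_int]
      exact ⟨m - n, by push_cast; ring⟩
    rw [he, sub_self, zero_div, mul_zero]

theorem inner_normExp (s : ℝ) (n : ℤ) (ψ : L2) :
    inner ℂ ψ (normExp s n) = ((√(2 * Real.pi))⁻¹ : ℂ) * expTransform ψ ((n + s : ℝ) : ℂ) := by
  rw [normExp, inner_smul_right, expTransform]

theorem norm_sq_inner_normExp (s : ℝ) (n : ℤ) (ψ : L2) :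
    ‖inner ℂ (normExp s n) ψ‖ ^ 2 = (2 * Real.pi)⁻¹ * ‖expTransform ψ ((n + s : ℝ) : ℂ)‖ ^ 2 := by
  rw [norm_inner_symm, inner_normExp, norm_mul, mul_pow, norm_inv, Complex.norm_real, Real.norm_eq_abs,
    abs_of_nonneg (Real.sqrt_nonneg _), inv_pow, Real.sq_sqrt (by positivity)]

/-- Bessel's inequality. The shift is kept free: s = 0 gives the integers, s = 1/2 the points where
|sin πz| = 1, and integration over 0 < s ≤ 1 gives the L² norm on the line. -/
theorem summable_norm_sq_expTransform (ψ : L2) (s : ℝ) :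
    Summable fun n : ℤ => ‖expTransform ψ ((n + s : ℝ) : ℂ)‖ ^ 2 := by
  have h := (orthonormal_normExp s).inner_products_summable ψ
  simp_rw [norm_sq_inner_normExp] at h
  exact (summable_mul_left_iff (by positivity)).1 h

theorem tsum_norm_sq_expTransform_le (ψ : L2) (s : ℝ) :
    ∑' n : ℤ, ‖expTransform ψ ((n + s : ℝ) : ℂ)‖ ^ 2 ≤ 2 * Real.pi * ‖ψ‖ ^ 2 := by
  have h := (orthonormal_normExp s).tsum_inner_products_le ψ
  simp_rw [norm_sq_inner_normExp] at h
  rw [tsum_mul_left] at h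
  have hpos : (0 : ℝ) < 2 * Real.pi := by positivity
  rwa [inv_mul_le_iff₀ hpos] at h

/-- Riesz–Fischer: square summable data on `s + ℤ` are interpolated by a Fourier transform. -/
theorem exists_expTransform_eq (s : ℝ) (c : ℤ → ℂ) (hc : Summable fun n => ‖c n‖ ^ 2) :
    ∃ ψ : L2, ∀ n : ℤ, expTransform ψ ((n + s : ℝ) : ℂ) = c n := by
  have hv := orthonormal_normExp s
  set a : ℤ → ℂ := fun n => (√(2 * Real.pi))⁻¹ * (starRingEnd ℂ) (c n)
  have hsum : Summable fun n => a n • normExp s n := by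
    have := (hv.orthogonalFamily.summable_iff_norm_sq_summable a).2 (by
      simp only [a, norm_mul, mul_pow, RCLike.norm_conj]
      exact hc.mul_left _)
    simpa using this
  refine ⟨∑' n, a n • normExp s n, fun m => ?_⟩
  have h1 : inner ℂ (∑' n, a n • normExp s n) (normExp s m) = (starRingEnd ℂ) (a m) := by
    have h2 : HasSum (fun n => inner ℂ (normExp s m) (a n • normExp s n))
        (inner ℂ (normExp s m) (∑' n, a n • normExp s n)) :=
      hsum.hasSum.mapL (innerSL ℂ (normExp s m))
    have h3 : HasSum (fun n => inner ℂ (normExp s m) (a n • normExp s n)) (a m) := by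
      convert hasSum_ite_eq m (a m) using 2 with n
      rw [inner_smul_right, orthonormal_iff_ite.1 hv]
      by_cases h : n = m
      · subst h; simp
      · simp [h, Ne.symm h]
    rw [← inner_conj_symm, h2.unique h3]
  rw [inner_normExp] at h1
  have hne : ((√(2 * Real.pi) : ℝ) : ℂ)⁻¹ ≠ 0 := by
    have : (0:ℝ) < √(2 * Real.pi) := by positivity
    simp only [ne_eq, inv_eq_zero, Complex.ofReal_eq_zero]; exact this.ne'
  refine mul_left_cancel₀ hne ?_
  rw [h1]
  simp [a]

/-- The quotient by sin π(z − s) is entire and bounded, hence constant by Liouville; the decay along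
the positive imaginary axis makes the constant zero. -/
theorem eq_zero_of_eq_zero_on_lattice (s : ℝ) {D : ℂ → ℂ} (hD : Differentiable ℂ D) {C : ℝ}
    (hC : ∀ z, ‖D z‖ ≤ C * Real.exp (Real.pi * |z.im|)) (h0 : ∀ n : ℤ, D ((n + s : ℝ) : ℂ) = 0)
    (hlim : Tendsto (fun y : ℝ => ‖D (Complex.I * y)‖ * Real.exp (-(Real.pi * y))) atTop (𝓝 0)) :
    D = 0 := by
  have hC0 : 0 ≤ C := by
    have := (norm_nonneg _).trans (hC 0)
    simpa using this
  obtain ⟨Q, hQ, hDQ⟩ := exists_eq_sin_mul (N := fun z => D (z + s)) (by fun_prop) (fun n => by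
    have := h0 n; push_cast at this; exact this)
  have hQb : ∀ z, ‖Q z‖ ≤ 4 * C := fun z => by
    have := norm_le_of_sin_mul hQ hC0 le_rfl (j := 0) (fun z => by
      rw [← hDQ z]; simpa using hC (z + s)) z
    simpa using this
  have hconst : ∀ z, Q z = Q 0 := fun z =>
    hQ.apply_eq_apply_of_bounded (isBounded_iff_forall_norm_le.2 ⟨4 * C, by
      rintro _ ⟨w, rfl⟩; exact hQb w⟩) z 0
  have hD' : ∀ z, D z = Complex.sin (Real.pi * (z - s)) * Q 0 := fun z => by
    have := hDQ (z - s)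
    rwa [sub_add_cancel, hconst] at this
  have hq : ‖Q 0‖ / 4 ≤ 0 := by
    refine ge_of_tendsto hlim ?_
    filter_upwards [eventually_ge_atTop (1 / 2)] with y hy
    have h1 := le_norm_sin_of_forall_int (z := Complex.I * y - s) (fun n => by
      have := Complex.abs_im_le_norm (Complex.I * y - s - n)
      simp at this
      exact hy.trans ((le_abs_self y).trans this))
    have h2 : |(Complex.I * y - s).im| = y := by simp; linarith
    rw [h2] at h1
    rw [hD', norm_mul]
    have h3 : Real.exp (Real.pi * y) * Real.exp (-(Real.pi * y)) = 1 := by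
      rw [← Real.exp_add, add_neg_cancel, Real.exp_zero]
    calc ‖Q 0‖ / 4 = 1 / 4 * Real.exp (Real.pi * y) * ‖Q 0‖ * Real.exp (-(Real.pi * y)) := by
          linear_combination (-(‖Q 0‖) / 4) * h3
      _ ≤ _ := by gcongr
  have : Q 0 = 0 := norm_le_zero_iff.1 (by linarith)
  funext z
  rw [hD', this, mul_zero, Pi.zero_apply]

/-! ### The Paley–Wiener class and its extension by one power of z -/

/-- Intrinsic description of the Fourier transforms of `L²(-π, π)`. -/
structure IsPaleyWiener (X : ℂ → ℂ) : Prop where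
  differentiable : Differentiable ℂ X
  bound : ∃ C, ∀ z, ‖X z‖ ≤ C * Real.exp (Real.pi * |z.im|)
  summable : Summable fun n : ℤ => ‖X ((n + 1 / 2 : ℝ) : ℂ)‖ ^ 2
  tendsto : Tendsto (fun y : ℝ => ‖X (Complex.I * y)‖ * Real.exp (-(Real.pi * y))) atTop (𝓝 0)

theorem isPaleyWiener_expTransform (ψ : L2) : IsPaleyWiener (expTransform ψ) :=
  ⟨differentiable_expTransform ψ, ⟨_, norm_expTransform_le ψ⟩, summable_norm_sq_expTransform ψ _,
    tendsto_expTransform_imag ψ⟩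

/-- The samples at half-integers are interpolated by a transform, and the difference falls under the
uniqueness statement on a shifted lattice. -/
theorem IsPaleyWiener.exists_expTransform {X : ℂ → ℂ} (hX : IsPaleyWiener X) :
    ∃ ψ : L2, expTransform ψ = X := by
  obtain ⟨ψ, hψ⟩ := exists_expTransform_eq (1 / 2) (fun n => X ((n + 1 / 2 : ℝ) : ℂ)) hX.summable
  refine ⟨ψ, ?_⟩
  obtain ⟨C, hC⟩ := hX.bound
  refine sub_eq_zero.1 (eq_zero_of_eq_zero_on_lattice (1 / 2)
    ((differentiable_expTransform ψ).sub hX.differentiable)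
    (C := (∫ t, ‖ψ t‖ ∂intervalMeasure) + C) (fun z => ?_) (fun n => ?_) ?_)
  · rw [add_mul]
    exact (norm_sub_le _ _).trans (add_le_add (norm_expTransform_le ψ z) (hC z))
  · simp only [Pi.sub_apply]; rw [hψ n, sub_self]
  · have := (tendsto_expTransform_imag ψ).add hX.tendsto
    rw [add_zero] at this
    refine squeeze_zero (fun y => by positivity) (fun y => ?_) this
    rw [← add_mul]
    gcongr
    exact norm_sub_le _ _

/-- Entire functions of the form `X + z Y` with `X`, `Y` Fourier transforms. -/
structure IsPaleyWienerOne (W : ℂ → ℂ) : Prop where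
  differentiable : Differentiable ℂ W
  bound : ∃ C, ∀ z, ‖W z‖ ≤ C * (1 + ‖z‖) * Real.exp (Real.pi * |z.im|)
  summable : Summable fun n : ℤ => (‖W ((n + 1 / 2 : ℝ) : ℂ)‖ / (1 + |(n : ℝ)|)) ^ 2
  tendsto : Tendsto (fun y : ℝ => ‖W (Complex.I * y)‖ * Real.exp (-(Real.pi * y)) / y) atTop (𝓝 0)

theorem IsPaleyWienerOne.sub {V W : ℂ → ℂ} (hV : IsPaleyWienerOne V) (hW : IsPaleyWienerOne W) :
    IsPaleyWienerOne (V - W) := by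
  obtain ⟨C, hC⟩ := hV.bound
  obtain ⟨C', hC'⟩ := hW.bound
  refine ⟨hV.differentiable.sub hW.differentiable, ⟨C + C', fun z => ?_⟩, ?_, ?_⟩
  · refine (norm_sub_le _ _).trans ((add_le_add (hC z) (hC' z)).trans_eq (by ring))
  · refine Summable.of_nonneg_of_le (fun n => by positivity) (fun n => ?_)
      ((hV.summable.mul_left 2).add (hW.summable.mul_left 2))
    have h1 : ‖(V - W) ((n + 1 / 2 : ℝ) : ℂ)‖ / (1 + |(n : ℝ)|) ≤
        ‖V ((n + 1 / 2 : ℝ) : ℂ)‖ / (1 + |(n : ℝ)|) + ‖W ((n + 1 / 2 : ℝ) : ℂ)‖ / (1 + |(n : ℝ)|) := by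
      rw [← add_div]; gcongr; exact norm_sub_le _ _
    have h2 : (‖(V - W) ((n + 1 / 2 : ℝ) : ℂ)‖ / (1 + |(n : ℝ)|)) ^ 2 ≤ (‖V ((n + 1 / 2 : ℝ) : ℂ)‖ /
      (1 + |(n : ℝ)|) + ‖W ((n + 1 / 2 : ℝ) : ℂ)‖ / (1 + |(n : ℝ)|)) ^ 2 := by gcongr
    refine h2.trans ?_
    nlinarith [sq_nonneg (‖V ((n + 1 / 2 : ℝ) : ℂ)‖ / (1 + |(n : ℝ)|) -
      ‖W ((n + 1 / 2 : ℝ) : ℂ)‖ / (1 + |(n : ℝ)|))]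
  · have := hV.tendsto.add hW.tendsto
    rw [add_zero] at this
    refine squeeze_zero' ?_ ?_ this
    · filter_upwards [eventually_ge_atTop 0] with y hy
      positivity
    · filter_upwards [eventually_ge_atTop 0] with y hy
      rw [← add_div, ← add_mul]
      gcongr
      exact norm_sub_le _ _

theorem IsPaleyWienerOne.const_mul {W : ℂ → ℂ} (hW : IsPaleyWienerOne W) (c : ℂ) :
    IsPaleyWienerOne fun z => c * W z := by
  obtain ⟨C, hC⟩ := hW.bound
  refine ⟨hW.differentiable.const_mul c, ⟨‖c‖ * C, fun z => ?_⟩, ?_, ?_⟩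
  · rw [norm_mul, mul_assoc, mul_assoc, ← mul_assoc C]
    gcongr
    exact hC z
  · refine (hW.summable.mul_left (‖c‖ ^ 2)).congr fun n => ?_
    rw [norm_mul]; ring
  · have := hW.tendsto.const_mul ‖c‖
    rw [mul_zero] at this
    refine this.congr fun y => ?_
    rw [norm_mul]; ring

/-- Removing one zero gains a factor 1/|z|, which is exactly the gap between the two classes. The
unit disc about z₀ is handled by the maximum principle. -/
theorem IsPaleyWienerOne.dslope {W : ℂ → ℂ} (hW : IsPaleyWienerOne W) {z₀ : ℂ} (h0 : W z₀ = 0) :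
    IsPaleyWiener (dslope W z₀) := by
  obtain ⟨C, hC⟩ := hW.bound
  have hC0 : 0 ≤ C := by
    have := (norm_nonneg _).trans (hC 0)
    simpa using this
  have hval : ∀ z, z ≠ z₀ → ‖_root_.dslope W z₀ z‖ = ‖W z‖ / ‖z - z₀‖ := fun z hz => by
    have := sub_smul_dslope W z₀ z
    rw [h0, sub_zero, smul_eq_mul] at this
    rw [← this, norm_mul, mul_div_cancel_left₀]
    exact norm_ne_zero_iff.2 (sub_ne_zero.2 hz)
  have hdiff := differentiable_dslope hW.differentiable z₀
  have hfar : ∀ z, 1 ≤ ‖z - z₀‖ → ‖_root_.dslope W z₀ z‖ ≤ C * (2 + ‖z₀‖) * Real.exp (Real.pi * |z.im|) :=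
    fun z hz => by
    have hne : z ≠ z₀ := fun h => by subst h; simp at hz; linarith
    have hpos : 0 < ‖z - z₀‖ := by linarith
    rw [hval z hne, div_le_iff₀ hpos]
    refine (hC z).trans ?_
    have h1 : 1 + ‖z‖ ≤ (2 + ‖z₀‖) * ‖z - z₀‖ := by
      have : ‖z‖ ≤ ‖z - z₀‖ + ‖z₀‖ := by simpa using norm_add_le (z - z₀) z₀
      nlinarith [norm_nonneg z₀]
    calc C * (1 + ‖z‖) * Real.exp (Real.pi * |z.im|)
        ≤ C * ((2 + ‖z₀‖) * ‖z - z₀‖) * Real.exp (Real.pi * |z.im|) := by gcongr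
      _ = _ := by ring
  refine ⟨hdiff, ⟨C * (2 + ‖z₀‖) * Real.exp (Real.pi * (|z₀.im| + 1)), fun z => ?_⟩, ?_, ?_⟩
  · rcases le_or_gt 1 ‖z - z₀‖ with hz | hz
    · refine (hfar z hz).trans ?_
      have h1 : (1 : ℝ) ≤ Real.exp (Real.pi * (|z₀.im| + 1)) := Real.one_le_exp (by positivity)
      have h2 : 0 ≤ C * (2 + ‖z₀‖) * Real.exp (Real.pi * |z.im|) := by positivity
      nlinarith
    · have key : ‖_root_.dslope W z₀ z‖ ≤ C * (2 + ‖z₀‖) * Real.exp (Real.pi * (|z₀.im| + 1)) := by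
        refine Complex.norm_le_of_forall_mem_frontier_norm_le (U := Metric.ball z₀ 1)
          Metric.isBounded_ball hdiff.diffContOnCl (fun w hw => ?_)
          (subset_closure (by simpa [dist_eq_norm] using hz))
        rw [frontier_ball _ one_ne_zero, mem_sphere_iff_norm] at hw
        refine (hfar w hw.ge).trans ?_
        have h1 : |w.im| ≤ |z₀.im| + 1 := by
          have h2 := Complex.abs_im_le_norm (w - z₀)
          have h3 : w.im = z₀.im + (w - z₀).im := by simp
          rw [h3]
          exact (abs_add_le _ _).trans (by linarith)
        gcongr
      refine key.trans ?_
      have h1 : (1 : ℝ) ≤ Real.exp (Real.pi * |z.im|) := Real.one_le_exp (by positivity)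
      have h2 : 0 ≤ C * (2 + ‖z₀‖) * Real.exp (Real.pi * (|z₀.im| + 1)) := by positivity
      nlinarith
  · refine Summable.of_norm_bounded_eventually (hW.summable.mul_left 4) ?_
    -- Once |n| ≥ 2 + 2|z₀|, the distance from n + 1/2 to z₀ is at least (1 + |n|)/2; the finitely
    -- many other n do not matter for summability.
    have hfin : {n : ℤ | |(n : ℝ)| < 2 + 2 * ‖z₀‖}.Finite := by
      refine (Set.finite_Icc (-⌈2 + 2 * ‖z₀‖⌉) ⌈2 + 2 * ‖z₀‖⌉).subset fun n hn => ?_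
      have h1 : |(n : ℝ)| ≤ (⌈2 + 2 * ‖z₀‖⌉ : ℝ) := hn.le.trans (Int.le_ceil _)
      have h2 : |n| ≤ ⌈2 + 2 * ‖z₀‖⌉ := by exact_mod_cast h1
      exact abs_le.1 h2
    filter_upwards [hfin.compl_mem_cofinite] with n hn
    simp only [Set.mem_compl_iff, Set.mem_ofPred_eq, not_lt] at hn
    have h1 : (1 + |(n : ℝ)|) / 2 ≤ ‖((n + 1 / 2 : ℝ) : ℂ) - z₀‖ := by
      have h2 : |(n : ℝ)| ≤ ‖((n + 1 / 2 : ℝ) : ℂ)‖ + 1 / 2 := by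
        rw [Complex.norm_real, Real.norm_eq_abs]
        have : (n : ℝ) = (n + 1 / 2) - 1 / 2 := by ring
        calc |(n : ℝ)| = |((n : ℝ) + 1 / 2) - 1 / 2| := by rw [← this]
          _ ≤ _ := (abs_sub _ _).trans (by norm_num)
      have h3 := norm_sub_norm_le ((n + 1 / 2 : ℝ) : ℂ) z₀
      linarith
    have hne : ((n + 1 / 2 : ℝ) : ℂ) ≠ z₀ := fun h => by
      rw [h, sub_self, norm_zero] at h1
      nlinarith [abs_nonneg (n : ℝ)]
    rw [hval _ hne, Real.norm_eq_abs, abs_of_nonneg (by positivity)]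
    have h4 : ‖W ((n + 1 / 2 : ℝ) : ℂ)‖ / ‖((n + 1 / 2 : ℝ) : ℂ) - z₀‖ ≤
        2 * (‖W ((n + 1 / 2 : ℝ) : ℂ)‖ / (1 + |(n : ℝ)|)) := by
      calc _ ≤ ‖W ((n + 1 / 2 : ℝ) : ℂ)‖ / ((1 + |(n : ℝ)|) / 2) := by gcongr
        _ = _ := by field_simp
    calc _ ≤ (2 * (‖W ((n + 1 / 2 : ℝ) : ℂ)‖ / (1 + |(n : ℝ)|))) ^ 2 := by gcongr
      _ = _ := by ring
  · have := hW.tendsto.const_mul 2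
    rw [mul_zero] at this
    refine squeeze_zero' (Eventually.of_forall fun y => by positivity) ?_ this
    filter_upwards [eventually_gt_atTop (2 * ‖z₀‖), eventually_gt_atTop 0] with y hy hy0
    have h1 : y / 2 ≤ ‖Complex.I * y - z₀‖ := by
      have h3 := norm_sub_norm_le (Complex.I * y) z₀
      rw [norm_mul, Complex.norm_I, one_mul, Complex.norm_real, Real.norm_eq_abs, abs_of_pos hy0] at h3
      linarith
    have hne : Complex.I * y ≠ z₀ := fun h => by
      rw [h, sub_self, norm_zero] at h1; linarith
    rw [hval _ hne]
    calc _ ≤ ‖W (Complex.I * y)‖ / (y / 2) * Real.exp (-(Real.pi * y)) := by gcongr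
      _ = _ := by field_simp

theorem isPaleyWienerOne_sub_mul {X : ℂ → ℂ} (hX : IsPaleyWiener X) (μ : ℂ) :
    IsPaleyWienerOne fun z => (z - μ) * X z := by
  obtain ⟨C, hC⟩ := hX.bound
  have hC0 : 0 ≤ C := by
    have := (norm_nonneg _).trans (hC 0)
    simpa using this
  have hdiff := hX.differentiable
  have hle : ∀ z, ‖z - μ‖ ≤ (1 + ‖μ‖) * (1 + ‖z‖) := fun z => by
    refine (norm_sub_le _ _).trans ?_
    nlinarith [norm_nonneg z, norm_nonneg μ]
  refine ⟨by fun_prop, ⟨(1 + ‖μ‖) * C, fun z => ?_⟩, ?_, ?_⟩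
  · rw [norm_mul]
    calc ‖z - μ‖ * ‖X z‖ ≤ ((1 + ‖μ‖) * (1 + ‖z‖)) * (C * Real.exp (Real.pi * |z.im|)) := by
          gcongr
          · exact hle z
          · exact hC z
      _ = _ := by ring
  · refine Summable.of_nonneg_of_le (fun n => by positivity) (fun n => ?_)
      (hX.summable.mul_left ((2 * (1 + ‖μ‖)) ^ 2))
    rw [← mul_pow, norm_mul]
    have h1 : ‖((n + 1 / 2 : ℝ) : ℂ) - μ‖ ≤ 2 * (1 + ‖μ‖) * (1 + |(n : ℝ)|) := by
      refine (hle _).trans ?_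
      rw [Complex.norm_real, Real.norm_eq_abs]
      have : |(n : ℝ) + 1 / 2| ≤ |(n : ℝ)| + 1 / 2 := (abs_add_le _ _).trans (by norm_num)
      have h2 : 1 + |(n : ℝ) + 1 / 2| ≤ 2 * (1 + |(n : ℝ)|) := by linarith [abs_nonneg (n : ℝ)]
      calc _ ≤ (1 + ‖μ‖) * (2 * (1 + |(n : ℝ)|)) := by gcongr
        _ = _ := by ring
    gcongr
    rw [div_le_iff₀ (by positivity)]
    calc _ ≤ 2 * (1 + ‖μ‖) * (1 + |(n : ℝ)|) * ‖X ((n + 1 / 2 : ℝ) : ℂ)‖ := by gcongr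
      _ = _ := by ring
  · have := hX.tendsto.const_mul (1 + ‖μ‖)
    rw [mul_zero] at this
    refine squeeze_zero' ?_ ?_ this
    · filter_upwards [eventually_ge_atTop 0] with y hy
      positivity
    · filter_upwards [eventually_ge_atTop 1] with y hy
      have h1 : ‖Complex.I * y - μ‖ ≤ (1 + ‖μ‖) * y := by
        refine (norm_sub_le _ _).trans ?_
        rw [norm_mul, Complex.norm_I, one_mul, Complex.norm_real, Real.norm_eq_abs,
          abs_of_nonneg (by linarith)]
        nlinarith [norm_nonneg μ]
      rw [norm_mul, div_le_iff₀ (by linarith)]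
      calc _ ≤ (1 + ‖μ‖) * y * ‖X (Complex.I * y)‖ * Real.exp (-(Real.pi * y)) := by gcongr
        _ = _ := by ring

/-! ### Completeness on the Fourier side and the generator -/

theorem isComplete_iff {H : Type*} [NormedAddCommGroup H] [InnerProductSpace ℂ H] [CompleteSpace H]
    {s : Set H} : IsComplete s ↔ ∀ ψ : H, (∀ v ∈ s, inner ℂ ψ v = 0) → ψ = 0 := by
  rw [IsComplete, Submodule.topologicalClosure_eq_top_iff, Submodule.eq_bot_iff]
  refine forall_congr' fun ψ => ?_
  rw [Submodule.mem_orthogonal']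
  refine imp_congr_left ⟨fun h v hv => h v (Submodule.subset_span hv), fun h v hv => ?_⟩
  induction hv using Submodule.span_induction with
  | mem v hv => exact h v hv
  | zero => exact inner_zero_right _
  | add x y _ _ hx hy => rw [inner_add_right, hx, hy, add_zero]
  | smul a x _ hx => rw [inner_smul_right, hx, mul_zero]

/-- A complete minimal system has a biorthogonal system. -/
theorem IsCompleteMinimal.exists_isBiorthogonal {ι H : Type*} [NormedAddCommGroup H]
    [InnerProductSpace ℂ H] [CompleteSpace H] {v : ι → H} (hv : IsCompleteMinimal v) :
    ∃ w : ι → H, IsBiorthogonal v w := by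
  have h : ∀ m, ∃ ψ : H, inner ℂ (v m) ψ = 1 ∧ ∀ n, n ≠ m → inner ℂ (v n) ψ = 0 := fun m => by
    have h1 := hv.2 m
    rw [isComplete_iff] at h1
    push Not at h1
    obtain ⟨ψ, h2, h3⟩ := h1
    have h4 : inner ℂ (v m) ψ ≠ 0 := fun h => h3 <| isComplete_iff.1 hv.1 ψ <| by
      rintro _ ⟨n, rfl⟩
      by_cases hn : n = m
      · subst hn; exact inner_eq_zero_symm.1 h
      · exact h2 _ ⟨n, hn, rfl⟩
    refine ⟨(inner ℂ (v m) ψ)⁻¹ • ψ, by rw [inner_smul_right, inv_mul_cancel₀ h4], fun n hn => ?_⟩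
    rw [inner_smul_right, inner_eq_zero_symm.1 (h2 _ ⟨n, hn, rfl⟩), mul_zero]
  choose w h1 h2 using h
  exact ⟨w, h1, fun n m hnm => h2 m n hnm⟩

theorem IsPaleyWiener.eq_zero {Λ : Set ℂ} (hΛ : IsComplete (Set.range (expSystem Λ))) {X : ℂ → ℂ}
    (hX : IsPaleyWiener X) (h0 : ∀ z ∈ Λ, X z = 0) : X = 0 := by
  obtain ⟨ψ, rfl⟩ := hX.exists_expTransform
  have : ψ = 0 := isComplete_iff.1 hΛ ψ <| by
    rintro _ ⟨⟨μ, hμ⟩, rfl⟩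
    exact h0 μ hμ
  subst this
  funext z
  simp [expTransform]

/-- One zero beyond Λ, counted with multiplicity, can be divided out. The quotient is a Fourier
transform still vanishing on Λ, so completeness kills it. -/
theorem IsPaleyWienerOne.eq_zero {Λ : Set ℂ} (hΛ : IsComplete (Set.range (expSystem Λ))) {W : ℂ → ℂ}
    (hW : IsPaleyWienerOne W) (h0 : ∀ z ∈ Λ, W z = 0) {z₀ : ℂ} (hz : W z₀ = 0)
    (hz' : z₀ ∈ Λ → deriv W z₀ = 0) : W = 0 := by
  have h1 : _root_.dslope W z₀ = 0 := (hW.dslope hz).eq_zero hΛ fun z hzΛ => by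
    by_cases h : z = z₀
    · subst h; rw [dslope_same, hz' hzΛ]
    · rw [dslope_of_ne _ h, slope_def_field, h0 z hzΛ, hz, sub_self, zero_div]
  funext z
  have := sub_smul_dslope W z₀ z
  rw [h1, hz] at this
  simpa using this.symm

/-- `E` is the entire function with simple zeros at `Λ`, `E 0 = 1`, generating all the functions of
the class vanishing on `Λ`. -/
structure IsGenerator (Λ : Set ℂ) (E : ℂ → ℂ) : Prop where
  isPaleyWienerOne : IsPaleyWienerOne E
  map_zero : E 0 = 1
  eq_zero_iff : ∀ z, E z = 0 ↔ z ∈ Λ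
  deriv_ne_zero : ∀ z ∈ Λ, deriv E z ≠ 0
  summable_int : Summable fun n : ℤ => (‖E n‖ / (1 + |(n : ℝ)|)) ^ 2
  unique : ∀ W, IsPaleyWienerOne W → (∀ z ∈ Λ, W z = 0) → ∀ z, W z = W 0 * E z

theorem expTransform_biorthogonal {Λ : Set ℂ} {w : Λ → L2} (hw : IsBiorthogonal (expSystem Λ) w) (m : Λ) :
    expTransform (w m) m = 1 ∧ ∀ z ∈ Λ, z ≠ m → expTransform (w m) z = 0 := by
  constructor
  · have := congrArg (starRingEnd ℂ) (hw.1 m)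
    rw [inner_conj_symm, map_one] at this
    exact this
  · intro z hz hzm
    exact inner_eq_zero_symm.1 (hw.2 ⟨z, hz⟩ m fun h => hzm (congrArg Subtype.val h))

theorem nontrivial_L2 : Nontrivial L2 := by
  have h := (orthonormal_normExp 0).1 0
  exact ⟨normExp 0 0, 0, fun h0 => by rw [h0, norm_zero] at h; exact zero_ne_one h⟩

/-- Take (z − μ) times the transform of the biorthogonal vector of any μ ∈ Λ. An additional or
multiple zero would make it vanish identically, although its derivative at μ is 1. For uniqueness, W
− W(0) E has the extra zero 0 ∉ Λ. -/
theorem exists_isGenerator {Λ : Set ℂ} (hΛ : IsCompleteMinimal (expSystem Λ)) (h0 : (0 : ℂ) ∉ Λ) :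
    ∃ E, IsGenerator Λ E := by
  obtain ⟨w, hw⟩ := hΛ.exists_isBiorthogonal
  have hne : Λ.Nonempty := by
    by_contra h
    rw [Set.not_nonempty_iff_eq_empty] at h
    subst h
    have := nontrivial_L2
    obtain ⟨ψ, hψ⟩ := exists_ne (0 : L2)
    exact hψ (isComplete_iff.1 hΛ.1 ψ (by rintro _ ⟨⟨_, h⟩, _⟩; exact h.elim))
  obtain ⟨μ, hμ⟩ := hne
  obtain ⟨h1, h2⟩ := expTransform_biorthogonal hw ⟨μ, hμ⟩
  have hX := isPaleyWiener_expTransform (w ⟨μ, hμ⟩)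
  set X := expTransform (w ⟨μ, hμ⟩)
  have hE := isPaleyWienerOne_sub_mul hX μ
  set E₀ : ℂ → ℂ := fun z => (z - μ) * X z with hE₀
  have hzero : ∀ z ∈ Λ, E₀ z = 0 := fun z hz => by
    by_cases h : z = μ
    · simp [hE₀, h]
    · simp [hE₀, h2 z hz h]
  have hE₀ne : E₀ ≠ 0 := fun h => by
    have h3 : deriv E₀ μ = 1 := by
      have h4 : HasDerivAt E₀ (1 * X μ + (μ - μ) * deriv X μ) μ :=
        ((hasDerivAt_id μ).sub_const μ).mul (hX.differentiable μ).hasDerivAt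
      rw [h4.deriv, h1]; simp
    rw [h] at h3
    simp at h3
  have hz0 : ∀ z, E₀ z = 0 → z ∈ Λ ∧ deriv E₀ z ≠ 0 := fun z hz => by
    by_contra hcon
    rw [not_and, not_not] at hcon
    exact hE₀ne (hE.eq_zero hΛ.1 hzero hz hcon)
  have hE00 : E₀ 0 ≠ 0 := fun h => h0 (hz0 0 h).1
  have hPW : IsPaleyWienerOne fun z => (E₀ 0)⁻¹ * E₀ z := hE.const_mul _
  refine ⟨fun z => (E₀ 0)⁻¹ * E₀ z, hPW, inv_mul_cancel₀ hE00, fun z => ?_, fun z hz => ?_, ?_,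
    fun W hW hW0 z => ?_⟩
  · constructor
    · intro h
      exact (hz0 z ((mul_eq_zero.1 h).resolve_left (inv_ne_zero hE00))).1
    · intro h
      simp only [hzero z h, mul_zero]
  · rw [deriv_const_mul _ (hE.differentiable z)]
    exact mul_ne_zero (inv_ne_zero hE00) (hz0 z (hzero z hz)).2
  · refine Summable.of_nonneg_of_le (fun n => by positivity) (fun n => ?_)
      ((summable_norm_sq_expTransform (w ⟨μ, hμ⟩) 0).mul_left ((‖(E₀ 0)⁻¹‖ * (1 + ‖μ‖)) ^ 2))
    have hn : (((n : ℝ) + 0 : ℝ) : ℂ) = n := by push_cast; ring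
    rw [hn, ← mul_pow, norm_mul, hE₀, norm_mul]
    gcongr
    rw [div_le_iff₀ (by positivity)]
    have h3 : ‖(n : ℂ) - μ‖ ≤ (1 + ‖μ‖) * (1 + |(n : ℝ)|) := by
      refine (norm_sub_le _ _).trans ?_
      rw [Complex.norm_intCast]
      nlinarith [abs_nonneg (n : ℝ), norm_nonneg μ]
    calc _ ≤ ‖(E₀ 0)⁻¹‖ * ((1 + ‖μ‖) * (1 + |(n : ℝ)|) * ‖X n‖) := by gcongr
      _ = _ := by ring
  · have := (hW.sub (hPW.const_mul (W 0))).eq_zero hΛ.1 (z₀ := 0) (fun z hz => by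
      simp [hW0 z hz, hzero z hz]) (by simp [inv_mul_cancel₀ hE00]) (fun h => (h0 h).elim)
    have := congrFun this z
    simp only [Pi.sub_apply, Pi.zero_apply, sub_eq_zero] at this
    exact this

/-- The product on the left vanishes on Λ, so uniqueness of the generator applies; the factor is
nonzero because the derivative at m is 1. -/
theorem IsGenerator.expTransform_eq {Λ : Set ℂ} {E : ℂ → ℂ} (hE : IsGenerator Λ E) {w : Λ → L2}
    (hw : IsBiorthogonal (expSystem Λ) w) (m : Λ) :
    ∃ c : ℂ, c ≠ 0 ∧ ∀ z, (z - m) * expTransform (w m) z = c * E z := by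
  obtain ⟨h1, h2⟩ := expTransform_biorthogonal hw m
  have hX := isPaleyWiener_expTransform (w m)
  have key := hE.unique _ (isPaleyWienerOne_sub_mul hX m) (fun z hz => by
    by_cases h : z = m
    · simp [h]
    · simp [h2 z hz h])
  refine ⟨_, fun h => ?_, key⟩
  rw [h] at key
  have h3 : deriv (fun z : ℂ => (z - m) * expTransform (w m) z) m = 1 := by
    have h4 : HasDerivAt (fun z : ℂ => (z - m) * expTransform (w m) z)
        (1 * expTransform (w m) m + ((m : ℂ) - m) * deriv (expTransform (w m)) m) (m : ℂ) :=
      ((hasDerivAt_id (m : ℂ)).sub_const (m : ℂ)).mul (hX.differentiable m).hasDerivAt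
    rw [h4.deriv, h1]; simp
  have h5 : (fun z : ℂ => (z - m) * expTransform (w m) z) = fun _ => 0 := by
    funext z; rw [key z, zero_mul]
  rw [h5] at h3
  simp at h3

/-! ### Interpolation at the integers and the identity for an orthogonal vector -/

/-- Parseval's formula for the integer frequencies. -/
theorem hasSum_inner_expTransform {Λ : Set ℂ} (hΛ : IsComplete (Set.range (expSystem Λ))) (χ ψ : L2) :
    HasSum (fun n : ℤ => expTransform χ n * (starRingEnd ℂ) (expTransform ψ n))
      (2 * Real.pi * inner ℂ χ ψ) := by
  have hv := orthonormal_normExp 0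
  -- A vector orthogonal to all integer exponentials has a transform vanishing on ℤ, hence
  -- identically, in particular on Λ; `hΛ` then gives the zero vector.
  have hbot : (Submodule.span ℂ (Set.range (normExp 0)))ᗮ = ⊥ := by
    rw [Submodule.eq_bot_iff]
    intro θ hθ
    rw [Submodule.mem_orthogonal'] at hθ
    have hθ0 : expTransform θ = 0 := by
      refine eq_zero_of_eq_zero_on_lattice 0 (differentiable_expTransform θ) (norm_expTransform_le θ)
        (fun n => ?_) (tendsto_expTransform_imag θ)
      have := hθ _ (Submodule.subset_span ⟨n, rfl⟩)
      rw [inner_normExp] at this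
      refine (mul_eq_zero.1 this).resolve_left ?_
      have : (0:ℝ) < √(2 * Real.pi) := by positivity
      simp only [ne_eq, inv_eq_zero, Complex.ofReal_eq_zero]; exact this.ne'
    refine isComplete_iff.1 hΛ θ ?_
    rintro _ ⟨μ, rfl⟩
    exact congrFun hθ0 μ
  have h := (HilbertBasis.mkOfOrthogonalEqBot hv hbot).hasSum_inner_mul_inner χ ψ
  have h2 := h.mul_left (2 * Real.pi : ℂ)
  refine h2.congr_fun fun n => ?_
  have hpos : (0 : ℝ) < 2 * Real.pi := by positivity
  have hs : ((√(2 * Real.pi) : ℝ) : ℂ) * ((√(2 * Real.pi) : ℝ) : ℂ) = 2 * Real.pi := by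
    rw [← Complex.ofReal_mul, Real.mul_self_sqrt hpos.le]; push_cast; ring
  have hne : (2 * Real.pi : ℂ) ≠ 0 := by exact_mod_cast hpos.ne'
  have hn : (((n : ℝ) + 0 : ℝ) : ℂ) = n := by push_cast; ring
  rw [HilbertBasis.coe_mkOfOrthogonalEqBot, ← inner_conj_symm (normExp 0 n) ψ, inner_normExp,
    inner_normExp, map_mul, map_inv₀, Complex.conj_ofReal, hn]
  have h3 : ∀ a b q p : ℂ, q * q = p → p ≠ 0 → a * b = p * (q⁻¹ * a * (q⁻¹ * b)) := by
    rintro a b q _ rfl hq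
    have : q ≠ 0 := fun h => hq (by simp [h])
    field_simp
  exact h3 _ _ _ _ hs hne

theorem norm_sin_pi_mul_le (z : ℂ) : ‖Complex.sin (Real.pi * z)‖ ≤ Real.exp (Real.pi * |z.im|) := by
  refine le_of_sq_le_sq ?_ (Real.exp_pos _).le
  rw [normSq_sin]
  simp only [Complex.re_ofReal_mul, Complex.im_ofReal_mul]
  have h1 := Real.sin_sq_le_one (Real.pi * z.re)
  have h2 := Real.cosh_sq (Real.pi * z.im)
  have h3 : Real.cosh (Real.pi * z.im) ≤ Real.exp (Real.pi * |z.im|) := by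
    rw [← Real.cosh_abs, abs_mul, abs_of_pos Real.pi_pos, Real.cosh_eq]
    have : Real.exp (-(Real.pi * |z.im|)) ≤ Real.exp (Real.pi * |z.im|) := by
      apply Real.exp_le_exp.2
      have : 0 ≤ Real.pi * |z.im| := by positivity
      linarith
    linarith
  have h4 : Real.cosh (Real.pi * z.im) ^ 2 ≤ Real.exp (Real.pi * |z.im|) ^ 2 := by
    have := Real.cosh_pos (Real.pi * z.im)
    gcongr
  linarith

/-- The entire function `sin (π z) / (z - n)`. -/
def sinKernel (n : ℤ) : ℂ → ℂ := dslope (fun z : ℂ => Complex.sin (Real.pi * z)) n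

theorem sin_pi_mul_intCast (n : ℤ) : Complex.sin (Real.pi * n) = 0 :=
  sin_pi_mul_eq_zero_iff.2 ⟨n, rfl⟩

theorem sub_mul_sinKernel (n : ℤ) (z : ℂ) :
    (z - n) * sinKernel n z = Complex.sin (Real.pi * z) := by
  have := sub_smul_dslope (fun z : ℂ => Complex.sin (Real.pi * z)) n z
  rwa [sin_pi_mul_intCast, sub_zero, smul_eq_mul] at this

theorem differentiable_sinKernel (n : ℤ) : Differentiable ℂ (sinKernel n) :=
  differentiable_dslope (by fun_prop) _

theorem sinKernel_of_ne {n : ℤ} {z : ℂ} (h : z ≠ n) :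
    sinKernel n z = Complex.sin (Real.pi * z) / (z - n) := by
  rw [← sub_mul_sinKernel n z, mul_div_cancel_left₀]
  exact sub_ne_zero.2 h

theorem sinKernel_int_of_ne {n m : ℤ} (h : m ≠ n) : sinKernel n m = 0 := by
  rw [sinKernel_of_ne (by exact_mod_cast h), sin_pi_mul_intCast, zero_div]

theorem norm_sinKernel_le_of_one_le {n : ℤ} {z : ℂ} (h : 1 ≤ ‖z - n‖) :
    ‖sinKernel n z‖ ≤ Real.exp (Real.pi * |z.im|) / ‖z - n‖ := by
  have hne : z ≠ n := fun h' => by rw [h', sub_self, norm_zero] at h; linarith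
  rw [sinKernel_of_ne hne, norm_div]
  gcongr
  exact norm_sin_pi_mul_le z

theorem norm_sinKernel_le (n : ℤ) (z : ℂ) :
    ‖sinKernel n z‖ ≤ Real.exp Real.pi * Real.exp (Real.pi * |z.im|) := by
  have he : (1 : ℝ) ≤ Real.exp Real.pi := Real.one_le_exp Real.pi_pos.le
  have he' : (1 : ℝ) ≤ Real.exp (Real.pi * |z.im|) := Real.one_le_exp (by positivity)
  rcases le_or_gt 1 ‖z - n‖ with h | h
  · refine (norm_sinKernel_le_of_one_le h).trans ((div_le_self (Real.exp_pos _).le h).trans ?_)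
    nlinarith
  · have key : ‖sinKernel n z‖ ≤ Real.exp Real.pi := by
      refine Complex.norm_le_of_forall_mem_frontier_norm_le (U := Metric.ball (n : ℂ) 1)
        Metric.isBounded_ball (differentiable_sinKernel n).diffContOnCl (fun w hw => ?_)
        (subset_closure (by simpa [dist_eq_norm] using h))
      rw [frontier_ball _ one_ne_zero, mem_sphere_iff_norm] at hw
      refine (norm_sinKernel_le_of_one_le hw.ge).trans ?_
      rw [hw, div_one]
      apply Real.exp_le_exp.2
      have := Complex.abs_im_le_norm (w - n)
      simp only [Complex.sub_im, Complex.intCast_im, sub_zero] at this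
      nlinarith [Real.pi_pos]
    nlinarith

/-- Growth in z is traded for decay in n through 1 + |n| ≤ 2(1 + |z|)|z − n| when |z − n| ≥ 1.
Coefficients such as E(n) conj h(n), summable only after division by 1 + |n|, thus become
admissible. -/
theorem norm_sinKernel_le_div (n : ℤ) (z : ℂ) :
    ‖sinKernel n z‖ ≤ 2 * Real.exp Real.pi * (1 + ‖z‖) * Real.exp (Real.pi * |z.im|) / (1 + |(n : ℝ)|) := by
  have he : (1 : ℝ) ≤ Real.exp Real.pi := Real.one_le_exp Real.pi_pos.le
  have hn : |(n : ℝ)| ≤ ‖z - n‖ + ‖z‖ := by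
    rw [← Complex.norm_intCast, norm_sub_rev]
    simpa using norm_add_le ((n : ℂ) - z) z
  have hz := norm_nonneg z
  have hexp := Real.exp_pos (Real.pi * |z.im|)
  rw [le_div_iff₀ (by positivity)]
  rcases le_or_gt 1 ‖z - n‖ with h | h
  · have h1 : 1 + |(n : ℝ)| ≤ 2 * (1 + ‖z‖) * ‖z - n‖ := by nlinarith
    have hpos : 0 < ‖z - n‖ := by linarith
    calc ‖sinKernel n z‖ * (1 + |(n : ℝ)|)
        ≤ Real.exp (Real.pi * |z.im|) / ‖z - n‖ * (2 * (1 + ‖z‖) * ‖z - n‖) := by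
          gcongr
          exact norm_sinKernel_le_of_one_le h
      _ = 2 * 1 * (1 + ‖z‖) * Real.exp (Real.pi * |z.im|) := by field_simp
      _ ≤ _ := by gcongr
  · calc ‖sinKernel n z‖ * (1 + |(n : ℝ)|)
        ≤ Real.exp Real.pi * Real.exp (Real.pi * |z.im|) * (2 * (1 + ‖z‖)) := by
          gcongr
          · exact norm_sinKernel_le n z
          · linarith
      _ = _ := by ring

/-- The entire function `sin (π z) ∑ b n / (z - n)`. -/
def sinSum (b : ℤ → ℂ) (z : ℂ) : ℂ := ∑' n, b n * sinKernel n z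

theorem norm_mul_sinKernel_le (b : ℤ → ℂ) (n : ℤ) (z : ℂ) : ‖b n * sinKernel n z‖ ≤
    ‖b n‖ / (1 + |(n : ℝ)|) * (2 * Real.exp Real.pi * (1 + ‖z‖) * Real.exp (Real.pi * |z.im|)) := by
  rw [norm_mul]
  calc _ ≤ ‖b n‖ * (2 * Real.exp Real.pi * (1 + ‖z‖) * Real.exp (Real.pi * |z.im|) / (1 + |(n : ℝ)|)) := by
        gcongr; exact norm_sinKernel_le_div n z
    _ = _ := by ring

theorem differentiable_sinSum {b : ℤ → ℂ} (hb : Summable fun n : ℤ => ‖b n‖ / (1 + |(n : ℝ)|)) :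
    Differentiable ℂ (sinSum b) := by
  intro z
  have := Complex.differentiableOn_tsum_of_summable_norm (U := Metric.ball (0 : ℂ) (‖z‖ + 1))
    (F := fun n w => b n * sinKernel n w)
    (u := fun n => ‖b n‖ / (1 + |(n : ℝ)|) *
      (2 * Real.exp Real.pi * (1 + (‖z‖ + 1)) * Real.exp (Real.pi * (‖z‖ + 1))))
    (hb.mul_right _) (fun n => ((differentiable_sinKernel n).const_mul _).differentiableOn)
    Metric.isOpen_ball (fun n w hw => by
      rw [mem_ball_zero_iff] at hw
      refine (norm_mul_sinKernel_le b n w).trans ?_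
      have : |w.im| ≤ ‖z‖ + 1 := (Complex.abs_im_le_norm w).trans hw.le
      gcongr)
  exact this.differentiableAt (Metric.isOpen_ball.mem_nhds (by simp))

theorem norm_sinSum_le {b : ℤ → ℂ} (hb : Summable fun n : ℤ => ‖b n‖ / (1 + |(n : ℝ)|))
    (z : ℂ) : ‖sinSum b z‖ ≤ (∑' n : ℤ, ‖b n‖ / (1 + |(n : ℝ)|)) *
    (2 * Real.exp Real.pi * (1 + ‖z‖) * Real.exp (Real.pi * |z.im|)) := by
  rw [← tsum_mul_right]
  exact tsum_of_norm_bounded (hb.mul_right _).hasSum fun n => norm_mul_sinKernel_le b n z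

theorem norm_sinSum_le' {b : ℤ → ℂ} (hb : Summable fun n => ‖b n‖) (z : ℂ) :
    ‖sinSum b z‖ ≤ (∑' n, ‖b n‖) * (Real.exp Real.pi * Real.exp (Real.pi * |z.im|)) := by
  rw [← tsum_mul_right]
  refine tsum_of_norm_bounded (hb.mul_right _).hasSum fun n => ?_
  rw [norm_mul]
  gcongr
  exact norm_sinKernel_le n z

theorem sinSum_int (b : ℤ → ℂ) (m : ℤ) : sinSum b m = b m * sinKernel m m := by
  rw [sinSum, tsum_eq_single m]
  intro n hn
  rw [sinKernel_int_of_ne hn.symm, mul_zero]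

theorem sinSum_of_ne (b : ℤ → ℂ) {z : ℂ} (hz : ∀ n : ℤ, z ≠ n) :
    sinSum b z = Complex.sin (Real.pi * z) * ∑' n : ℤ, b n / (z - n) := by
  rw [sinSum, ← tsum_mul_left]
  congr 1
  funext n
  rw [sinKernel_of_ne (hz n)]
  ring

theorem summable_div_of_summable_sq {a h : ℤ → ℂ}
    (ha : Summable fun n : ℤ => (‖a n‖ / (1 + |(n : ℝ)|)) ^ 2) (hh : Summable fun n => ‖h n‖ ^ 2) :
    Summable fun n : ℤ => ‖a n * (starRingEnd ℂ) (h n)‖ / (1 + |(n : ℝ)|) := by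
  refine Summable.of_nonneg_of_le (fun n => by positivity) (fun n => ?_) (ha.add hh)
  rw [norm_mul, RCLike.norm_conj]
  have h1 : ‖a n‖ * ‖h n‖ / (1 + |(n : ℝ)|) = ‖a n‖ / (1 + |(n : ℝ)|) * ‖h n‖ := by ring
  rw [h1]
  nlinarith [sq_nonneg (‖a n‖ / (1 + |(n : ℝ)|)), sq_nonneg ‖h n‖,
    sq_nonneg (‖a n‖ / (1 + |(n : ℝ)|) - ‖h n‖)]

theorem summable_norm_sq_expTransform_int (ψ : L2) : Summable fun n : ℤ => ‖expTransform ψ n‖ ^ 2 := by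
  simpa using summable_norm_sq_expTransform ψ 0

/-- The numerator is O((1 + |z|) e^{2π|Im z|}) and division by the sine removes one π. At the
half-integers |sin πz| = 1, so |Q| is at most a constant times (1 + |n|)|h| + |E| there; on the
imaginary axis the lower bound for the sine plays the same part. -/
theorem isPaleyWienerOne_of_sin_mul_eq {h E Q : ℂ → ℂ} {b f : ℤ → ℂ} (hPW : IsPaleyWiener h)
    (hE : IsPaleyWienerOne E) (hb : Summable fun n : ℤ => ‖b n‖ / (1 + |(n : ℝ)|))
    (hf1 : Summable fun n => ‖f n‖) (hQ : Differentiable ℂ Q)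
    (hNQ : ∀ z, h z * sinSum b z - E z * sinSum f z = Complex.sin (Real.pi * z) * Q z) :
    IsPaleyWienerOne Q := by
  obtain ⟨Ch, hCh⟩ := hPW.bound
  obtain ⟨CE, hCE⟩ := hE.bound
  obtain ⟨Kb, hKb0, hKb⟩ : ∃ K, 0 ≤ K ∧ ∀ z, ‖sinSum b z‖ ≤ K * (1 + ‖z‖) * Real.exp (Real.pi * |z.im|) :=
    ⟨(∑' n : ℤ, ‖b n‖ / (1 + |(n : ℝ)|)) * (2 * Real.exp Real.pi),
      mul_nonneg (tsum_nonneg fun n => by positivity) (by positivity),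
      fun z => (norm_sinSum_le hb z).trans_eq (by ring)⟩
  obtain ⟨Kf, hKf0, hKf⟩ : ∃ K, 0 ≤ K ∧ ∀ z, ‖sinSum f z‖ ≤ K * Real.exp (Real.pi * |z.im|) :=
    ⟨(∑' n : ℤ, ‖f n‖) * Real.exp Real.pi,
      mul_nonneg (tsum_nonneg fun n => by positivity) (by positivity),
      fun z => (norm_sinSum_le' hf1 z).trans_eq (by ring)⟩
  have hCh0 : 0 ≤ Ch := by simpa using (norm_nonneg _).trans (hCh 0)
  have hCE0 : 0 ≤ CE := by simpa using (norm_nonneg _).trans (hCE 0)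
  have hN : ∀ z, ‖Complex.sin (Real.pi * z) * Q z‖ ≤
      ‖h z‖ * (Kb * (1 + ‖z‖) * Real.exp (Real.pi * |z.im|)) + ‖E z‖ * (Kf * Real.exp (Real.pi * |z.im|)) := by
    intro z
    rw [← hNQ z]
    refine (norm_sub_le _ _).trans ?_
    rw [norm_mul, norm_mul]
    gcongr
    · exact hKb z
    · exact hKf z
  refine ⟨hQ, ⟨4 * (Ch * Kb + CE * Kf) * 2 ^ 1 * Real.exp Real.pi, fun z => ?_⟩, ?_, ?_⟩
  · have := norm_le_of_sin_mul hQ (M := Ch * Kb + CE * Kf) (κ := Real.pi) (by positivity)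
      Real.pi_pos.le (j := 1) (fun z => by
        refine (hN z).trans ?_
        rw [add_mul Real.pi, Real.exp_add]
        calc _ ≤ Ch * Real.exp (Real.pi * |z.im|) * (Kb * (1 + ‖z‖) * Real.exp (Real.pi * |z.im|)) +
              CE * (1 + ‖z‖) * Real.exp (Real.pi * |z.im|) * (Kf * Real.exp (Real.pi * |z.im|)) := by
              gcongr
              · exact hCh z
              · exact hCE z
          _ = _ := by ring) z
    simpa using this
  · have hs : Summable fun n : ℤ => 2 * ((2 * Kb) ^ 2 * ‖h ((n + 1 / 2 : ℝ) : ℂ)‖ ^ 2) +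
        2 * (Kf ^ 2 * (‖E ((n + 1 / 2 : ℝ) : ℂ)‖ / (1 + |(n : ℝ)|)) ^ 2) :=
      ((hPW.summable.mul_left _).mul_left _).add ((hE.summable.mul_left _).mul_left _)
    refine Summable.of_nonneg_of_le (fun n => by positivity) (fun n => ?_) hs
    have h1 := hN ((n + 1 / 2 : ℝ) : ℂ)
    have hsin : ‖Complex.sin (Real.pi * ((n + 1 / 2 : ℝ) : ℂ))‖ = 1 := by
      have : (Real.pi : ℂ) * ((n + 1 / 2 : ℝ) : ℂ) = ((Real.pi / 2 + n * Real.pi : ℝ) : ℂ) := by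
        push_cast; ring
      rw [this, ← Complex.ofReal_sin, Complex.norm_real, Real.sin_add_int_mul_pi, Real.sin_pi_div_two]
      simp
    rw [norm_mul, hsin, one_mul] at h1
    simp only [Complex.ofReal_im, abs_zero, mul_zero, Real.exp_zero, mul_one] at h1
    have h2 : 1 + ‖((n + 1 / 2 : ℝ) : ℂ)‖ ≤ 2 * (1 + |(n : ℝ)|) := by
      rw [Complex.norm_real, Real.norm_eq_abs]
      have : |(n : ℝ) + 1 / 2| ≤ |(n : ℝ)| + 1 / 2 := (abs_add_le _ _).trans (by norm_num)
      linarith [abs_nonneg (n : ℝ)]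
    have h3 : ‖Q ((n + 1 / 2 : ℝ) : ℂ)‖ / (1 + |(n : ℝ)|) ≤ 2 * Kb * ‖h ((n + 1 / 2 : ℝ) : ℂ)‖ +
        Kf * (‖E ((n + 1 / 2 : ℝ) : ℂ)‖ / (1 + |(n : ℝ)|)) := by
      rw [div_le_iff₀ (by positivity)]
      have h4 : ‖E ((n + 1 / 2 : ℝ) : ℂ)‖ / (1 + |(n : ℝ)|) * (1 + |(n : ℝ)|) =
        ‖E ((n + 1 / 2 : ℝ) : ℂ)‖ := div_mul_cancel₀ _ (by positivity)
      rw [add_mul, mul_assoc Kf, h4]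
      refine h1.trans ?_
      calc _ ≤ ‖h ((n + 1 / 2 : ℝ) : ℂ)‖ * (Kb * (2 * (1 + |(n : ℝ)|))) +
            ‖E ((n + 1 / 2 : ℝ) : ℂ)‖ * Kf := by gcongr
        _ = _ := by ring
    calc _ ≤ (2 * Kb * ‖h ((n + 1 / 2 : ℝ) : ℂ)‖ +
        Kf * (‖E ((n + 1 / 2 : ℝ) : ℂ)‖ / (1 + |(n : ℝ)|))) ^ 2 := by gcongr
      _ ≤ _ := by nlinarith [sq_nonneg (2 * Kb * ‖h ((n + 1 / 2 : ℝ) : ℂ)‖ -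
        Kf * (‖E ((n + 1 / 2 : ℝ) : ℂ)‖ / (1 + |(n : ℝ)|)))]
  · have hl := (hPW.tendsto.const_mul (8 * Kb)).add (hE.tendsto.const_mul (4 * Kf))
    rw [mul_zero, mul_zero, add_zero] at hl
    refine squeeze_zero' ?_ ?_ hl
    · filter_upwards [eventually_ge_atTop 0] with y hy
      positivity
    · filter_upwards [eventually_ge_atTop 1] with y hy
      have hy0 : 0 < y := by linarith
      have h1 := le_norm_sin_of_forall_int (z := Complex.I * y) (fun n => by
        have := Complex.abs_im_le_norm (Complex.I * y - n)
        simp only [Complex.sub_im, Complex.I_mul_im, Complex.ofReal_re, Complex.intCast_im, sub_zero] at this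
        exact (by linarith : (1 / 2 : ℝ) ≤ y).trans ((le_abs_self y).trans this))
      have h2 := hN (Complex.I * y)
      have h3 : |(Complex.I * y).im| = y := by simp; linarith
      have h4 : ‖Complex.I * y‖ = y := by simp; linarith
      rw [h3] at h1
      rw [norm_mul, h3, h4] at h2
      set e := Real.exp (Real.pi * y) with he
      have hepos : 0 < e := Real.exp_pos _
      have h5 : 1 / 4 * e * ‖Q (Complex.I * y)‖ ≤
          ‖h (Complex.I * y)‖ * (Kb * (1 + y) * e) + ‖E (Complex.I * y)‖ * (Kf * e) :=
        (mul_le_mul_of_nonneg_right h1 (norm_nonneg _)).trans h2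
      have h6 : ‖Q (Complex.I * y)‖ ≤
          4 * (‖h (Complex.I * y)‖ * (Kb * (1 + y)) + ‖E (Complex.I * y)‖ * Kf) := by
        refine le_of_mul_le_mul_left ?_ hepos
        linarith
      rw [Real.exp_neg, ← he, div_le_iff₀ hy0]
      have h7 : ‖h (Complex.I * y)‖ * (Kb * (1 + y)) ≤ ‖h (Complex.I * y)‖ * (Kb * (2 * y)) := by
        gcongr; linarith
      have h8 : (8 * Kb * (‖h (Complex.I * y)‖ * e⁻¹) + 4 * Kf * (‖E (Complex.I * y)‖ * e⁻¹ / y)) * y =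
        4 * (‖h (Complex.I * y)‖ * (Kb * (2 * y)) + ‖E (Complex.I * y)‖ * Kf) * e⁻¹ := by
        field_simp; ring
      rw [h8]
      gcongr
      linarith

/-- Since the transform of the biorthogonal vector at n is cE(n)/(n − m), Parseval turns the
orthogonality (χ, w_m) = 0 into the conjugate of the vanishing of Σ E(n) conj h(n)/(m − n). -/
theorem IsGenerator.sinSum_eq_zero {Λ : Set ℂ} {E : ℂ → ℂ} (hE : IsGenerator Λ E)
    (hΛ : IsComplete (Set.range (expSystem Λ))) (hΛℤ : ∀ n : ℤ, (n : ℂ) ∉ Λ) {w : Λ → L2}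
    (hw : IsBiorthogonal (expSystem Λ) w) {χ : L2} {m : Λ} (hB : inner ℂ χ (w m) = 0) :
    sinSum (fun n => E n * (starRingEnd ℂ) (expTransform χ n)) m = 0 := by
  set b : ℤ → ℂ := fun n => E n * (starRingEnd ℂ) (expTransform χ n) with hb_def
  have hne : ∀ n : ℤ, (m : ℂ) ≠ n := fun n hn => hΛℤ n (hn ▸ m.2)
  rw [sinSum_of_ne b hne]
  have h1 := hasSum_inner_expTransform hΛ χ (w m)
  rw [hB, mul_zero] at h1
  obtain ⟨c, hc, hcE⟩ := hE.expTransform_eq hw m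
  have h2 : ∀ n : ℤ, expTransform χ n * (starRingEnd ℂ) (expTransform (w m) n) =
      - (starRingEnd ℂ) (c * (b n / (m - n))) := fun n => by
    have h3 : expTransform (w m) n = c * E n / (n - m) := by
      rw [← hcE n, mul_div_cancel_left₀]
      exact sub_ne_zero.2 (hne n).symm
    have h4 : (m : ℂ) - n = -(n - m) := by ring
    rw [h3, h4]
    simp only [hb_def, map_mul, map_div₀, map_neg, Complex.conj_conj, div_neg, mul_neg, neg_neg]
    ring
  simp_rw [h2] at h1
  have h5 := h1.neg
  simp only [neg_neg, neg_zero] at h5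
  have h6 : HasSum (fun n : ℤ => c * (b n / (m - n))) 0 := by
    have := h5.star
    simpa only [star_zero, RCLike.star_def, Complex.conj_conj] using this
  have h7 := h6.tsum_eq
  rw [tsum_mul_left] at h7
  rw [(mul_eq_zero.1 h7).resolve_left hc, mul_zero]

/-- If `h` is the transform of a vector orthogonal to a mixed system, then
`E (c + ∑ |h n|² / (z - n)) = h ∑ E n conj (h n) / (z - n)` for some constant `c`. -/
theorem IsGenerator.exists_const {Λ : Set ℂ} {E : ℂ → ℂ} (hE : IsGenerator Λ E)
    (hΛ : IsComplete (Set.range (expSystem Λ))) (hΛℤ : ∀ n : ℤ, (n : ℂ) ∉ Λ) {w : Λ → L2}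
    (hw : IsBiorthogonal (expSystem Λ) w) {A : Set Λ} {χ : L2}
    (hA : ∀ m ∈ A, inner ℂ χ (expSystem Λ m) = 0) (hB : ∀ m ∈ Aᶜ, inner ℂ χ (w m) = 0) :
    ∃ c : ℂ, ∀ z : ℂ, (∀ n : ℤ, z ≠ n) →
      E z * (c + ∑' n : ℤ, ((‖expTransform χ n‖ ^ 2 : ℝ) : ℂ) / (z - n)) =
        expTransform χ z * ∑' n : ℤ, E n * (starRingEnd ℂ) (expTransform χ n) / (z - n) := by
  set h := expTransform χ with hh
  set b : ℤ → ℂ := fun n => E n * (starRingEnd ℂ) (h n) with hb_def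
  set f : ℤ → ℂ := fun n => ((‖h n‖ ^ 2 : ℝ) : ℂ) with hf_def
  have hPW := isPaleyWiener_expTransform χ
  have hhsum : Summable fun n : ℤ => ‖h n‖ ^ 2 := summable_norm_sq_expTransform_int χ
  have hb : Summable fun n : ℤ => ‖b n‖ / (1 + |(n : ℝ)|) :=
    summable_div_of_summable_sq (a := fun n : ℤ => E n) (h := fun n : ℤ => h n) hE.summable_int hhsum
  have hfn : ∀ n, ‖f n‖ = ‖h n‖ ^ 2 := fun n => by
    simp only [hf_def, Complex.norm_real, Real.norm_eq_abs]
    exact abs_of_nonneg (by positivity)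
  have hf1 : Summable fun n => ‖f n‖ := by simp_rw [hfn]; exact hhsum
  have hf : Summable fun n : ℤ => ‖f n‖ / (1 + |(n : ℝ)|) :=
    hf1.of_nonneg_of_le (fun n => by positivity)
      (fun n => div_le_self (norm_nonneg _) (by linarith [abs_nonneg (n : ℝ)]))
  have hEd := hE.isPaleyWienerOne.differentiable
  have hhd := hPW.differentiable
  -- At an integer only one term of each sum survives, and h(n) · E(n) conj h(n) = E(n) · |h(n)|².
  obtain ⟨Q, hQ, hNQ⟩ := exists_eq_sin_mul (N := fun z => h z * sinSum b z - E z * sinSum f z)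
    ((hhd.mul (differentiable_sinSum hb)).sub (hEd.mul (differentiable_sinSum hf))) (fun n => by
      simp only [sinSum_int, hb_def, hf_def]
      have : ((‖h n‖ ^ 2 : ℝ) : ℂ) = h n * (starRingEnd ℂ) (h n) := by
        rw [Complex.mul_conj, Complex.normSq_eq_norm_sq]
      rw [this]; ring)
  have hQPW := isPaleyWienerOne_of_sin_mul_eq hPW hE.isPaleyWienerOne hb hf1 hQ hNQ
  -- On Λ the term with E drops out; the other one vanishes through h on A, and through the sum off
  -- A.
  have hQ0 : ∀ z ∈ Λ, Q z = 0 := fun z hz => by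
    have hne : Complex.sin (Real.pi * z) ≠ 0 := fun h0 => by
      obtain ⟨n, rfl⟩ := sin_pi_mul_eq_zero_iff.1 h0
      exact hΛℤ n hz
    refine (mul_eq_zero.1 ?_).resolve_left hne
    rw [← hNQ z, (hE.eq_zero_iff z).2 hz, zero_mul, sub_zero]
    by_cases hzA : (⟨z, hz⟩ : Λ) ∈ A
    · have hz0 : expTransform χ z = 0 := hA ⟨z, hz⟩ hzA
      rw [hh, hz0, zero_mul]
    · rw [hE.sinSum_eq_zero hΛ hΛℤ hw (m := ⟨z, hz⟩) (hB _ hzA), mul_zero]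
  have hfin := hE.unique Q hQPW hQ0
  refine ⟨Q 0, fun z hz => ?_⟩
  have hne : Complex.sin (Real.pi * z) ≠ 0 := fun h0 => by
    obtain ⟨n, rfl⟩ := sin_pi_mul_eq_zero_iff.1 h0
    exact hz n rfl
  have h1 := hNQ z
  rw [hfin z, sinSum_of_ne b hz, sinSum_of_ne f hz] at h1
  refine mul_left_cancel₀ hne ?_
  linear_combination (-1 : ℂ) * h1

/-! ### The weak type (1,1) bound for Cauchy transforms of point masses -/

section

/-- The Cauchy transform of a finite sum of point masses on the real line. -/
def cauchySum {ι : Type*} (s : Finset ι) (a : ι → ℝ) (m : ι → ℂ) (z : ℂ) : ℂ :=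
  ∑ i ∈ s, m i / (z - a i)

theorem div_one_add_re_nonneg {q : ℂ} (hq : 0 ≤ q.re) : 0 ≤ (q / (1 + q)).re := by
  rw [Complex.div_re, ← add_div]
  refine div_nonneg ?_ (Complex.normSq_nonneg _)
  simp only [Complex.add_re, Complex.one_re, Complex.add_im, Complex.one_im, zero_add]
  nlinarith [mul_self_nonneg q.re, mul_self_nonneg q.im]

theorem one_le_norm_one_add {q : ℂ} (hq : 0 ≤ q.re) : 1 ≤ ‖1 + q‖ := by
  refine le_trans ?_ (Complex.re_le_norm _)
  simp [hq]

section Positive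

variable {ι : Type*} {s : Finset ι} {a : ι → ℝ} {m : ι → ℝ}

theorem im_cauchySum_nonpos (hm : ∀ i ∈ s, 0 ≤ m i) {z : ℂ} (hz : 0 ≤ z.im) :
    (cauchySum s a (fun i => (m i : ℂ)) z).im ≤ 0 := by
  rw [cauchySum, Complex.im_sum]
  refine Finset.sum_nonpos fun i hi => ?_
  rw [Complex.div_im]
  simp only [Complex.ofReal_im, Complex.sub_re, Complex.ofReal_re, zero_mul, zero_div, Complex.sub_im,
    sub_zero, zero_sub, Left.neg_nonpos_iff]
  exact div_nonneg (mul_nonneg (hm i hi) hz) (Complex.normSq_nonneg _)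

theorem norm_cauchySum_le {b : ι → ℂ} {z : ℂ} {r : ℝ} (hr : 0 < r) (hz : ∀ i ∈ s, r ≤ ‖z - a i‖) :
    ‖cauchySum s a b z‖ ≤ (∑ i ∈ s, ‖b i‖) / r := by
  rw [cauchySum, Finset.sum_div]
  refine norm_sum_le_of_le _ fun i hi => ?_
  rw [norm_div]
  have := hz i hi
  gcongr

/-- The bounded analytic function used for the weak type estimate. -/
def cayleySum (s : Finset ι) (a : ι → ℝ) (m : ι → ℝ) (t : ℝ) (z : ℂ) : ℂ :=
  (Complex.I * cauchySum s a (fun i => (m i : ℂ)) z / t) /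
    (1 + Complex.I * cauchySum s a (fun i => (m i : ℂ)) z / t)

theorem re_I_mul_cauchySum_nonneg (hm : ∀ i ∈ s, 0 ≤ m i) {t : ℝ} (ht : 0 < t) {z : ℂ} (hz : 0 ≤ z.im) :
    0 ≤ (Complex.I * cauchySum s a (fun i => (m i : ℂ)) z / t).re := by
  rw [Complex.div_ofReal_re, Complex.I_mul_re]
  exact div_nonneg (by linarith [im_cauchySum_nonpos (a := a) hm hz]) ht.le

theorem norm_cayleySum_le (hm : ∀ i ∈ s, 0 ≤ m i) {t : ℝ} (ht : 0 < t) {z : ℂ} (hz : 0 ≤ z.im) :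
    ‖cayleySum s a m t z‖ ≤ ‖cauchySum s a (fun i => (m i : ℂ)) z‖ / t := by
  have h1 := one_le_norm_one_add (re_I_mul_cauchySum_nonneg (a := a) hm ht hz)
  rw [cayleySum, norm_div]
  refine (div_le_self (norm_nonneg _) h1).trans_eq ?_
  rw [norm_div, norm_mul, Complex.norm_I, one_mul, Complex.norm_real, Real.norm_eq_abs, abs_of_pos ht]

theorem differentiableAt_cauchySum {b : ι → ℂ} {z : ℂ} (hz : ∀ i ∈ s, z ≠ a i) :
    DifferentiableAt ℂ (cauchySum s a b) z := by
  refine DifferentiableAt.fun_sum fun i hi => ?_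
  exact (differentiableAt_const _).div ((differentiableAt_id).sub_const _) (sub_ne_zero.2 (hz i hi))

theorem differentiableAt_cayleySum (hm : ∀ i ∈ s, 0 ≤ m i) {t : ℝ} (ht : 0 < t) {z : ℂ} (hz : 0 ≤ z.im)
    (hza : ∀ i ∈ s, z ≠ a i) : DifferentiableAt ℂ (cayleySum s a m t) z := by
  have h1 := one_le_norm_one_add (re_I_mul_cauchySum_nonneg (a := a) hm ht hz)
  have h2 := (differentiableAt_cauchySum (b := fun i => (m i : ℂ)) hza).const_mul Complex.I
  have h3 := h2.div_const (t : ℂ)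
  exact h3.div (h3.const_add 1) (fun h => by rw [h, norm_zero] at h1; linarith)

theorem ne_ofReal_of_im_pos {z : ℂ} (hz : 0 < z.im) (x : ℝ) : z ≠ x := fun h => by
  rw [h] at hz; simp at hz

/-- With q = iC/t, where C is the Cauchy sum, Re q ≥ 0 in the upper half-plane, so q/(1 + q) is
analytic there and bounded by |C|/t. Cauchy's theorem moves the integral to the other three sides of
a rectangle, of total length 4R, where that bound is 2M/(Rt), M being the total mass. -/
theorem integral_re_cayleySum_le (hm : ∀ i ∈ s, 0 ≤ m i) {t : ℝ} (ht : 0 < t) {A R : ℝ}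
    (hA : ∀ i ∈ s, |a i| ≤ A) (hR : 2 * A ≤ R) (hR0 : 0 < R) {η : ℝ} (hη : 0 < η) :
    ∫ x in (-R)..R, (cayleySum s a m t (x + η * Complex.I)).re ≤ 8 * (∑ i ∈ s, m i) / t := by
  set f := cayleySum s a m t with hf
  set M := ∑ i ∈ s, m i with hM
  have hMnn : 0 ≤ M := Finset.sum_nonneg hm
  have hMn : ∑ i ∈ s, ‖(m i : ℂ)‖ = M := Finset.sum_congr rfl fun i hi => by
    rw [Complex.norm_real, Real.norm_eq_abs, abs_of_nonneg (hm i hi)]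
  have hdiff : ∀ z : ℂ, 0 < z.im → DifferentiableAt ℂ f z := fun z hz =>
    differentiableAt_cayleySum hm ht hz.le fun i _ => ne_ofReal_of_im_pos hz _
  have hcauchy := Complex.integral_boundary_rect_eq_zero_of_differentiableOn f (-R + η * Complex.I)
    (R + (η + R) * Complex.I) (fun z hz => (hdiff z (by
      have h1 := hz.2
      simp only [Set.mem_preimage, Complex.add_im, Complex.neg_im, Complex.ofReal_im, Complex.mul_im,
        Complex.ofReal_re, Complex.I_im, Complex.I_re, Complex.add_re] at h1
      have h2 := h1.1
      norm_num at h2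
      rcases h2 with h2 | h2 <;> linarith)).differentiableWithinAt)
  simp only [Complex.add_im, Complex.neg_im, Complex.ofReal_im, Complex.mul_im, Complex.ofReal_re,
    Complex.I_im, Complex.I_re, Complex.add_re, Complex.neg_re, Complex.mul_re, mul_zero, mul_one,
    add_zero, zero_add, neg_zero, sub_self, Complex.ofReal_add, Complex.ofReal_neg] at hcauchy
  have hbound : ∀ z : ℂ, 0 < z.im → R ≤ |z.re| ∨ R ≤ z.im → ‖f z‖ ≤ 2 * M / (R * t) := fun z hz h => by
    refine (norm_cayleySum_le hm ht hz.le).trans ?_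
    have h1 : ∀ i ∈ s, R / 2 ≤ ‖z - a i‖ := fun i hi => by
      rcases h with h | h
      · have h2 := Complex.abs_re_le_norm (z - a i)
        rw [Complex.sub_re, Complex.ofReal_re] at h2
        have h3 := abs_sub_abs_le_abs_sub z.re (a i)
        linarith [hA i hi]
      · have h2 := Complex.abs_im_le_norm (z - a i)
        rw [Complex.sub_im, Complex.ofReal_im, sub_zero] at h2
        linarith [le_abs_self z.im]
    have h4 := norm_cauchySum_le (b := fun i => (m i : ℂ)) (by positivity : 0 < R / 2) h1
    rw [hMn] at h4
    calc _ ≤ M / (R / 2) / t := by gcongr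
      _ = _ := by field_simp
  set K := 2 * M / (R * t) with hK
  have b1 : ‖∫ x in (-R)..R, f (x + (η + R) * Complex.I)‖ ≤ K * |R - -R| :=
    intervalIntegral.norm_integral_le_of_norm_le_const fun x _ =>
      hbound _ (by simp; linarith) (Or.inr (by simp; linarith))
  have b2 : ‖∫ y in η..(η + R), f (R + y * Complex.I)‖ ≤ K * |η + R - η| :=
    intervalIntegral.norm_integral_le_of_norm_le_const fun y hy => by
      rw [Set.uIoc_of_le (by linarith)] at hy
      exact hbound _ (by simp; linarith [hy.1]) (Or.inl (by simp [le_abs_self]))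
  have b3 : ‖∫ y in η..(η + R), f (-R + y * Complex.I)‖ ≤ K * |η + R - η| :=
    intervalIntegral.norm_integral_le_of_norm_le_const fun y hy => by
      rw [Set.uIoc_of_le (by linarith)] at hy
      exact hbound _ (by simp; linarith [hy.1]) (Or.inl (by simp [le_abs_self]))
  have hcont : Continuous fun x : ℝ => f (x + η * Complex.I) := by
    rw [continuous_iff_continuousAt]
    intro x
    have h1 : ContinuousAt f ((x : ℂ) + η * Complex.I) := (hdiff _ (by simp [hη])).continuousAt
    exact h1.comp (f := fun x : ℝ => (x : ℂ) + η * Complex.I) (by fun_prop)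
  have hre : ∫ x in (-R)..R, (f (x + η * Complex.I)).re = (∫ x in (-R)..R, f (x + η * Complex.I)).re :=
    (Complex.reCLM.intervalIntegral_comp_comm (hcont.intervalIntegrable _ _))
  rw [hre]
  refine (Complex.re_le_norm _).trans ?_
  have hmain : (∫ x in (-R)..R, f (x + η * Complex.I)) = (∫ x in (-R)..R, f (x + (η + R) * Complex.I))
      - Complex.I • (∫ y in η..(η + R), f (R + y * Complex.I))
      + Complex.I • ∫ y in η..(η + R), f (-R + y * Complex.I) := by
    linear_combination (norm := skip) hcauchy
    simp only [smul_eq_mul]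
    ring
  rw [hmain]
  refine (norm_add_le _ _).trans ?_
  refine (add_le_add_left (norm_sub_le _ _) _).trans ?_
  rw [norm_smul, norm_smul, Complex.norm_I, one_mul, one_mul]
  have e1 : |R - -R| = 2 * R := by rw [abs_of_nonneg] <;> linarith
  have e2 : |η + R - η| = R := by rw [abs_of_nonneg] <;> linarith
  rw [e1] at b1
  rw [e2] at b2 b3
  have e3 : K * R = 2 * M / t := by rw [hK]; field_simp
  have e4 : 8 * M / t = 4 * (2 * M / t) := by ring
  rw [e4, ← e3]
  linarith

/-- At a real point off the poles C is real, and with u = C/t the real part of q/(1 + q) is u²/(1 +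
u²), which is at least 1/2 when |C| ≥ t. Chebyshev's inequality and Fatou's lemma as the line
descends to the real axis give the constant 16 = 2 · 8. -/
theorem volume_le_cauchySum_le (hm : ∀ i ∈ s, 0 ≤ m i) {t : ℝ} (ht : 0 < t) {R : ℝ} (hR0 : 0 < R) :
    volume {x : ℝ | x ∈ Set.Ioc (-R) R ∧ (∀ i ∈ s, x ≠ a i) ∧
      t ≤ ‖cauchySum s a (fun i => (m i : ℂ)) x‖} ≤ ENNReal.ofReal (16 * (∑ i ∈ s, m i) / t) := by
  obtain ⟨A, hA⟩ : ∃ A, ∀ i ∈ s, |a i| ≤ A :=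
    ⟨∑ i ∈ s, |a i|, fun i hi => Finset.single_le_sum (f := fun i => |a i|) (fun i _ => abs_nonneg _) hi⟩
  -- The set grows with R while the bound does not depend on it.
  wlog hRA : 2 * A ≤ R generalizing R
  · refine le_trans (measure_mono fun x hx => ?_) (this (R := max R (2 * A))
      (lt_max_of_lt_left hR0) (le_max_right _ _))
    refine ⟨⟨?_, hx.1.2.trans (le_max_left _ _)⟩, hx.2⟩
    linarith [hx.1.1, le_max_left R (2 * A)]
  set f := cayleySum s a m t with hf
  set M := ∑ i ∈ s, m i with hM
  have hMnn : 0 ≤ M := Finset.sum_nonneg hm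
  set η : ℕ → ℝ := fun n => 1 / ((n : ℝ) + 1) with hη
  have hηpos : ∀ n, 0 < η n := fun n => by positivity
  have hηlim : Tendsto η atTop (𝓝 0) := tendsto_one_div_add_atTop_nhds_zero_nat
  have hcont : ∀ n, Continuous fun x : ℝ => f (x + η n * Complex.I) := fun n => by
    rw [continuous_iff_continuousAt]
    intro x
    have him : 0 < ((x : ℂ) + η n * Complex.I).im := by simp [hηpos n]
    have h1 : ContinuousAt f ((x : ℂ) + η n * Complex.I) :=
      (differentiableAt_cayleySum hm ht him.le fun i _ => ne_ofReal_of_im_pos him _).continuousAt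
    exact h1.comp (f := fun x : ℝ => (x : ℂ) + η n * Complex.I) (by fun_prop)
  set g : ℕ → ℝ → ENNReal := fun n x => ENNReal.ofReal (f (x + η n * Complex.I)).re with hg
  have hgm : ∀ n, Measurable (g n) := fun n =>
    ENNReal.measurable_ofReal.comp (Complex.continuous_re.comp (hcont n)).measurable
  have hint : ∀ n, ∫⁻ x in Set.Ioc (-R) R, g n x ≤ ENNReal.ofReal (8 * M / t) := fun n => by
    rw [← ofReal_integral_eq_lintegral_ofReal]
    · rw [← intervalIntegral.integral_of_le (by linarith)]
      exact ENNReal.ofReal_le_ofReal (integral_re_cayleySum_le hm ht hA hRA hR0 (hηpos n))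
    · exact ((Complex.continuous_re.comp (hcont n)).integrableOn_Icc).mono_set Set.Ioc_subset_Icc_self
    · refine Eventually.of_forall fun x => ?_
      exact div_one_add_re_nonneg (re_I_mul_cauchySum_nonneg hm ht (by simp [(hηpos n).le]))
  have hfatou := lintegral_liminf_le (u := atTop) (μ := volume.restrict (Set.Ioc (-R) R)) hgm
  set S := {x : ℝ | x ∈ Set.Ioc (-R) R ∧ (∀ i ∈ s, x ≠ a i) ∧
      t ≤ ‖cauchySum s a (fun i => (m i : ℂ)) x‖} with hS
  have hlow : ∀ x ∈ S, ENNReal.ofReal (1 / 2) ≤ liminf (fun n => g n x) atTop := fun x hx => by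
    have h1 : Tendsto (fun n => f (x + η n * Complex.I)) atTop (𝓝 (f x)) := by
      have hc : ContinuousAt f (x : ℂ) := (differentiableAt_cayleySum hm ht (by simp) fun i hi h =>
        hx.2.1 i hi (by exact_mod_cast h)).continuousAt
      have h2 : Tendsto (fun n => (x : ℂ) + η n * Complex.I) atTop (𝓝 x) := by
        have h3 : Tendsto (fun n => ((η n : ℝ) : ℂ)) atTop (𝓝 ((0 : ℝ) : ℂ)) :=
          (Complex.continuous_ofReal.tendsto 0).comp hηlim
        simpa using (h3.mul_const Complex.I).const_add (x : ℂ)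
      exact hc.tendsto.comp h2
    have h2 : Tendsto (fun n => g n x) atTop (𝓝 (ENNReal.ofReal (f x).re)) :=
      (ENNReal.continuous_ofReal.tendsto _).comp ((Complex.continuous_re.tendsto _).comp h1)
    rw [h2.liminf_eq]
    apply ENNReal.ofReal_le_ofReal
    obtain ⟨v, hv⟩ : ∃ v : ℝ, cauchySum s a (fun i => (m i : ℂ)) x = v :=
      ⟨∑ i ∈ s, m i / (x - a i), by simp [cauchySum]⟩
    have h3 := hx.2.2
    rw [hv, Complex.norm_real, Real.norm_eq_abs] at h3
    have h4 : f x = (Complex.I * ((v / t : ℝ) : ℂ)) / (1 + Complex.I * ((v / t : ℝ) : ℂ)) := by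
      rw [hf, cayleySum, hv]; push_cast; rw [mul_div_assoc]
    have h5 : 1 ≤ (v / t) ^ 2 := by
      rw [← sq_abs, abs_div, abs_of_pos ht]
      exact one_le_pow₀ ((one_le_div ht).2 h3)
    set u := v / t
    rw [h4, Complex.div_re, ← add_div]
    simp [Complex.normSq_apply]
    rw [le_div_iff₀ (by nlinarith)]
    nlinarith
  have hle : ∫⁻ x in Set.Ioc (-R) R, liminf (fun n => g n x) atTop ≤ ENNReal.ofReal (8 * M / t) :=
    hfatou.trans (liminf_le_of_le (by isBoundedDefault) fun b hb => by
      obtain ⟨n, hn⟩ := hb.exists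
      exact hn.trans (hint n))
  have hcheb := mul_meas_ge_le_lintegral₀ (μ := volume.restrict (Set.Ioc (-R) R))
    (f := fun x => liminf (fun n => g n x) atTop) (Measurable.liminf hgm).aemeasurable (ENNReal.ofReal (1 / 2))
  have hsub : volume S ≤ (volume.restrict (Set.Ioc (-R) R))
      {x | ENNReal.ofReal (1 / 2) ≤ liminf (fun n => g n x) atTop} := by
    rw [Measure.restrict_apply' measurableSet_Ioc]
    exact measure_mono fun x hx => ⟨hlow x hx, hx.1⟩
  have hfin := (mul_le_mul_right hsub (ENNReal.ofReal (1 / 2))).trans (hcheb.trans hle)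
  have h8 : 16 * M / t = 2 * (8 * M / t) := by ring
  rw [h8, ENNReal.ofReal_mul (by norm_num)]
  calc volume S = ENNReal.ofReal 2 * (ENNReal.ofReal (1 / 2) * volume S) := by
        rw [← mul_assoc, ← ENNReal.ofReal_mul (by norm_num)]; norm_num
    _ ≤ _ := by gcongr

end Positive

/-- Weak type estimate for the Cauchy transform of point masses. -/
theorem volume_le_cauchySum_complex_le {ι : Type*} {s : Finset ι} {a : ι → ℝ} (b : ι → ℂ) {t : ℝ}
    (ht : 0 < t) {R : ℝ} (hR0 : 0 < R) :
    volume {x : ℝ | x ∈ Set.Ioc (-R) R ∧ (∀ i ∈ s, x ≠ a i) ∧ t ≤ ‖cauchySum s a b x‖} ≤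
      ENNReal.ofReal (256 * (∑ i ∈ s, ‖b i‖) / t) := by
  set B := ∑ i ∈ s, ‖b i‖ with hB
  set S : (ι → ℝ) → Set ℝ := fun m => {x : ℝ | x ∈ Set.Ioc (-R) R ∧ (∀ i ∈ s, x ≠ a i) ∧
      t / 4 ≤ ‖cauchySum s a (fun i => (m i : ℂ)) x‖} with hS
  have hvol : ∀ m : ι → ℝ, (∀ i, 0 ≤ m i) → (∀ i, m i ≤ ‖b i‖) →
      volume (S m) ≤ ENNReal.ofReal (64 * B / t) := fun m h1 h2 => by
    refine (volume_le_cauchySum_le (fun i _ => h1 i) (by positivity : 0 < t / 4) hR0).trans ?_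
    apply ENNReal.ofReal_le_ofReal
    have : ∑ i ∈ s, m i ≤ B := Finset.sum_le_sum fun i _ => h2 i
    calc _ ≤ 16 * B / (t / 4) := by gcongr
      _ = _ := by field_simp; ring
  -- The weights split into four nonnegative families, each tested at height t/4: 4 · (16 · 4) =
  -- 256.
  set m1 : ι → ℝ := fun i => max (b i).re 0
  set m2 : ι → ℝ := fun i => max (-(b i).re) 0
  set m3 : ι → ℝ := fun i => max (b i).im 0
  set m4 : ι → ℝ := fun i => max (-(b i).im) 0
  have hr := fun i => abs_le.1 (Complex.abs_re_le_norm (b i))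
  have hi := fun i => abs_le.1 (Complex.abs_im_le_norm (b i))
  have v1 := hvol m1 (fun i => le_max_right _ _) (fun i => max_le (hr i).2 (norm_nonneg _))
  have v2 := hvol m2 (fun i => le_max_right _ _) (fun i => max_le (by linarith [(hr i).1]) (norm_nonneg _))
  have v3 := hvol m3 (fun i => le_max_right _ _) (fun i => max_le (hi i).2 (norm_nonneg _))
  have v4 := hvol m4 (fun i => le_max_right _ _) (fun i => max_le (by linarith [(hi i).1]) (norm_nonneg _))
  have hdec : ∀ x : ℂ, cauchySum s a b x = cauchySum s a (fun i => (m1 i : ℂ)) x -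
      cauchySum s a (fun i => (m2 i : ℂ)) x + (Complex.I * cauchySum s a (fun i => (m3 i : ℂ)) x -
      Complex.I * cauchySum s a (fun i => (m4 i : ℂ)) x) := fun x => by
    simp only [cauchySum, Finset.mul_sum]
    rw [← Finset.sum_sub_distrib, ← Finset.sum_sub_distrib, ← Finset.sum_add_distrib]
    refine Finset.sum_congr rfl fun i _ => ?_
    have h1 : (b i).re = m1 i - m2 i := by
      simp only [m1, m2]
      rcases le_total 0 (b i).re with h | h
      · rw [max_eq_left h, max_eq_right (by linarith)]; ring
      · rw [max_eq_right h, max_eq_left (by linarith)]; ring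
    have h2 : (b i).im = m3 i - m4 i := by
      simp only [m3, m4]
      rcases le_total 0 (b i).im with h | h
      · rw [max_eq_left h, max_eq_right (by linarith)]; ring
      · rw [max_eq_right h, max_eq_left (by linarith)]; ring
    have h3 : b i = (m1 i - m2 i : ℝ) + (m3 i - m4 i : ℝ) * Complex.I := by
      rw [← h1, ← h2, Complex.re_add_im]
    rw [h3]; push_cast; ring
  have hsub : {x : ℝ | x ∈ Set.Ioc (-R) R ∧ (∀ i ∈ s, x ≠ a i) ∧ t ≤ ‖cauchySum s a b x‖} ⊆
      (S m1 ∪ S m2) ∪ (S m3 ∪ S m4) := by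
    rintro x ⟨hx1, hx2, hx3⟩
    by_contra hcon
    simp only [Set.mem_union, not_or] at hcon
    have hlt : ∀ m, x ∉ S m → ‖cauchySum s a (fun i => (m i : ℂ)) x‖ < t / 4 := fun m hm => by
      by_contra h
      exact hm ⟨hx1, hx2, not_lt.1 h⟩
    rw [hdec] at hx3
    have h1 := (hx3.trans (norm_add_le _ _)).trans (add_le_add (norm_sub_le _ _) (norm_sub_le _ _))
    rw [norm_mul, norm_mul, Complex.norm_I, one_mul, one_mul] at h1
    linarith [hlt _ hcon.1.1, hlt _ hcon.1.2, hlt _ hcon.2.1, hlt _ hcon.2.2]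
  refine (measure_mono hsub).trans ((measure_union_le _ _).trans ((add_le_add (measure_union_le _ _)
    (measure_union_le _ _)).trans ((add_le_add (add_le_add v1 v2) (add_le_add v3 v4)).trans_eq ?_)))
  have hB0 : 0 ≤ B := Finset.sum_nonneg fun i _ => norm_nonneg _
  rw [← ENNReal.ofReal_add (by positivity) (by positivity), ← ENNReal.ofReal_add (by positivity) (by positivity)]
  congr 1
  ring

end

/-- Each of the three inequalities fails on a set of measure at most d/8, and the integers are null,
so an interval of length d is not exhausted. The constant 2048 is 8 · 256. -/
theorem exists_good_point {h : ℝ → ℂ} (hc : Continuous h) {ρ d m B : ℝ} (hd : 0 < d) (hm : 0 < m)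
    (hB : 0 < B) {I : Finset ℤ} {f b : ℤ → ℂ} (hf : ∑ n ∈ I, ‖f n‖ ≤ m) (hb : ∑ n ∈ I, ‖b n‖ ≤ B)
    (hh : ∫⁻ x in Set.Icc (ρ - d / 2) (ρ + d / 2), ENNReal.ofReal (‖h x‖ ^ 2) ≤ ENNReal.ofReal m) :
    ∃ x ∈ Set.Icc (ρ - d / 2) (ρ + d / 2), (∀ n : ℤ, x ≠ n) ∧ ‖h x‖ ^ 2 ≤ 8 * m / d ∧
      ‖cauchySum I (fun n : ℤ => (n : ℝ)) f x‖ ≤ 2048 * m / d ∧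
      ‖cauchySum I (fun n : ℤ => (n : ℝ)) b x‖ ≤ 2048 * B / d := by
  set J := Set.Icc (ρ - d / 2) (ρ + d / 2) with hJ
  set R := |ρ| + d with hR
  have hR0 : 0 < R := by positivity
  set S₁ : Set ℝ := {x | x ∈ J ∧ 8 * m / d ≤ ‖h x‖ ^ 2} with hS₁
  set S₂ : Set ℝ := {x : ℝ | x ∈ Set.Ioc (-R) R ∧ (∀ n ∈ I, x ≠ ((n : ℤ) : ℝ)) ∧
    2048 * m / d ≤ ‖cauchySum I (fun n : ℤ => (n : ℝ)) f x‖} with hS₂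
  set S₃ : Set ℝ := {x : ℝ | x ∈ Set.Ioc (-R) R ∧ (∀ n ∈ I, x ≠ ((n : ℤ) : ℝ)) ∧
    2048 * B / d ≤ ‖cauchySum I (fun n : ℤ => (n : ℝ)) b x‖} with hS₃
  set S₄ : Set ℝ := Set.range (fun n : ℤ => (n : ℝ)) with hS₄
  have v1 : volume S₁ ≤ ENNReal.ofReal (d / 8) := by
    have h1 := mul_meas_ge_le_lintegral₀ (μ := volume.restrict J)
      (f := fun x => ENNReal.ofReal (‖h x‖ ^ 2)) (by fun_prop) (ENNReal.ofReal (8 * m / d))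
    have h2 : volume S₁ ≤ (volume.restrict J) {x | ENNReal.ofReal (8 * m / d) ≤ ENNReal.ofReal (‖h x‖ ^ 2)} := by
      rw [Measure.restrict_apply' measurableSet_Icc]
      exact measure_mono fun x hx => ⟨ENNReal.ofReal_le_ofReal hx.2, hx.1⟩
    have h3 := (mul_le_mul_right h2 (ENNReal.ofReal (8 * m / d))).trans (h1.trans hh)
    calc volume S₁ = ENNReal.ofReal (d / (8 * m)) * (ENNReal.ofReal (8 * m / d) * volume S₁) := by
          rw [← mul_assoc, ← ENNReal.ofReal_mul (by positivity)]
          have : d / (8 * m) * (8 * m / d) = 1 := by field_simp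
          rw [this, ENNReal.ofReal_one, one_mul]
      _ ≤ ENNReal.ofReal (d / (8 * m)) * ENNReal.ofReal m := by gcongr
      _ = ENNReal.ofReal (d / 8) := by
          rw [← ENNReal.ofReal_mul (by positivity)]; congr 1; field_simp
  have v2 : volume S₂ ≤ ENNReal.ofReal (d / 8) := by
    refine (volume_le_cauchySum_complex_le f (by positivity) hR0).trans (ENNReal.ofReal_le_ofReal ?_)
    calc _ ≤ 256 * m / (2048 * m / d) := by gcongr
      _ = d / 8 := by field_simp; norm_num
  have v3 : volume S₃ ≤ ENNReal.ofReal (d / 8) := by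
    refine (volume_le_cauchySum_complex_le b (by positivity) hR0).trans (ENNReal.ofReal_le_ofReal ?_)
    calc _ ≤ 256 * B / (2048 * B / d) := by gcongr
      _ = d / 8 := by field_simp; norm_num
  have v4 : volume S₄ = 0 := (Set.countable_range _).measure_zero _
  have hlt : volume (((S₁ ∪ S₂) ∪ S₃) ∪ S₄) < volume J := by
    have hJv : volume J = ENNReal.ofReal d := by
      rw [hJ, Real.volume_Icc]; congr 1; ring
    rw [hJv]
    calc volume (((S₁ ∪ S₂) ∪ S₃) ∪ S₄) ≤ volume S₁ + volume S₂ + volume S₃ + volume S₄ := by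
          refine (measure_union_le _ _).trans ?_
          gcongr
          refine (measure_union_le _ _).trans ?_
          gcongr
          exact measure_union_le _ _
      _ ≤ ENNReal.ofReal (d / 8) + ENNReal.ofReal (d / 8) + ENNReal.ofReal (d / 8) + 0 := by
          rw [v4]; gcongr
      _ = ENNReal.ofReal (3 * d / 8) := by
          rw [add_zero, ← ENNReal.ofReal_add (by positivity) (by positivity),
            ← ENNReal.ofReal_add (by positivity) (by positivity)]
          congr 1; ring
      _ < ENNReal.ofReal d := (ENNReal.ofReal_lt_ofReal_iff hd).2 (by linarith)
  obtain ⟨x, hxJ, hxb⟩ : ∃ x ∈ J, x ∉ ((S₁ ∪ S₂) ∪ S₃) ∪ S₄ := by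
    by_contra! hcon
    exact absurd hlt (not_lt.2 (measure_mono hcon))
  simp only [Set.mem_union, not_or] at hxb
  obtain ⟨⟨⟨n1, n2⟩, n3⟩, n4⟩ := hxb
  have hint : ∀ n : ℤ, x ≠ n := fun n hn => n4 ⟨n, hn.symm⟩
  have hxR : x ∈ Set.Ioc (-R) R := by
    constructor
    · linarith [hxJ.1, neg_abs_le ρ]
    · linarith [hxJ.2, le_abs_self ρ]
  refine ⟨x, hxJ, hint, ?_, ?_, ?_⟩
  · by_contra hcon; exact n1 ⟨hxJ, (not_le.1 hcon).le⟩
  · by_contra hcon; exact n2 ⟨hxR, fun n _ => hint n, (not_le.1 hcon).le⟩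
  · by_contra hcon; exact n3 ⟨hxR, fun n _ => hint n, (not_le.1 hcon).le⟩

/-! ### Estimates at a good point of one interval -/

/-- The integers in `[ρ - d, ρ + d]`. -/
def intsIn (ρ d : ℝ) : Finset ℤ := Finset.Icc ⌈ρ - d⌉ ⌊ρ + d⌋

theorem mem_intsIn {ρ d : ℝ} {n : ℤ} : n ∈ intsIn ρ d ↔ (n : ℝ) ∈ Set.Icc (ρ - d) (ρ + d) := by
  rw [intsIn, Finset.mem_Icc, Int.ceil_le, Int.le_floor, Set.mem_Icc]

theorem sum_intsIn_add_tsum {V : Type*} [NormedAddCommGroup V] [CompleteSpace V] {f : ℤ → V}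
    (hf : Summable f) (ρ d : ℝ) :
    ∑ n ∈ intsIn ρ d, f n + ∑' n : {n : ℤ // (n : ℝ) ∉ Set.Icc (ρ - d) (ρ + d)}, f n = ∑' n, f n := by
  rw [← hf.sum_add_tsum_subtype_compl (intsIn ρ d)]
  congr 1
  exact (Equiv.subtypeEquivRight fun n => by rw [mem_intsIn]).tsum_eq
    (fun n : {n : ℤ // n ∉ intsIn ρ d} => f n)

theorem half_le_abs_sub {ρ d x : ℝ} (hx : x ∈ Set.Icc (ρ - d / 2) (ρ + d / 2)) {n : ℤ}
    (hn : (n : ℝ) ∉ Set.Icc (ρ - d) (ρ + d)) : |(n : ℝ) - ρ| / 2 ≤ |x - n| ∧ d < |(n : ℝ) - ρ| := by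
  have h1 : d < |(n : ℝ) - ρ| := by
    by_contra hcon
    obtain ⟨h1, h2⟩ := abs_le.1 (not_lt.1 hcon)
    exact hn ⟨by linarith, by linarith⟩
  refine ⟨?_, h1⟩
  have h2 : |x - ρ| ≤ d / 2 := abs_le.2 ⟨by linarith [hx.1], by linarith [hx.2]⟩
  have h3 : |(n : ℝ) - ρ| ≤ |x - n| + |x - ρ| := by
    rw [abs_sub_comm x n]
    exact abs_sub_le _ _ _
  linarith

/-- Weighted Cauchy–Schwarz, derived from the inequality of means with the balancing weight √(P/A)
so that summability comes with the bound. -/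
theorem tsum_mul_div_le {ι : Type*} {a h : ι → ℝ} {r : ι → ℝ} (hr : ∀ i, 0 < r i) (ha : ∀ i, 0 ≤ a i)
    (hh : ∀ i, 0 ≤ h i) {A P : ℝ} (hA : 0 < A) (hP : 0 < P)
    (hsa : Summable fun i => a i ^ 2 / r i) (hsh : Summable fun i => h i ^ 2 / r i)
    (hAle : ∑' i, a i ^ 2 / r i ≤ A) (hPle : ∑' i, h i ^ 2 / r i ≤ P) :
    Summable (fun i => a i * h i / r i) ∧ ∑' i, a i * h i / r i ≤ √(A * P) := by
  set t := √(P / A) with ht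
  have ht0 : 0 < t := Real.sqrt_pos.2 (by positivity)
  have hpt : ∀ i, a i * h i / r i ≤ t / 2 * (a i ^ 2 / r i) + 1 / (2 * t) * (h i ^ 2 / r i) := fun i => by
    have : t / 2 * (a i ^ 2 / r i) + 1 / (2 * t) * (h i ^ 2 / r i) - a i * h i / r i =
        (t * a i - h i) ^ 2 / (2 * t * r i) := by
      have := (hr i).ne'
      field_simp
      ring
    have h2 : 0 ≤ (t * a i - h i) ^ 2 / (2 * t * r i) := by have := hr i; positivity
    linarith
  have hs := (hsa.mul_left (t / 2)).add (hsh.mul_left (1 / (2 * t)))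
  have hsum : Summable (fun i => a i * h i / r i) :=
    hs.of_nonneg_of_le (fun i => div_nonneg (mul_nonneg (ha i) (hh i)) (hr i).le) hpt
  refine ⟨hsum, ?_⟩
  calc _ ≤ ∑' i, (t / 2 * (a i ^ 2 / r i) + 1 / (2 * t) * (h i ^ 2 / r i)) := hsum.tsum_le_tsum hpt hs
    _ = t / 2 * (∑' i, a i ^ 2 / r i) + 1 / (2 * t) * ∑' i, h i ^ 2 / r i := by
        rw [(hsa.mul_left (t / 2)).tsum_add (hsh.mul_left (1 / (2 * t))), tsum_mul_left, tsum_mul_left]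
    _ ≤ t / 2 * A + 1 / (2 * t) * P := by gcongr
    _ = √(A * P) := by
        have h1 : √(A * P) = t * A := by
          rw [ht, Real.sqrt_eq_iff_mul_self_eq (by positivity) (by positivity)]
          rw [mul_mul_mul_comm, Real.mul_self_sqrt (by positivity)]
          field_simp
        have h2 : P = t * t * A := by
          rw [ht, Real.mul_self_sqrt (by positivity)]; field_simp
        have h3 : 1 / (2 * t) * P = t / 2 * A := by
          calc 1 / (2 * t) * P = 1 / (2 * t) * (t * t * A) := by rw [← h2]
            _ = _ := by field_simp
        rw [h1, h3]
        ring

section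

/-- Sum bound for weights supported near `ρ`: the mass inside `[0.8ρ, 1.2ρ]` is at most `m`. -/
theorem tsum_indicator_le {H : ℤ → ℝ} (hH : Summable H) {J : Set ℝ} {m : ℝ}
    (hm : ∀ s : Finset ℤ, (∀ n ∈ s, (n : ℝ) ∈ J) → ∑ n ∈ s, H n ≤ m) :
    ∑' n, Set.indicator {n : ℤ | (n : ℝ) ∈ J} H n ≤ m := by
  classical
  refine (hH.indicator _).tsum_le_of_sum_le fun s => ?_
  simp_rw [Set.indicator_apply]
  rw [← Finset.sum_filter]
  exact hm _ fun n hn => (Finset.mem_filter.1 hn).2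

section

variable {E h : ℂ → ℂ} {c : ℂ} {ρ d C δ : ℝ}

/-- Integers of the window outside the interval are farther than d from ρ and carry mass at most
δd/ρ, which gives δ/ρ; all others are at distance at least ρ/5, which gives the factor 5. -/
theorem tsum_div_abs_sub_le (hH : Summable fun n : ℤ => ‖h n‖ ^ 2) (hρ : 0 < ρ) (hd : 0 < d)
    (hm : ∀ s : Finset ℤ, (∀ n ∈ s, (n : ℝ) ∈ Set.Icc (0.8 * ρ) (1.2 * ρ)) →
      ∑ n ∈ s, ‖h n‖ ^ 2 ≤ δ * d / ρ) :
    Summable (fun n : {n : ℤ // (n : ℝ) ∉ Set.Icc (ρ - d) (ρ + d)} =>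
      ‖h (n : ℤ)‖ ^ 2 / |((n : ℤ) : ℝ) - ρ|) ∧
    ∑' n : {n : ℤ // (n : ℝ) ∉ Set.Icc (ρ - d) (ρ + d)}, ‖h (n : ℤ)‖ ^ 2 / |((n : ℤ) : ℝ) - ρ| ≤
      (5 * ∑' n : ℤ, ‖h n‖ ^ 2 + δ) / ρ := by
  set H : ℤ → ℝ := fun n => ‖h n‖ ^ 2 with hHdef
  have hH0 : ∀ n, 0 ≤ H n := fun n => by positivity
  set J : Set ℤ := {n : ℤ | (n : ℝ) ∈ Set.Icc (0.8 * ρ) (1.2 * ρ)} with hJ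
  set u : ℤ → ℝ := fun n => 5 / ρ * H n + 1 / d * J.indicator H n with hu
  have hind0 : ∀ n, 0 ≤ J.indicator H n := fun n => Set.indicator_nonneg (fun n _ => hH0 n) n
  have hu0 : ∀ n, 0 ≤ u n := fun n => by
    have := hH0 n; have := hind0 n; positivity
  have hus : Summable u := (hH.mul_left _).add ((hH.indicator J).mul_left _)
  have hpt : ∀ n : {n : ℤ // (n : ℝ) ∉ Set.Icc (ρ - d) (ρ + d)},
      H n / |((n : ℤ) : ℝ) - ρ| ≤ u n := by
    rintro ⟨n, hn⟩
    have h1 : d < |(n : ℝ) - ρ| :=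
      (half_le_abs_sub (x := ρ) ⟨by linarith, by linarith⟩ hn).2
    by_cases hnJ : n ∈ J
    · simp only [hu, Set.indicator_of_mem hnJ]
      have h2 : H n / |(n : ℝ) - ρ| ≤ 1 / d * H n := by
        rw [one_div_mul_eq_div]
        exact div_le_div_of_nonneg_left (hH0 n) hd h1.le
      have h3 : 0 ≤ 5 / ρ * H n := by have := hH0 n; positivity
      linarith
    · simp only [hu, Set.indicator_of_notMem hnJ, mul_zero, add_zero]
      have h2 : ρ / 5 ≤ |(n : ℝ) - ρ| := by
        by_contra hcon
        obtain ⟨h3, h4⟩ := abs_lt.1 (not_le.1 hcon)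
        exact hnJ ⟨by linarith, by linarith⟩
      calc H n / |(n : ℝ) - ρ| ≤ H n / (ρ / 5) := by
            exact div_le_div_of_nonneg_left (hH0 n) (by positivity) h2
        _ = _ := by field_simp
  have hsub : Summable fun n : {n : ℤ // (n : ℝ) ∉ Set.Icc (ρ - d) (ρ + d)} => u n := hus.subtype _
  have hsum : Summable fun n : {n : ℤ // (n : ℝ) ∉ Set.Icc (ρ - d) (ρ + d)} => H n / |((n : ℤ) : ℝ) - ρ| :=
    hsub.of_nonneg_of_le (fun n => div_nonneg (hH0 _) (abs_nonneg _)) hpt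
  refine ⟨hsum, (hsum.tsum_le_tsum hpt hsub).trans ?_⟩
  refine (hus.tsum_subtype_le u _ hu0).trans ?_
  rw [(hH.mul_left (5 / ρ)).tsum_add ((hH.indicator J).mul_left (1 / d)), tsum_mul_left, tsum_mul_left]
  have h1 := tsum_indicator_le hH hm
  calc _ ≤ 5 / ρ * ∑' n, H n + 1 / d * (δ * d / ρ) := by gcongr
    _ = _ := by field_simp

/-- Put q = g/d and let x be a good point. Then |h(x)| ≤ √(8δ/ρ), the near part of Σ E(n) conj
h(n)/(x − n) is at most 2048 √q √(δ/ρ), and by (i) with Cauchy–Schwarz the far part is at most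
2√(Cq(5S + δ)/ρ), where S = Σ |h(n)|². Since (ii) gives |E(x)| ≥ √q/C, the unknown q cancels from
the identity. -/
theorem exists_norm_const_add_le (hhc : Continuous h) (hH : Summable fun n : ℤ => ‖h n‖ ^ 2)
    (hid : ∀ x : ℝ, (∀ n : ℤ, x ≠ n) → E x * (c + ∑' n : ℤ, ((‖h n‖ ^ 2 : ℝ) : ℂ) / ((x : ℂ) - n)) =
      h x * ∑' n : ℤ, E n * (starRingEnd ℂ) (h n) / ((x : ℂ) - n))
    (hρ : 0 < ρ) (hd : 0 < d) (hdρ : d ≤ 0.1 * ρ) (hC : 0 < C) (hδ : 0 < δ)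
    (hg : 0 < localMass E ρ d)
    (hsum : Summable fun n : {n : ℤ // (n : ℝ) ∉ Set.Icc (ρ - d) (ρ + d)} =>
      ‖E (n : ℤ)‖ ^ 2 / |((n : ℤ) : ℝ) - ρ|)
    (hi : ∑' n : {n : ℤ // (n : ℝ) ∉ Set.Icc (ρ - d) (ρ + d)},
      ‖E (n : ℤ)‖ ^ 2 / |((n : ℤ) : ℝ) - ρ| ≤ C * (localMass E ρ d / d))
    (hii : ∀ x ∈ Set.Icc (ρ - d) (ρ + d), √(localMass E ρ d / d) ≤ C * ‖E (x : ℂ)‖)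
    (hm : ∀ s : Finset ℤ, (∀ n ∈ s, (n : ℝ) ∈ Set.Icc (0.8 * ρ) (1.2 * ρ)) →
      ∑ n ∈ s, ‖h n‖ ^ 2 ≤ δ * d / ρ)
    (hm' : ∫⁻ x in Set.Icc (0.8 * ρ) (1.2 * ρ), ENNReal.ofReal (‖h (x : ℂ)‖ ^ 2) ≤
      ENNReal.ofReal (δ * d / ρ)) :
    ∃ x ∈ Set.Icc (ρ - d / 2) (ρ + d / 2), (∀ n : ℤ, x ≠ n) ∧
      ‖c + ∑' n : ℤ, ((‖h n‖ ^ 2 : ℝ) : ℂ) / ((x : ℂ) - n)‖ ≤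
        C * √(8 * δ) * (2048 * √δ + 2 * √(C * (5 * ∑' n : ℤ, ‖h n‖ ^ 2 + δ))) / ρ ∧
      ‖∑ n ∈ intsIn ρ d, ((‖h n‖ ^ 2 : ℝ) : ℂ) / ((x : ℂ) - n)‖ ≤ 2048 * δ / ρ := by
  set g := localMass E ρ d with hgdef
  set S := ∑' n : ℤ, ‖h n‖ ^ 2 with hS
  have hS0 : 0 ≤ S := tsum_nonneg fun n => by positivity
  set m := δ * d / ρ with hmdef
  have hm0 : 0 < m := by positivity
  have hIJ : ∀ n ∈ intsIn ρ d, (n : ℝ) ∈ Set.Icc (0.8 * ρ) (1.2 * ρ) := fun n hn => by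
    obtain ⟨h1, h2⟩ := mem_intsIn.1 hn
    exact ⟨by linarith, by linarith⟩
  have hmI := hm _ hIJ
  -- Cauchy–Schwarz with the local masses g of E and at most m of h.
  have hB : ∑ n ∈ intsIn ρ d, ‖E n * (starRingEnd ℂ) (h n)‖ ≤ √(g * m) := by
    simp only [norm_mul, RCLike.norm_conj]
    refine (Real.sum_mul_le_sqrt_mul_sqrt _ _ _).trans ?_
    rw [← Real.sqrt_mul (Finset.sum_nonneg fun i _ => by positivity)]
    apply Real.sqrt_le_sqrt
    exact mul_le_mul_of_nonneg_left hmI (Finset.sum_nonneg fun i _ => by positivity)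
  have hB0 : 0 < √(g * m) := Real.sqrt_pos.2 (by positivity)
  have hsubJ : Set.Icc (ρ - d / 2) (ρ + d / 2) ⊆ Set.Icc (0.8 * ρ) (1.2 * ρ) :=
    Set.Icc_subset_Icc (by linarith) (by linarith)
  obtain ⟨x, hxJ, hxn, hx1, hx2, hx3⟩ := exists_good_point (h := fun x : ℝ => h x) (ρ := ρ)
    (hhc.comp Complex.continuous_ofReal) hd hm0 hB0 (I := intsIn ρ d)
    (f := fun n => ((‖h n‖ ^ 2 : ℝ) : ℂ)) (b := fun n => E n * (starRingEnd ℂ) (h n))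
    (by
      refine le_trans (le_of_eq (Finset.sum_congr rfl fun n _ => ?_)) hmI
      rw [Complex.norm_real, Real.norm_eq_abs, abs_of_nonneg (by positivity)]) hB
    ((lintegral_mono_set hsubJ).trans hm')
  refine ⟨x, hxJ, hxn, ?_, ?_⟩
  swap
  · have h1 : 2048 * m / d = 2048 * δ / ρ := by rw [hmdef]; field_simp
    rw [h1] at hx2
    simpa [cauchySum] using hx2
  set q := g / d with hq
  have hq0 : 0 < q := by positivity
  obtain ⟨hPs, hPle⟩ := tsum_div_abs_sub_le (h := h) hH hρ hd hm
  obtain ⟨hs1, hs2⟩ := tsum_mul_div_le (a := fun n : {n : ℤ // (n : ℝ) ∉ Set.Icc (ρ - d) (ρ + d)} =>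
    ‖E (n : ℤ)‖) (h := fun n => ‖h (n : ℤ)‖) (r := fun n => |((n : ℤ) : ℝ) - ρ|)
    (fun n => hd.trans (half_le_abs_sub hxJ n.2).2) (fun n => norm_nonneg _) (fun n => norm_nonneg _)
    (A := C * q) (P := (5 * S + δ) / ρ) (by positivity) (by positivity) hsum hPs hi hPle
  have hterm : ∀ n : {n : ℤ // (n : ℝ) ∉ Set.Icc (ρ - d) (ρ + d)},
      ‖E (n : ℤ) * (starRingEnd ℂ) (h (n : ℤ)) / ((x : ℂ) - (n : ℤ))‖ ≤
        2 * (‖E (n : ℤ)‖ * ‖h (n : ℤ)‖ / |((n : ℤ) : ℝ) - ρ|) := by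
    rintro ⟨n, hn⟩
    obtain ⟨h1, h2⟩ := half_le_abs_sub hxJ hn
    have h3 : ‖(x : ℂ) - (n : ℤ)‖ = |x - n| := by
      rw [← Complex.ofReal_intCast, ← Complex.ofReal_sub, Complex.norm_real, Real.norm_eq_abs]
    have h4 : 0 < |(n : ℝ) - ρ| := hd.trans h2
    simp only
    rw [norm_div, norm_mul, RCLike.norm_conj, h3]
    calc _ ≤ ‖E n‖ * ‖h n‖ / (|(n : ℝ) - ρ| / 2) := by gcongr
      _ = _ := by field_simp
  have hLout : ‖∑' n : {n : ℤ // (n : ℝ) ∉ Set.Icc (ρ - d) (ρ + d)},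
      E (n : ℤ) * (starRingEnd ℂ) (h (n : ℤ)) / ((x : ℂ) - (n : ℤ))‖ ≤
        2 * √(C * q * ((5 * S + δ) / ρ)) := by
    refine (tsum_of_norm_bounded (hs1.mul_left 2).hasSum hterm).trans ?_
    rw [tsum_mul_left]
    gcongr
  have hbs : Summable fun n : ℤ => E n * (starRingEnd ℂ) (h n) / ((x : ℂ) - n) := by
    rw [← (intsIn ρ d).summable_compl_iff]
    have h1 : Summable fun n : {n : ℤ // (n : ℝ) ∉ Set.Icc (ρ - d) (ρ + d)} =>
        E (n : ℤ) * (starRingEnd ℂ) (h (n : ℤ)) / ((x : ℂ) - (n : ℤ)) :=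
      Summable.of_norm_bounded (hs1.mul_left 2) hterm
    exact ((Equiv.subtypeEquivRight fun n => by rw [mem_intsIn]).summable_iff (f := fun n :
      {n : ℤ // (n : ℝ) ∉ Set.Icc (ρ - d) (ρ + d)} => E (n : ℤ) * (starRingEnd ℂ) (h (n : ℤ)) /
        ((x : ℂ) - (n : ℤ)))).2 h1
  have hL : ‖∑' n : ℤ, E n * (starRingEnd ℂ) (h n) / ((x : ℂ) - n)‖ ≤
      2048 * √(g * m) / d + 2 * √(C * q * ((5 * S + δ) / ρ)) := by
    rw [← sum_intsIn_add_tsum hbs ρ d]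
    refine (norm_add_le _ _).trans (add_le_add ?_ hLout)
    simpa [cauchySum] using hx3
  have hidx := congrArg norm (hid x hxn)
  rw [norm_mul, norm_mul] at hidx
  set Φ := ‖c + ∑' n : ℤ, ((‖h n‖ ^ 2 : ℝ) : ℂ) / ((x : ℂ) - n)‖ with hΦ
  have hEx : √q ≤ C * ‖E (x : ℂ)‖ := hii x ⟨by linarith [hxJ.1], by linarith [hxJ.2]⟩
  have hhx : ‖h x‖ ≤ √(8 * δ) / √ρ := by
    rw [← Real.sqrt_div (by positivity)]
    apply Real.le_sqrt_of_sq_le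
    refine hx1.trans_eq ?_
    rw [hmdef]; field_simp
  have e1 : √(g * m) / d = √q * (√δ / √ρ) := by
    rw [← Real.sqrt_div (by positivity), ← Real.sqrt_mul hq0.le, div_eq_iff hd.ne',
      Real.sqrt_eq_iff_mul_self_eq (by positivity) (by positivity), mul_mul_mul_comm,
      Real.mul_self_sqrt (by positivity), hq, hmdef]
    field_simp
  have e2 : √(C * q * ((5 * S + δ) / ρ)) = √q * (√(C * (5 * S + δ)) / √ρ) := by
    rw [← Real.sqrt_div (by positivity), ← Real.sqrt_mul hq0.le]
    congr 1; ring
  have hsq : 0 < √q := Real.sqrt_pos.2 hq0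
  have hρs : √ρ * √ρ = ρ := Real.mul_self_sqrt hρ.le
  have hsρ : 0 < √ρ := Real.sqrt_pos.2 hρ
  have hfin : √q * Φ ≤ √q * (C * √(8 * δ) * (2048 * √δ + 2 * √(C * (5 * S + δ))) / ρ) := by
    calc √q * Φ ≤ C * ‖E (x : ℂ)‖ * Φ := by gcongr
      _ = C * (‖h x‖ * ‖∑' n : ℤ, E n * (starRingEnd ℂ) (h n) / ((x : ℂ) - n)‖) := by
          rw [← hidx]; ring
      _ ≤ C * (√(8 * δ) / √ρ * (2048 * √(g * m) / d + 2 * √(C * q * ((5 * S + δ) / ρ)))) := by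
          gcongr
      _ = _ := by
          have e4 : ∀ X : ℝ, X / ρ = X / (√ρ * √ρ) := fun X => by rw [hρs]
          rw [mul_div_assoc, e1, e2, e4 (C * _ * _)]
          field_simp
  exact le_of_mul_le_mul_left hfin hsq

end

end

/-! ### Disjoint windows and convergence of Σ d/ρ -/

section

/-- Lacunarity: for k < l, 1.2 ρ_k < 0.8 · 2ρ_k ≤ 0.8 ρ_l. -/
theorem pairwise_disjoint_windows {ρ : ℕ → ℝ} (hρ0 : ∀ k, 0 < ρ k) (hρ : ∀ k, 2 * ρ k ≤ ρ (k + 1)) :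
    Pairwise (Function.onFun Disjoint fun k => Set.Icc (0.8 * ρ k) (1.2 * ρ k)) := by
  have hmono : ∀ k l, k < l → 2 * ρ k ≤ ρ l := fun k l hkl => by
    induction l, hkl using Nat.le_induction with
    | base => exact hρ k
    | succ n _ ih => linarith [hρ n, hρ0 n]
  have key : ∀ k l, k < l → Disjoint (Set.Icc (0.8 * ρ k) (1.2 * ρ k)) (Set.Icc (0.8 * ρ l) (1.2 * ρ l)) :=
    fun k l hkl => Set.disjoint_left.2 fun x hx hx' => by
      linarith [hx.2, hx'.1, hmono k l hkl, hρ0 k]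
  intro k l hkl
  rcases lt_or_gt_of_ne hkl with h | h
  · exact key k l h
  · exact (key l k h).symm

/-- The masses of `h` on disjoint windows are summable. -/
theorem exists_window_mass {h : ℂ → ℂ} (hH : Summable fun n : ℤ => ‖h n‖ ^ 2)
    (hint : ∫⁻ x : ℝ, ENNReal.ofReal (‖h (x : ℂ)‖ ^ 2) ≠ ⊤) {J : ℕ → Set ℝ}
    (hJm : ∀ k, MeasurableSet (J k)) (hJ : Pairwise (Function.onFun Disjoint J)) :
    ∃ m : ℕ → ℝ, Summable m ∧ (∀ k, 0 ≤ m k) ∧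
      (∀ k, ∀ s : Finset ℤ, (∀ n ∈ s, (n : ℝ) ∈ J k) → ∑ n ∈ s, ‖h n‖ ^ 2 ≤ m k) ∧
      ∀ k, ∫⁻ x in J k, ENNReal.ofReal (‖h (x : ℂ)‖ ^ 2) ≤ ENNReal.ofReal (m k) := by
  -- The continuous and the discrete mass are added into one finite measure, whose value on each
  -- window serves as m.
  set ν₁ : Measure ℝ := volume.withDensity fun x => ENNReal.ofReal (‖h (x : ℂ)‖ ^ 2) with hν₁
  set ν₂ : Measure ℝ := Measure.sum fun n : ℤ => ENNReal.ofReal (‖h n‖ ^ 2) • Measure.dirac (n : ℝ) with hν₂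
  have h1 : ν₁ Set.univ ≠ ⊤ := by
    rw [hν₁, withDensity_apply _ MeasurableSet.univ, Measure.restrict_univ]
    exact hint
  have h2 : ν₂ Set.univ ≠ ⊤ := by
    rw [hν₂, Measure.sum_apply _ MeasurableSet.univ]
    simp only [Measure.smul_apply, measure_univ, smul_eq_mul, mul_one]
    exact hH.tsum_ofReal_ne_top
  set ν := ν₁ + ν₂ with hν
  have h3 : ν Set.univ ≠ ⊤ := by
    rw [hν, Measure.add_apply]; exact ENNReal.add_ne_top.2 ⟨h1, h2⟩
  have hfin : ∀ s, ν s ≠ ⊤ := fun s => ne_top_of_le_ne_top h3 (measure_mono (Set.subset_univ s))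
  refine ⟨fun k => (ν (J k)).toReal, ?_, fun k => ENNReal.toReal_nonneg, fun k s hs => ?_, fun k => ?_⟩
  · refine ENNReal.summable_toReal ?_
    rw [← measure_iUnion hJ hJm]
    exact hfin _
  · rw [← ENNReal.ofReal_le_iff_le_toReal (hfin _), ENNReal.ofReal_sum_of_nonneg fun i _ => by positivity]
    refine le_trans ?_ (Measure.le_add_left le_rfl (J k) : ν₂ (J k) ≤ ν (J k))
    rw [hν₂, Measure.sum_apply _ (hJm k)]
    refine le_trans (Finset.sum_le_sum fun n hn => ?_) (ENNReal.sum_le_tsum s)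
    rw [Measure.smul_apply, Measure.dirac_apply' _ (hJm k), Set.indicator_of_mem (hs n hn)]
    simp
  · rw [ENNReal.ofReal_toReal (hfin _)]
    refine le_trans (le_of_eq ?_) (Measure.le_add_right le_rfl (J k) : ν₁ (J k) ≤ ν (J k))
    rw [hν₁, withDensity_apply _ (hJm k)]

theorem tendsto_tsum_tail {H : ℤ → ℝ} (hH : Summable H) {r : ℕ → ℝ}
    (hr : Tendsto r atTop atTop) :
    Tendsto (fun k => ∑' n, Set.indicator {n : ℤ | r k < (n : ℝ)} H n) atTop (𝓝 0) := by
  have := tendsto_tsum_of_dominated_convergence (𝓕 := atTop)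
    (f := fun (k : ℕ) (n : ℤ) => Set.indicator {n : ℤ | r k < (n : ℝ)} H n) (g := fun _ => 0)
    (bound := fun n => ‖H n‖) hH.norm (fun n => ?_) (Eventually.of_forall fun k n => ?_)
  · simpa using this
  · refine tendsto_const_nhds.congr' ?_
    filter_upwards [hr.eventually_ge_atTop (n : ℝ)] with k hk
    rw [Set.indicator_of_notMem]
    simp only [Set.mem_ofPred_eq, not_lt]
    exact hk
  · exact norm_indicator_le_norm_self _ _

section

variable {H : ℤ → ℝ} {ρ d x : ℝ}

theorem summable_div_sub (hH : Summable H) (hd : 0 < d) (hx : x ∈ Set.Icc (ρ - d / 2) (ρ + d / 2)) :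
    Summable fun n : {n : ℤ // (n : ℝ) ∉ Set.Icc (ρ - d) (ρ + d)} => H n / (x - (n : ℤ)) := by
  refine Summable.of_norm_bounded ((hH.norm.subtype _).mul_left (2 / d)) ?_
  rintro ⟨n, hn⟩
  obtain ⟨h1, h2⟩ := half_le_abs_sub hx hn
  simp only [Function.comp_apply]
  rw [norm_div, Real.norm_eq_abs (x - n)]
  calc ‖H n‖ / |x - n| ≤ ‖H n‖ / (d / 2) := by gcongr; linarith
    _ = _ := by field_simp

/-- Terms left of the window are nonnegative, and n₀ alone gives H(n₀)/(2ρ) because 0 < x − n₀ ≤ 2ρ.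
Window terms have |x − n| ≥ d/2 and terms to the right |x − n| ≥ ρ/10; these account for the two
subtracted quantities. -/
theorem le_tsum_div_sub (hH0 : ∀ n, 0 ≤ H n) (hH : Summable H) (hρ : 0 < ρ) (hd : 0 < d)
    (hdρ : d ≤ 0.1 * ρ) (hx : x ∈ Set.Icc (ρ - d / 2) (ρ + d / 2)) {n₀ : ℤ} (hn₀ : |(n₀ : ℝ)| ≤ 0.5 * ρ)
    {m : ℝ} (hm : ∀ s : Finset ℤ, (∀ n ∈ s, (n : ℝ) ∈ Set.Icc (0.8 * ρ) (1.2 * ρ)) → ∑ n ∈ s, H n ≤ m) :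
    H n₀ / (2 * ρ) - 2 * m / d - 10 / ρ * ∑' n, Set.indicator {n : ℤ | 1.2 * ρ < (n : ℝ)} H n ≤
      ∑' n : {n : ℤ // (n : ℝ) ∉ Set.Icc (ρ - d) (ρ + d)}, H n / (x - (n : ℤ)) := by
  classical
  set J : Set ℤ := {n : ℤ | (n : ℝ) ∈ Set.Icc (0.8 * ρ) (1.2 * ρ)} with hJ
  set K : Set ℤ := {n : ℤ | 1.2 * ρ < (n : ℝ)} with hK
  set T := {n : ℤ | (n : ℝ) ∉ Set.Icc (ρ - d) (ρ + d)} with hT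
  have habs := abs_le.1 hn₀
  -- Adding u makes every term nonnegative, so the whole sum dominates the single term at n₀.
  set u : ℤ → ℝ := fun n => 2 / d * J.indicator H n + 10 / ρ * K.indicator H n with hu
  have hindJ : ∀ n, 0 ≤ J.indicator H n := fun n => Set.indicator_nonneg (fun n _ => hH0 n) n
  have hindK : ∀ n, 0 ≤ K.indicator H n := fun n => Set.indicator_nonneg (fun n _ => hH0 n) n
  have hu0 : ∀ n, 0 ≤ u n := fun n => by
    have := hindJ n; have := hindK n; positivity
  have hus : Summable u := ((hH.indicator J).mul_left _).add ((hH.indicator K).mul_left _)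
  have husum : ∑' n, u n ≤ 2 * m / d + 10 / ρ * ∑' n, K.indicator H n := by
    rw [((hH.indicator J).mul_left (2 / d)).tsum_add ((hH.indicator K).mul_left (10 / ρ)),
      tsum_mul_left, tsum_mul_left]
    have h1 := tsum_indicator_le hH hm
    have h2 : 2 * m / d = 2 / d * m := by ring
    rw [h2]
    gcongr
  set f : ℤ → ℝ := fun n => H n / (x - n) with hf
  have hfs : Summable fun n : T => f n := summable_div_sub hH hd hx
  have hpt : ∀ n ∈ T, 0 ≤ f n + u n := fun n hn => by
    obtain ⟨h1, h2⟩ := half_le_abs_sub hx hn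
    rcases lt_or_ge (n : ℝ) (0.8 * ρ) with h3 | h3
    · have : 0 ≤ f n := div_nonneg (hH0 n) (by linarith [hx.1])
      linarith [hu0 n]
    rcases le_or_gt (n : ℝ) (1.2 * ρ) with h4 | h4
    · have hnJ : n ∈ J := ⟨h3, h4⟩
      have h5 : |f n| ≤ 2 / d * H n := by
        rw [hf, abs_div, abs_of_nonneg (hH0 n)]
        calc H n / |x - n| ≤ H n / (d / 2) :=
              div_le_div_of_nonneg_left (hH0 n) (by positivity) (by linarith)
          _ = _ := by field_simp
      have h6 : u n ≥ 2 / d * H n := by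
        simp only [hu, Set.indicator_of_mem hnJ]
        have := hindK n
        have : 0 ≤ 10 / ρ * K.indicator H n := by positivity
        linarith
      linarith [(abs_le.1 h5).1]
    · have hnK : n ∈ K := h4
      have h5 : |f n| ≤ 10 / ρ * H n := by
        rw [hf, abs_div, abs_of_nonneg (hH0 n)]
        have : ρ / 10 ≤ |x - n| := by
          rw [abs_of_nonpos (by linarith [hx.2])]; linarith [hx.2]
        calc H n / |x - n| ≤ H n / (ρ / 10) :=
              div_le_div_of_nonneg_left (hH0 n) (by positivity) this
          _ = _ := by field_simp
      have h6 : u n ≥ 10 / ρ * H n := by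
        simp only [hu, Set.indicator_of_mem hnK]
        have := hindJ n
        have : 0 ≤ 2 / d * J.indicator H n := by positivity
        linarith
      linarith [(abs_le.1 h5).1]
  have hn₀T : n₀ ∈ T := fun h => by linarith [h.1]
  have h0 : H n₀ / (2 * ρ) ≤ f n₀ + u n₀ := by
    have h1 : 0 < x - n₀ := by linarith [hx.1]
    have h2 : x - n₀ ≤ 2 * ρ := by linarith [hx.2]
    have : H n₀ / (2 * ρ) ≤ f n₀ := div_le_div_of_nonneg_left (hH0 n₀) h1 h2
    linarith [hu0 n₀]
  have hus' : Summable fun n : T => u n := hus.subtype _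
  have hs := hfs.add hus'
  have h1 : f n₀ + u n₀ ≤ ∑' n : T, (f n + u n) :=
    hs.le_tsum (⟨n₀, hn₀T⟩ : T) (fun n _ => hpt n n.2)
  rw [hfs.tsum_add hus'] at h1
  have h2 : ∑' n : T, u n ≤ ∑' n, u n := hus.tsum_subtype_le u _ hu0
  have h3 : ∑' n : T, f n = ∑' n : {n : ℤ // (n : ℝ) ∉ Set.Icc (ρ - d) (ρ + d)}, H n / (x - (n : ℤ)) := rfl
  rw [← h3]
  linarith

theorem abs_tsum_div_sub_le (hH0 : ∀ n, 0 ≤ H n) (hd : 0 < d) (hx : x ∈ Set.Icc (ρ - d / 2) (ρ + d / 2)) {P : ℝ}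
    (hs : Summable (fun n : {n : ℤ // (n : ℝ) ∉ Set.Icc (ρ - d) (ρ + d)} => H n / |((n : ℤ) : ℝ) - ρ|))
    (hP : ∑' n : {n : ℤ // (n : ℝ) ∉ Set.Icc (ρ - d) (ρ + d)}, H n / |((n : ℤ) : ℝ) - ρ| ≤ P) :
    |∑' n : {n : ℤ // (n : ℝ) ∉ Set.Icc (ρ - d) (ρ + d)}, H n / (x - (n : ℤ))| ≤ 2 * P := by
  rw [← Real.norm_eq_abs]
  refine (tsum_of_norm_bounded (hs.mul_left 2).hasSum ?_).trans ?_
  · rintro ⟨n, hn⟩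
    obtain ⟨h1, h2⟩ := half_le_abs_sub hx hn
    simp only
    have h3 : 0 < |(n : ℝ) - ρ| := hd.trans h2
    rw [norm_div, Real.norm_eq_abs, Real.norm_eq_abs, abs_of_nonneg (hH0 n)]
    calc H n / |x - n| ≤ H n / (|(n : ℝ) - ρ| / 2) :=
          div_le_div_of_nonneg_left (hH0 n) (by positivity) h1
      _ = _ := by field_simp
  · rw [tsum_mul_left]; gcongr

end

end

theorem tendsto_atTop_of_two_mul_le {ρ : ℕ → ℝ} (hρ0 : ∀ k, 0 < ρ k) (hρ : ∀ k, 2 * ρ k ≤ ρ (k + 1)) :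
    Tendsto ρ atTop atTop := by
  have h : ∀ k : ℕ, ρ 0 * 2 ^ k ≤ ρ k := fun k => by
    induction k with
    | zero => simp
    | succ n ih => rw [pow_succ]; linarith [hρ n]
  exact tendsto_atTop_mono h
    ((tendsto_pow_atTop_atTop_of_one_lt (by norm_num : (1 : ℝ) < 2)).const_mul_atTop (hρ0 0))

theorem exists_small_param (C S κ : ℝ) (hκ : 0 < κ) : ∃ δ : ℝ, 0 < δ ∧ δ < 1 ∧
    C * √(8 * δ) * (2048 * √δ + 2 * √(C * (5 * S + δ))) + 2048 * δ + 2 * δ < κ := by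
  have hc : Continuous fun δ : ℝ =>
      C * √(8 * δ) * (2048 * √δ + 2 * √(C * (5 * S + δ))) + 2048 * δ + 2 * δ := by fun_prop
  have h0 := hc.tendsto 0
  simp only [mul_zero, Real.sqrt_zero, zero_mul, add_zero] at h0
  have h1 : ∀ᶠ δ in 𝓝[>] (0 : ℝ),
      C * √(8 * δ) * (2048 * √δ + 2 * √(C * (5 * S + δ))) + 2048 * δ + 2 * δ < κ :=
    (h0.eventually_lt_const hκ).filter_mono nhdsWithin_le_nhds
  obtain ⟨δ, h2, h3⟩ := (h1.and (Ioo_mem_nhdsGT one_pos)).exists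
  exact ⟨δ, h3.1, h3.2, h2⟩

/-- A late window of mass below δd/ρ is impossible, so d_k/ρ_k ≤ m_k/δ eventually, and the masses
m_k of disjoint windows are summable. With r the sum off I_k, the good point gives ρ|c + r| ≤ F +
2048δ < κ/4 − 2δ for the chosen δ, which both cases for c contradict. -/
theorem summable_of_identity {E h : ℂ → ℂ} {c : ℂ} {ρ d : ℕ → ℝ} {C : ℝ} (hhc : Continuous h)
    (hH : Summable fun n : ℤ => ‖h n‖ ^ 2)
    (hint : ∫⁻ x : ℝ, ENNReal.ofReal (‖h (x : ℂ)‖ ^ 2) ≠ ⊤) {n₀ : ℤ} (hn₀ : h n₀ ≠ 0)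
    (hid : ∀ x : ℝ, (∀ n : ℤ, x ≠ n) → E x * (c + ∑' n : ℤ, ((‖h n‖ ^ 2 : ℝ) : ℂ) / ((x : ℂ) - n)) =
      h x * ∑' n : ℤ, E n * (starRingEnd ℂ) (h n) / ((x : ℂ) - n))
    (hρ0 : ∀ k, 0 < ρ k) (hρ : ∀ k, 2 * ρ k ≤ ρ (k + 1)) (hd : ∀ k, 0 < d k)
    (hdρ : ∀ k, d k ≤ 0.1 * ρ k) (hC : 0 < C) (hg : ∀ k, 0 < localMass E (ρ k) (d k))
    (hsum : ∀ k, Summable fun n : {n : ℤ // (n : ℝ) ∉ Set.Icc (ρ k - d k) (ρ k + d k)} =>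
      ‖E (n : ℤ)‖ ^ 2 / |((n : ℤ) : ℝ) - ρ k|)
    (hi : ∀ k, ∑' n : {n : ℤ // (n : ℝ) ∉ Set.Icc (ρ k - d k) (ρ k + d k)},
      ‖E (n : ℤ)‖ ^ 2 / |((n : ℤ) : ℝ) - ρ k| ≤ C * (localMass E (ρ k) (d k) / d k))
    (hii : ∀ k, ∀ x ∈ Set.Icc (ρ k - d k) (ρ k + d k),
      √(localMass E (ρ k) (d k) / d k) ≤ C * ‖E (x : ℂ)‖) :
    Summable fun k => d k / ρ k := by
  obtain ⟨m, hms, hm0, hm1, hm2⟩ := exists_window_mass hH hint (fun k => measurableSet_Icc)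
    (pairwise_disjoint_windows hρ0 hρ)
  set H : ℤ → ℝ := fun n => ‖h n‖ ^ 2 with hHdef
  have hH0 : ∀ n, 0 ≤ H n := fun n => by positivity
  set S := ∑' n, H n with hS
  have hS0 : 0 ≤ S := tsum_nonneg hH0
  set κ := H n₀ with hκ
  have hκ0 : 0 < κ := by rw [hκ, hHdef]; have := norm_pos_iff.2 hn₀; positivity
  obtain ⟨δ, hδ0, hδ1, hδ⟩ := exists_small_param C S (κ / 4) (by positivity)
  set F := C * √(8 * δ) * (2048 * √δ + 2 * √(C * (5 * S + δ))) with hF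
  have hlim := tendsto_atTop_of_two_mul_le hρ0 hρ
  have hlim' : Tendsto (fun k => 1.2 * ρ k) atTop atTop := hlim.const_mul_atTop (by norm_num)
  -- The threshold κ/40 makes 10 times the tail less than κ/4, half of the contribution κ/2 of n₀.
  have htail := (tendsto_tsum_tail hH hlim').eventually_lt_const (by positivity : 0 < κ / 40)
  have hev : ∀ᶠ k in atTop, δ * (d k / ρ k) ≤ m k := by
    have hcev : ∀ᶠ k in atTop, c ≠ 0 → κ + 10 * S + 2 < ‖c‖ * ρ k := by
      by_cases hc : c = 0
      · exact Eventually.of_forall fun k h => (h hc).elim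
      · filter_upwards [(hlim.const_mul_atTop (norm_pos_iff.2 hc)).eventually_gt_atTop (κ + 10 * S + 2)]
          with k hk _
        exact hk
    filter_upwards [htail, hcev, hlim.eventually_ge_atTop (2 * |(n₀ : ℝ)|)] with k hk1 hk2 hk3
    by_contra hcon
    have hlt : m k ≤ δ * d k / ρ k := by rw [mul_div_assoc]; exact (not_le.1 hcon).le
    have hρk := hρ0 k
    have hmass := fun s hs => (hm1 k s hs).trans hlt
    obtain ⟨x, hx, hxn, hx1, hx2⟩ := exists_norm_const_add_le hhc hH hid hρk (hd k) (hdρ k) hC hδ0 (hg k)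
      (hsum k) (hi k) (hii k) hmass ((hm2 k).trans (ENNReal.ofReal_le_ofReal hlt))
    set r := ∑' n : {n : ℤ // (n : ℝ) ∉ Set.Icc (ρ k - d k) (ρ k + d k)}, H n / (x - (n : ℤ)) with hr
    have hrs := summable_div_sub hH (hd k) hx
    have hfull : Summable fun n : ℤ => H n / (x - n) := by
      rw [← (intsIn (ρ k) (d k)).summable_compl_iff]
      exact ((Equiv.subtypeEquivRight fun n => by rw [mem_intsIn]).summable_iff (f := fun n :
        {n : ℤ // (n : ℝ) ∉ Set.Icc (ρ k - d k) (ρ k + d k)} => H n / (x - (n : ℤ)))).2 hrs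
    have hsplit : ∑' n : ℤ, ((‖h n‖ ^ 2 : ℝ) : ℂ) / ((x : ℂ) - n) =
        (∑ n ∈ intsIn (ρ k) (d k), ((‖h n‖ ^ 2 : ℝ) : ℂ) / ((x : ℂ) - n)) + (r : ℂ) := by
      have h1 : ∀ n : ℤ, ((‖h n‖ ^ 2 : ℝ) : ℂ) / ((x : ℂ) - n) = ((H n / (x - n) : ℝ) : ℂ) := fun n => by
        simp [hHdef]
      simp_rw [h1]
      rw [← Complex.ofReal_tsum, ← sum_intsIn_add_tsum hfull (ρ k) (d k), Complex.ofReal_add,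
        Complex.ofReal_sum]
    rw [hsplit] at hx1
    have hcr : ‖c + (r : ℂ)‖ ≤ (F + 2048 * δ) / ρ k := by
      have h1 : c + (r : ℂ) = (c + ((∑ n ∈ intsIn (ρ k) (d k), ((‖h n‖ ^ 2 : ℝ) : ℂ) / ((x : ℂ) - n)) + r)) -
        ∑ n ∈ intsIn (ρ k) (d k), ((‖h n‖ ^ 2 : ℝ) : ℂ) / ((x : ℂ) - n) := by ring
      rw [h1, add_div]
      exact (norm_sub_le _ _).trans (add_le_add hx1 hx2)
    rw [le_div_iff₀ hρk] at hcr
    by_cases hc : c = 0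
    -- Here ρr ≥ κ/2 − 2δ − 10t > κ/4 − 2δ, with t the tail.
    · have h1 := le_tsum_div_sub hH0 hH hρk (hd k) (hdρ k) hx (n₀ := n₀) (by linarith) hmass
      rw [← hr] at h1
      have h2 : 2 * (δ * d k / ρ k) / d k = 2 * δ / ρ k := by
        have := (hd k).ne'; field_simp
      rw [h2] at h1
      rw [hc, zero_add, Complex.norm_real, Real.norm_eq_abs] at hcr
      have h3 : r * ρ k ≤ |r| * ρ k := by gcongr; exact le_abs_self r
      have h4 := mul_le_mul_of_nonneg_right h1 hρk.le
      set t := ∑' n, Set.indicator {n : ℤ | 1.2 * ρ k < (n : ℝ)} H n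
      have h5 : (H n₀ / (2 * ρ k) - 2 * δ / ρ k - 10 / ρ k * t) * ρ k = κ / 2 - 2 * δ - 10 * t := by
        rw [← hκ]; field_simp
      rw [h5] at h4
      linarith
    -- Here ρ|r| ≤ 10S + 2δ, so ρ|c| stays bounded while ρ tends to infinity.
    · obtain ⟨hPs, hPle⟩ := tsum_div_abs_sub_le (h := h) hH hρk (hd k) hmass
      have h1 := abs_tsum_div_sub_le (H := H) hH0 (hd k) hx hPs hPle
      rw [← hr] at h1
      have h2 : ‖c‖ ≤ ‖c + (r : ℂ)‖ + |r| := by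
        have : c = (c + r) - r := by ring
        calc ‖c‖ = ‖(c + r) - (r : ℂ)‖ := by rw [← this]
          _ ≤ _ := by
            refine (norm_sub_le _ _).trans ?_
            rw [Complex.norm_real, Real.norm_eq_abs]
      have h3 := mul_le_mul_of_nonneg_right h2 hρk.le
      have h4 := mul_le_mul_of_nonneg_right h1 hρk.le
      have h5 : 2 * ((5 * S + δ) / ρ k) * ρ k = 10 * S + 2 * δ := by field_simp; ring
      rw [h5] at h4
      have := hk2 hc
      linarith
  refine Summable.of_norm_bounded_eventually_nat (hms.mul_left δ⁻¹) ?_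
  filter_upwards [hev] with k hk
  have := hρ0 k
  have := hd k
  rw [Real.norm_eq_abs, abs_of_pos (by positivity), inv_mul_eq_div, le_div_iff₀ hδ0]
  linarith

/-- Cut the line into unit intervals and translate them to (0, 1]; Bessel's inequality bounds the
sum over n + s uniformly in s. -/
theorem lintegral_norm_sq_expTransform_ne_top (ψ : L2) :
    ∫⁻ x : ℝ, ENNReal.ofReal (‖expTransform ψ (x : ℂ)‖ ^ 2) ≠ ⊤ := by
  set f : ℝ → ENNReal := fun x => ENNReal.ofReal (‖expTransform ψ (x : ℂ)‖ ^ 2) with hf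
  have hfm : Measurable f := by
    have : Continuous fun x : ℝ => expTransform ψ (x : ℂ) :=
      (differentiable_expTransform ψ).continuous.comp Complex.continuous_ofReal
    exact ENNReal.measurable_ofReal.comp (this.norm.pow 2).measurable
  have h1 : ∫⁻ x : ℝ, f x = ∑' n : ℤ, ∫⁻ x in Set.Ioc (n : ℝ) (n + 1), f x := by
    rw [← lintegral_iUnion (fun n => measurableSet_Ioc) (Set.pairwise_disjoint_Ioc_intCast ℝ),
      iUnion_Ioc_intCast, Measure.restrict_univ]
  have h2 : ∀ n : ℤ, ∫⁻ x in Set.Ioc (n : ℝ) (n + 1), f x = ∫⁻ s in Set.Ioc (0 : ℝ) 1, f (n + s) := fun n => by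
    have := (measurePreserving_add_left volume (n : ℝ)).setLIntegral_comp_preimage
      (measurableSet_Ioc (a := (n : ℝ)) (b := n + 1)) hfm
    rw [← this]
    congr 2
    ext s; simp
  rw [h1]
  simp_rw [h2]
  have hm : ∀ n : ℤ, AEMeasurable (fun s : ℝ => f (n + s)) (volume.restrict (Set.Ioc 0 1)) :=
    fun n => (hfm.comp (measurable_const_add (n : ℝ))).aemeasurable
  rw [← lintegral_tsum hm]
  refine ne_top_of_le_ne_top (b := ∫⁻ _ in Set.Ioc (0 : ℝ) 1, ENNReal.ofReal (2 * Real.pi * ‖ψ‖ ^ 2)) ?_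
    (lintegral_mono fun s => ?_)
  · simp
  · rw [← ENNReal.ofReal_tsum_of_nonneg (fun n => by positivity) (summable_norm_sq_expTransform ψ s)]
    exact ENNReal.ofReal_le_ofReal (tsum_norm_sq_expTransform_le ψ s)

/-! ### Factorisation of the generator and the principal value product -/

theorem IsGenerator.finite {Λ : Set ℂ} {E : ℂ → ℂ} (hE : IsGenerator Λ E) (R : ℝ) :
    {μ : ℂ | μ ∈ Λ ∧ ‖μ‖ < R}.Finite := by
  by_contra hinf
  obtain ⟨x, -, hx⟩ := Set.Infinite.exists_accPt_of_subset_isCompact hinf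
    (isCompact_closedBall (0 : ℂ) R) fun μ hμ => by simpa using hμ.2.le
  rw [accPt_iff_frequently_nhdsNE] at hx
  have hd := hE.isPaleyWienerOne.differentiable
  have h0 := (hd.differentiableOn.analyticOnNhd isOpen_univ).eqOn_zero_of_preconnected_of_frequently_eq_zero
    isPreconnected_univ (Set.mem_univ x) (hx.mono fun z hz => (hE.eq_zero_iff z).2 hz.1)
  have := h0 (Set.mem_univ 0)
  rw [hE.map_zero] at this
  exact one_ne_zero this

/-- The zeros of a generator of modulus less than `R`. -/
def IsGenerator.zerosIn {Λ : Set ℂ} {E : ℂ → ℂ} (hE : IsGenerator Λ E) (R : ℝ) : Finset ℂ :=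
  (hE.finite R).toFinset

theorem IsGenerator.mem_zerosIn {Λ : Set ℂ} {E : ℂ → ℂ} (hE : IsGenerator Λ E) {R : ℝ} {μ : ℂ} :
    μ ∈ hE.zerosIn R ↔ E μ = 0 ∧ ‖μ‖ < R := by
  simp [IsGenerator.zerosIn, hE.eq_zero_iff]

/-- Division of an entire function by finitely many of its simple zeros. -/
theorem exists_eq_prod_mul {E : ℂ → ℂ} (hE : Differentiable ℂ E) (T : Finset ℂ)
    (hT0 : ∀ μ ∈ T, μ ≠ 0) (hT : ∀ μ ∈ T, E μ = 0) (hT' : ∀ μ ∈ T, deriv E μ ≠ 0) :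
    ∃ F : ℂ → ℂ, Differentiable ℂ F ∧ (∀ z, E z = (∏ μ ∈ T, (1 - z / μ)) * F z) ∧
      ∀ z, F z = 0 → E z = 0 ∧ z ∉ T := by
  classical
  induction T using Finset.induction_on with
  | empty => exact ⟨E, hE, by simp, by simp⟩
  | insert a T ha ih =>
    obtain ⟨F, hF, hEF, hF0⟩ := ih (fun μ h => hT0 μ (Finset.mem_insert_of_mem h))
      (fun μ h => hT μ (Finset.mem_insert_of_mem h)) (fun μ h => hT' μ (Finset.mem_insert_of_mem h))
    have ha0 := hT0 a (Finset.mem_insert_self a T)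
    have hp : ∏ μ ∈ T, (1 - a / μ) ≠ 0 := Finset.prod_ne_zero_iff.2 fun μ hμ h => by
      have h0 := hT0 μ (Finset.mem_insert_of_mem hμ)
      rw [sub_eq_zero, eq_comm, div_eq_one_iff_eq h0] at h
      exact ha (h ▸ hμ)
    have hFa : F a = 0 := by
      have := hEF a
      rw [hT a (Finset.mem_insert_self a T)] at this
      exact (mul_eq_zero.1 this.symm).resolve_left hp
    have hFd : ∀ z, F z = (1 - z / a) * (-a * dslope F a z) := fun z => by
      have := sub_smul_dslope F a z
      rw [hFa, sub_zero, smul_eq_mul] at this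
      rw [← this]; field_simp; ring
    refine ⟨fun z => -a * dslope F a z, (differentiable_dslope hF a).const_mul _, fun z => ?_, fun z hz => ?_⟩
    · rw [Finset.prod_insert ha, hEF z, hFd z]; ring
    · have h1 := hF0 z (by rw [hFd z]; exact mul_eq_zero_of_right _ hz)
      refine ⟨h1.1, fun h => ?_⟩
      rcases Finset.mem_insert.1 h with rfl | h
      · have hdz : deriv F z = 0 := by
          rw [← dslope_same]; exact (mul_eq_zero.1 hz).resolve_left (neg_ne_zero.2 ha0)
        refine hT' z (Finset.mem_insert_self z T) ?_
        have hP : Differentiable ℂ fun w => ∏ μ ∈ T, (1 - w / μ) := by fun_prop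
        have : E = fun w => (∏ μ ∈ T, (1 - w / μ)) * F w := funext hEF
        rw [this, deriv_fun_mul hP.differentiableAt hF.differentiableAt, hdz, hFa]
        simp
      · exact h1.2 h

/-- A zero-free holomorphic function on a disc has a logarithm. -/
theorem exists_log_of_ne_zero {F : ℂ → ℂ} (hF : Differentiable ℂ F) {R : ℝ} (hR : 0 < R)
    (h0 : ∀ z ∈ Metric.ball (0 : ℂ) R, F z ≠ 0) (h1 : F 0 = 1) :
    ∃ g : ℂ → ℂ, DifferentiableOn ℂ g (Metric.ball 0 R) ∧ g 0 = 0 ∧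
      (∀ z ∈ Metric.ball (0 : ℂ) R, F z = Complex.exp (g z)) ∧ deriv g 0 = deriv F 0 := by
  have hdF : Differentiable ℂ (deriv F) := fun z => (hF.analyticAt z).deriv.differentiableAt
  have hq : DifferentiableOn ℂ (fun z => deriv F z / F z) (Metric.ball 0 R) :=
    hdF.differentiableOn.div hF.differentiableOn h0
  obtain ⟨g, hg⟩ := hq.isExactOn_ball
  have h0R : (0 : ℂ) ∈ Metric.ball (0 : ℂ) R := Metric.mem_ball_self hR
  -- With g' = F'/F the product F e^{−g} has zero derivative.
  have hgd : ∀ z ∈ Metric.ball (0 : ℂ) R, HasDerivAt (fun w => F w * Complex.exp (-(g w - g 0))) 0 z :=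
    fun z hz => by
      have h2 := (hF z).hasDerivAt.mul ((((hg z hz).sub_const (g 0)).neg).cexp)
      refine h2.congr_deriv ?_
      have := h0 z hz
      simp only [Pi.neg_apply]
      field_simp
      ring
  refine ⟨fun z => g z - g 0, fun z hz => ((hg z hz).sub_const _).differentiableAt.differentiableWithinAt,
    sub_self _, fun z hz => ?_, ?_⟩
  · have := (convex_ball (0 : ℂ) R).is_const_of_fderivWithin_eq_zero (𝕜 := ℂ)
      (f := fun w => F w * Complex.exp (-(g w - g 0)))
      (fun w hw => (hgd w hw).differentiableAt.differentiableWithinAt) (fun w hw => by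
        rw [fderivWithin_of_isOpen Metric.isOpen_ball hw, (hgd w hw).hasFDerivAt.fderiv]; simp) hz h0R
    simp only [sub_self, neg_zero, Complex.exp_zero, mul_one, h1] at this
    rw [Complex.exp_neg, mul_inv_eq_one₀ (Complex.exp_ne_zero _)] at this
    exact this
  · have := ((hg 0 h0R).sub_const (g 0)).deriv
    simp only [this, h1, div_one]

/-- Second order expansion of a function vanishing at `0` whose real part is bounded above. -/
theorem norm_sub_deriv_mul_le {g : ℂ → ℂ} {R M : ℝ} (hR : 0 < R) (hM : 0 < M)
    (hg : DifferentiableOn ℂ g (Metric.ball 0 R)) (h0 : g 0 = 0)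
    (hre : ∀ z ∈ Metric.ball (0 : ℂ) R, (g z).re ≤ M) :
    ‖deriv g 0‖ ≤ 4 * M / R ∧
      ∀ z ∈ Metric.ball (0 : ℂ) (R / 2), ‖g z - deriv g 0 * z‖ ≤ 16 * M / R ^ 2 * ‖z‖ ^ 2 := by
  have hR2 : Metric.ball (0 : ℂ) (R / 2) ⊆ Metric.ball 0 R := Metric.ball_subset_ball (by linarith)
  have hnhds : Metric.ball (0 : ℂ) R ∈ 𝓝 (0 : ℂ) := Metric.ball_mem_nhds _ hR
  have hds : DifferentiableOn ℂ (dslope g 0) (Metric.ball 0 (R / 2)) :=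
    ((Complex.differentiableOn_dslope hnhds).2 hg).mono hR2
  have hgz : ∀ z, g z = z * dslope g 0 z := fun z => by
    have := sub_smul_dslope g 0 z
    rw [h0, sub_zero, sub_zero, smul_eq_mul] at this
    exact this.symm
  -- Borel–Carathéodory gives |g(z)| ≤ 2M|z|/(R − |z|), and R − |z| > R/2 here.
  have hb : ∀ z ∈ Metric.ball (0 : ℂ) (R / 2), z ≠ 0 → ‖dslope g 0 z‖ ≤ 4 * M / R := fun z hz hz0 => by
    have hz' : ‖z‖ < R / 2 := by simpa using hz
    have := Complex.borelCaratheodory_zero hM hg hre hR (hR2 hz) h0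
    rw [hgz z, norm_mul] at this
    have hzp : 0 < ‖z‖ := norm_pos_iff.2 hz0
    have h2 : 2 * M * ‖z‖ / (R - ‖z‖) ≤ ‖z‖ * (4 * M / R) := by
      rw [div_le_iff₀ (by linarith)]
      have : ‖z‖ * (4 * M / R) * (R - ‖z‖) = ‖z‖ * M * (4 * (R - ‖z‖) / R) := by ring
      rw [this]
      have h3 : 2 ≤ 4 * (R - ‖z‖) / R := by rw [le_div_iff₀ hR]; linarith
      nlinarith [mul_pos hzp hM]
    exact le_of_mul_le_mul_left (this.trans h2) hzp
  have hb0 : ‖dslope g 0 0‖ ≤ 4 * M / R := by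
    have hc : ContinuousAt (dslope g 0) 0 :=
      (hds.differentiableAt (Metric.ball_mem_nhds _ (by linarith))).continuousAt
    refine le_of_tendsto (hc.norm.tendsto.mono_left (nhdsWithin_le_nhds (s := {(0 : ℂ)}ᶜ))) ?_
    filter_upwards [self_mem_nhdsWithin, mem_nhdsWithin_of_mem_nhds
      (Metric.ball_mem_nhds (0 : ℂ) (by linarith : 0 < R / 2))] with z hz hz2
    exact hb z hz2 hz
  have hba : ∀ z ∈ Metric.ball (0 : ℂ) (R / 2), ‖dslope g 0 z‖ ≤ 4 * M / R := fun z hz => by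
    rcases eq_or_ne z 0 with rfl | h
    · exact hb0
    · exact hb z hz h
  refine ⟨by rw [← dslope_same]; exact hb0, fun z hz => ?_⟩
  -- Schwarz's lemma for g(z)/z on the half disc, whose oscillation from its value at 0 is at most
  -- 8M/R.
  have := Complex.dist_le_div_mul_dist_of_mapsTo_ball (R₂ := 8 * M / R) hds (fun w hw => by
    rw [Metric.mem_closedBall, dist_eq_norm]
    calc _ ≤ ‖dslope g 0 w‖ + ‖dslope g 0 0‖ := norm_sub_le _ _
      _ ≤ 4 * M / R + 4 * M / R := add_le_add (hba w hw) hb0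
      _ = _ := by ring) hz
  rw [dist_eq_norm, dist_zero_right, dslope_same] at this
  calc ‖g z - deriv g 0 * z‖ = ‖dslope g 0 z - deriv g 0‖ * ‖z‖ := by
        rw [← norm_mul, hgz z]; congr 1; ring
    _ ≤ (8 * M / R / (R / 2) * ‖z‖) * ‖z‖ := by gcongr
    _ = _ := by field_simp; ring

/-- The coefficient `E'(0) + ∑_{|μ| < R} 1 / μ`. -/
def IsGenerator.coeff {Λ : Set ℂ} {E : ℂ → ℂ} (hE : IsGenerator Λ E) (R : ℝ) : ℂ :=
  deriv E 0 + ∑ μ ∈ hE.zerosIn R, 1 / μ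

theorem IsGenerator.ne_zero_of_mem_zerosIn {Λ : Set ℂ} {E : ℂ → ℂ} (hE : IsGenerator Λ E) {R : ℝ}
    {μ : ℂ} (h : μ ∈ hE.zerosIn R) : μ ≠ 0 := by
  rintro rfl
  have := (hE.mem_zerosIn.1 h).1
  rw [hE.map_zero] at this
  exact one_ne_zero this

theorem deriv_prod_one_sub_div (T : Finset ℂ) :
    HasDerivAt (fun z : ℂ => ∏ μ ∈ T, (1 - z / μ)) (-∑ μ ∈ T, 1 / μ) 0 := by
  have h := HasDerivAt.fun_finsetProd (u := T) (f := fun μ z : ℂ => 1 - z / μ) (f' := fun μ => -(1 / μ)) (x := 0)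
    fun μ _ => ((hasDerivAt_id (0 : ℂ)).div_const μ).const_sub 1
  refine h.congr_deriv ?_
  simp

/-- Divide E by its zeros in |z| < R. On |w| = 2R each factor 1 − w/μ has modulus at least 1, so the
quotient is no larger than E there, hence at most e^{O(R)} inside. Its logarithm g has real part
O(R), so g'(0) is bounded uniformly in R and the second order remainder is O(|z|²/R). -/
theorem IsGenerator.exists_factor {Λ : Set ℂ} {E : ℂ → ℂ} (hE : IsGenerator Λ E) :
    ∃ K : ℝ, 0 < K ∧ ∀ R : ℝ, 1 ≤ R → ∃ g : ℂ → ℂ, DifferentiableOn ℂ g (Metric.ball 0 R) ∧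
      deriv g 0 = hE.coeff R ∧
      (∀ z ∈ Metric.ball (0 : ℂ) R, E z = (∏ μ ∈ hE.zerosIn R, (1 - z / μ)) * Complex.exp (g z)) ∧
      ‖hE.coeff R‖ ≤ K ∧ ∀ z ∈ Metric.ball (0 : ℂ) (R / 2), ‖g z - hE.coeff R * z‖ ≤ K / R * ‖z‖ ^ 2 := by
  obtain ⟨C₀, hC₀⟩ := hE.isPaleyWienerOne.bound
  set C := max C₀ 1
  have hC1 : 1 ≤ C := le_max_right _ _
  have hC : ∀ z, ‖E z‖ ≤ C * (1 + ‖z‖) * Real.exp (Real.pi * |z.im|) := fun z => (hC₀ z).trans (by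
    gcongr; exact le_max_left _ _)
  have hπ := Real.pi_pos
  refine ⟨16 * (3 * C + 2 * Real.pi), by positivity, fun R hR => ?_⟩
  have hR0 : 0 < R := by linarith
  have hEd := hE.isPaleyWienerOne.differentiable
  obtain ⟨F, hF, hEF, hF0⟩ := exists_eq_prod_mul hEd (hE.zerosIn R)
    (fun μ h => hE.ne_zero_of_mem_zerosIn h) (fun μ h => (hE.mem_zerosIn.1 h).1)
    (fun μ h => hE.deriv_ne_zero μ ((hE.eq_zero_iff μ).1 (hE.mem_zerosIn.1 h).1))
  have hF1 : F 0 = 1 := by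
    have := hEF 0
    rw [hE.map_zero] at this
    simpa using this.symm
  have hFne : ∀ z ∈ Metric.ball (0 : ℂ) R, F z ≠ 0 := fun z hz h => by
    obtain ⟨h1, h2⟩ := hF0 z h
    exact h2 (hE.mem_zerosIn.2 ⟨h1, by simpa using hz⟩)
  obtain ⟨g, hg, hg0, hFg, hgd⟩ := exists_log_of_ne_zero hF hR0 hFne hF1
  have hcoeff : deriv F 0 = hE.coeff R := by
    have h := (deriv_prod_one_sub_div (hE.zerosIn R)).mul (hF 0).hasDerivAt
    have h2 : ((fun z : ℂ => ∏ μ ∈ hE.zerosIn R, (1 - z / μ)) * F) = E := (funext hEF).symm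
    rw [h2] at h
    have h3 := h.deriv
    simp only [hF1, zero_div, sub_zero, Finset.prod_const_one, one_mul, mul_one] at h3
    rw [IsGenerator.coeff, h3]; ring
  have hFb : ∀ z ∈ Metric.ball (0 : ℂ) (2 * R), ‖F z‖ ≤ Real.exp ((3 * C + 2 * Real.pi) * R) := by
    intro z hz
    refine Complex.norm_le_of_forall_mem_frontier_norm_le Metric.isBounded_ball hF.diffContOnCl
      (fun w hw => ?_) (subset_closure hz)
    rw [frontier_ball _ (by positivity), mem_sphere_zero_iff_norm] at hw
    have h1 : 1 ≤ ‖∏ μ ∈ hE.zerosIn R, (1 - w / μ)‖ := by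
      rw [norm_prod]
      calc (1 : ℝ) = ∏ μ ∈ hE.zerosIn R, (1 : ℝ) := by simp
        _ ≤ _ := Finset.prod_le_prod (fun _ _ => zero_le_one) fun μ hμ => ?_
      have hμ0 : 0 < ‖μ‖ := norm_pos_iff.2 (hE.ne_zero_of_mem_zerosIn hμ)
      have hμR := (hE.mem_zerosIn.1 hμ).2
      have h2 : 2 ≤ ‖w / μ‖ := by rw [norm_div, hw, le_div_iff₀ hμ0]; linarith
      have h3 := norm_sub_norm_le (w / μ) 1
      rw [norm_one, norm_sub_rev] at h3
      linarith
    have h2 : ‖F w‖ ≤ ‖E w‖ := by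
      rw [hEF w, norm_mul]
      exact le_mul_of_one_le_left (norm_nonneg _) h1
    refine h2.trans ((hC w).trans ?_)
    rw [hw]
    have h3 : |w.im| ≤ 2 * R := hw ▸ Complex.abs_im_le_norm w
    calc C * (1 + 2 * R) * Real.exp (Real.pi * |w.im|)
        ≤ Real.exp (C * (1 + 2 * R)) * Real.exp (Real.pi * (2 * R)) := by
          gcongr
          linarith [Real.add_one_le_exp (C * (1 + 2 * R))]
      _ ≤ _ := by
          rw [← Real.exp_add, Real.exp_le_exp]
          nlinarith
  have key := norm_sub_deriv_mul_le (M := (3 * C + 2 * Real.pi) * R) hR0 (by positivity) hg hg0 fun z hz => by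
    have := hFb z (Metric.ball_subset_ball (by linarith) hz)
    rwa [hFg z hz, Complex.norm_exp, Real.exp_le_exp] at this
  rw [hgd, hcoeff] at key
  refine ⟨g, hg, hgd.trans hcoeff, fun z hz => by rw [← hFg z hz]; exact hEF z, key.1.trans ?_, fun z hz => (key.2 z hz).trans ?_⟩
  · rw [div_le_iff₀ hR0]
    have : 0 < (3 * C + 2 * Real.pi) * R := by positivity
    linarith
  · apply le_of_eq; field_simp

/-- The principal value product differs from the generator by an exponential factor. -/
theorem IsGenerator.exists_tendsto_coeff {Λ : Set ℂ} {E G : ℂ → ℂ} (hE : IsGenerator Λ E)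
    (hG : IsGeneratingFunction Λ G) :
    ∃ α : ℂ, Tendsto hE.coeff atTop (𝓝 α) ∧ ∀ z, G z * Complex.exp (α * z) = E z := by
  obtain ⟨K, hK, hfac⟩ := hE.exists_factor
  have hG' : ∀ z, Tendsto (fun R => ∏ μ ∈ hE.zerosIn R, (1 - z / μ)) atTop (𝓝 (G z)) := fun z => by
    refine (hG z).congr fun R => ?_
    rw [finprod_mem_eq_finite_toFinset_prod _ (hE.finite R)]
    rfl
  have hlim : ∀ z, Tendsto (fun R => (∏ μ ∈ hE.zerosIn R, (1 - z / μ)) * Complex.exp (hE.coeff R * z))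
      atTop (𝓝 (E z)) := fun z => by
    choose! g hg using hfac
    have h0 : Tendsto (fun R => g R z - hE.coeff R * z) atTop (𝓝 0) := by
      refine squeeze_zero_norm' (a := fun R => K / R * ‖z‖ ^ 2) ?_ ?_
      · filter_upwards [eventually_ge_atTop 1, eventually_gt_atTop (2 * ‖z‖)] with R hR hz
        exact (hg R hR).2.2.2.2 z (by simp; linarith)
      · simpa using (tendsto_const_nhds.div_atTop tendsto_id).mul_const (‖z‖ ^ 2)
    have h1 : Tendsto (fun R => Complex.exp (-(g R z - hE.coeff R * z))) atTop (𝓝 1) := by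
      simpa using h0.neg.cexp
    have h2 : Tendsto (fun R => E z * Complex.exp (-(g R z - hE.coeff R * z))) atTop (𝓝 (E z)) := by
      simpa using h1.const_mul (E z)
    refine h2.congr' ?_
    filter_upwards [eventually_ge_atTop 1, eventually_gt_atTop (‖z‖)] with R hR hz
    rw [(hg R hR).2.2.1 z (by simpa using hz), mul_assoc, ← Complex.exp_add]
    congr 2; ring
  have hK' : ∀ᶠ R in atTop, hE.coeff R ∈ Metric.closedBall (0 : ℂ) K := by
    filter_upwards [eventually_ge_atTop 1] with R hR
    obtain ⟨g, hg⟩ := hfac R hR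
    simpa using hg.2.2.2.1
  have hcl : ∀ α, MapClusterPt α atTop hE.coeff → ∀ z, G z * Complex.exp (α * z) = E z := fun α hα z => by
    obtain ⟨l, hl, hl'⟩ := mapClusterPt_iff_ultrafilter.1 hα
    have h1 : Tendsto (fun R => (∏ μ ∈ hE.zerosIn R, (1 - z / μ)) * Complex.exp (hE.coeff R * z)) l
        (𝓝 (G z * Complex.exp (α * z))) := ((hG' z).mono_left hl).mul (hl'.mul_const z).cexp
    exact tendsto_nhds_unique h1 ((hlim z).mono_left hl)
  -- The bounded coefficients have a cluster point. Any two cluster points satisfy the same identity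
  -- with G, and near 0, where E ≠ 0, comparing derivatives of the exponentials shows that they
  -- agree; hence convergence.
  obtain ⟨α, -, hα⟩ := (isCompact_closedBall (0 : ℂ) K).exists_mapClusterPt (u := hE.coeff)
    (f := atTop) (by simpa using hK')
  have hGα := hcl α hα
  refine ⟨α, ?_, hGα⟩
  refine (isCompact_closedBall (0 : ℂ) K).tendsto_nhds_of_unique_mapClusterPt hK' fun α' _ hα' => ?_
  have hGα' := hcl α' hα'
  have hEd := hE.isPaleyWienerOne.differentiable
  have hne : ∀ᶠ z in 𝓝 (0 : ℂ), E z ≠ 0 :=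
    hEd.continuous.continuousAt.eventually_ne (by rw [hE.map_zero]; exact one_ne_zero)
  have heq : (fun z => Complex.exp (α' * z)) =ᶠ[𝓝 0] fun z => Complex.exp (α * z) := by
    filter_upwards [hne] with z hz
    have h1 : G z ≠ 0 := fun h => hz (by rw [← hGα z, h, zero_mul])
    exact mul_left_cancel₀ h1 ((hGα' z).trans (hGα z).symm)
  have hder : ∀ a : ℂ, HasDerivAt (fun z => Complex.exp (a * z)) a 0 := fun a => by
    simpa using (((hasDerivAt_id (0 : ℂ)).const_mul a).cexp)
  exact (hder α').unique ((hder α).congr_of_eventuallyEq heq)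

/-! ### The first cosine moment of log |E| on circles -/

/-- Write 2 cos θ = e^{iθ} + e^{−iθ}: Cauchy's theorem kills the first exponential and Cauchy's
formula for g'(0) evaluates the second. -/
theorem integral_re_mul_cos {g : ℂ → ℂ} {R r : ℝ} (hr : 0 < r) (hrR : r < R)
    (hg : DifferentiableOn ℂ g (Metric.ball 0 R)) :
    ∫ θ in (0 : ℝ)..2 * Real.pi, (g (circleMap 0 r θ)).re * Real.cos θ = Real.pi * r * (deriv g 0).re := by
  have hsub : Metric.closedBall (0 : ℂ) r ⊆ Metric.ball 0 R := Metric.closedBall_subset_ball hrR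
  have h1 := Complex.two_pi_I_inv_smul_circleIntegral_sub_sq_inv_smul_of_differentiable
    Metric.isOpen_ball hsub hg (Metric.mem_ball_self hr)
  have h2 : (∮ z in C(0, r), g z) = 0 :=
    Complex.circleIntegral_eq_zero_of_differentiable_on_off_countable hr.le Set.countable_empty
      (hg.continuousOn.mono hsub) fun z hz => hg.differentiableAt
        (Metric.isOpen_ball.mem_nhds (hsub (Metric.ball_subset_closedBall hz.1)))
  have hne : ∀ θ, circleMap 0 r θ ≠ 0 := fun θ => circleMap_ne_center hr.ne'
  have hcont : Continuous fun θ => g (circleMap 0 r θ) := by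
    have := (hg.continuousOn.mono hsub).comp_continuous (continuous_circleMap 0 r)
      fun θ => circleMap_mem_closedBall 0 hr.le θ
    exact this
  have hc := continuous_circleMap 0 r
  have h3 : (∮ z in C(0, r), ((z - 0) ^ 2)⁻¹ • g z) =
      Complex.I * ∫ θ in (0 : ℝ)..2 * Real.pi, (circleMap 0 r θ)⁻¹ * g (circleMap 0 r θ) := by
    rw [circleIntegral, ← intervalIntegral.integral_const_mul]
    refine intervalIntegral.integral_congr fun θ _ => ?_
    have := hne θ
    simp only [deriv_circleMap, smul_eq_mul, sub_zero]
    field_simp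
  have h4 : (∮ z in C(0, r), g z) =
      Complex.I * ∫ θ in (0 : ℝ)..2 * Real.pi, circleMap 0 r θ * g (circleMap 0 r θ) := by
    rw [circleIntegral, ← intervalIntegral.integral_const_mul]
    refine intervalIntegral.integral_congr fun θ _ => ?_
    simp only [deriv_circleMap, smul_eq_mul]
    ring
  rw [h3] at h1
  rw [h4, mul_eq_zero] at h2
  have h2 := h2.resolve_left Complex.I_ne_zero
  have hr' : (r : ℂ) ≠ 0 := by exact_mod_cast hr.ne'
  have h5 : ∫ θ in (0 : ℝ)..2 * Real.pi, g (circleMap 0 r θ) * (Real.cos θ : ℂ) = Real.pi * r * deriv g 0 := by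
    have hsplit : ∀ θ : ℝ, g (circleMap 0 r θ) * (Real.cos θ : ℂ) =
        (1 / (2 * r)) * (circleMap 0 r θ * g (circleMap 0 r θ)) +
          (r / 2) * ((circleMap 0 r θ)⁻¹ * g (circleMap 0 r θ)) := fun θ => by
      have he : Complex.exp (-(θ * Complex.I)) = (Complex.exp (θ * Complex.I))⁻¹ := Complex.exp_neg _
      rw [Complex.ofReal_cos, Complex.cos, neg_mul, he]
      simp only [circleMap, zero_add]
      have := Complex.exp_ne_zero (θ * Complex.I)
      field_simp
    simp_rw [hsplit]
    rw [intervalIntegral.integral_add, intervalIntegral.integral_const_mul,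
      intervalIntegral.integral_const_mul, h2, ← h1]
    · have : (Real.pi : ℂ) ≠ 0 := by exact_mod_cast Real.pi_pos.ne'
      simp only [smul_eq_mul]
      have := Complex.I_ne_zero
      field_simp
      ring
    · exact (continuous_const.mul (hc.mul hcont)).intervalIntegrable _ _
    · exact (continuous_const.mul ((hc.inv₀ hne).mul hcont)).intervalIntegrable _ _
  have h6 : IntervalIntegrable (fun θ : ℝ => g (circleMap 0 r θ) * (Real.cos θ : ℂ)) volume 0 (2 * Real.pi) := by
    apply Continuous.intervalIntegrable
    exact hcont.mul (Complex.continuous_ofReal.comp Real.continuous_cos)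
  have h7 := congrArg Complex.re h5
  rw [← Complex.reCLM_apply, ← Complex.reCLM.intervalIntegral_comp_comm h6] at h7
  simp only [Complex.reCLM_apply, Complex.re_mul_ofReal] at h7
  rw [h7, ← Complex.ofReal_mul, Complex.re_ofReal_mul]

theorem integral_log_one_sub_div_mul_cos_of_lt {μ : ℂ} {r : ℝ} (hr : 0 < r) (h : r < ‖μ‖) :
    ∫ θ in (0 : ℝ)..2 * Real.pi, Real.log ‖1 - circleMap 0 r θ / μ‖ * Real.cos θ =
      -(Real.pi * r * (1 / μ).re) := by
  have hμ : 0 < ‖μ‖ := hr.trans h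
  have hslit : ∀ z ∈ Metric.ball (0 : ℂ) ‖μ‖, 1 - z / μ ∈ Complex.slitPlane := fun z hz => by
    left
    have h1 : ‖z / μ‖ < 1 := by
      rw [norm_div, div_lt_one hμ]; simpa using hz
    have := (abs_le.1 (Complex.abs_re_le_norm (z / μ))).2
    simp only [Complex.sub_re, Complex.one_re]
    linarith
  have hd : DifferentiableOn ℂ (fun z => Complex.log (1 - z / μ)) (Metric.ball 0 ‖μ‖) := fun z hz =>
    (DifferentiableAt.clog (f := fun z => 1 - z / μ) (by fun_prop) (hslit z hz)).differentiableWithinAt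
  have h1 := integral_re_mul_cos hr h hd
  have h2 : deriv (fun z => Complex.log (1 - z / μ)) 0 = -(1 / μ) := by
    have := (((hasDerivAt_id (0 : ℂ)).div_const μ).const_sub 1).clog (hslit 0 (Metric.mem_ball_self hμ))
    simpa using this.deriv
  rw [h2] at h1
  simp only [Complex.log_re] at h1
  rw [h1, Complex.neg_re]; ring

theorem continuous_log_one_sub_div {μ : ℂ} (hμ : μ ≠ 0) {r : ℝ} (hr : 0 < r) (h : ‖μ‖ ≠ r) :
    Continuous fun θ : ℝ => Real.log ‖1 - circleMap 0 r θ / μ‖ := by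
  refine Continuous.log ?_ fun θ => ?_
  · have := continuous_circleMap 0 r
    fun_prop
  · rw [norm_ne_zero_iff]
    intro h0
    rw [sub_eq_zero, eq_comm, div_eq_one_iff_eq hμ] at h0
    rw [← h0] at h
    simp [abs_of_pos hr] at h

/-- Reflect μ to ν = r²/conj μ, outside the circle. On |ζ| = r one has |1 − ζ/μ| = (r/|μ|)|1 − ζ/ν|,
and the constant log(r/|μ|) is orthogonal to the cosine. -/
theorem integral_log_one_sub_div_mul_cos_of_gt {μ : ℂ} {r : ℝ} (hμ : μ ≠ 0) (h : ‖μ‖ < r) :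
    ∫ θ in (0 : ℝ)..2 * Real.pi, Real.log ‖1 - circleMap 0 r θ / μ‖ * Real.cos θ =
      -(Real.pi / r * (‖μ‖ ^ 2 * (1 / μ).re)) := by
  have hμ' : 0 < ‖μ‖ := norm_pos_iff.2 hμ
  have hr : 0 < r := hμ'.trans h
  have hr' : (r : ℂ) ≠ 0 := by exact_mod_cast hr.ne'
  have hcμ : (starRingEnd ℂ) μ ≠ 0 := by simpa using hμ
  set ν : ℂ := r ^ 2 / (starRingEnd ℂ) μ with hν
  have hνn : ‖ν‖ = r ^ 2 / ‖μ‖ := by simp [hν, abs_of_pos hr]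
  have hν1 : r < ‖ν‖ := by rw [hνn, lt_div_iff₀ hμ', sq]; exact mul_lt_mul_of_pos_left h hr
  have hν0 : ν ≠ 0 := norm_pos_iff.1 (hr.trans hν1)
  have h1 := integral_log_one_sub_div_mul_cos_of_lt hr hν1
  have hpt : ∀ θ : ℝ, Real.log ‖1 - circleMap 0 r θ / μ‖ * Real.cos θ =
      Real.log (r / ‖μ‖) * Real.cos θ + Real.log ‖1 - circleMap 0 r θ / ν‖ * Real.cos θ := fun θ => by
    set ζ := circleMap 0 r θ with hζ
    have hζn : ‖ζ‖ = r := by simp [hζ, abs_of_pos hr]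
    have hζ0 : ζ ≠ 0 := norm_pos_iff.1 (by rw [hζn]; exact hr)
    have hζc : ζ * (starRingEnd ℂ) ζ = r ^ 2 := by
      rw [Complex.mul_conj, Complex.normSq_eq_norm_sq, hζn]; push_cast; ring
    have hval : ‖1 - ζ / μ‖ = r / ‖μ‖ * ‖1 - ζ / ν‖ := by
      have e1 : 1 - ζ / ν = (ζ / r ^ 2) * (starRingEnd ℂ) (ζ - μ) := by
        rw [hν, map_sub]
        have : ζ / (r ^ 2 / (starRingEnd ℂ) μ) = ζ * (starRingEnd ℂ) μ / r ^ 2 := by field_simp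
        rw [this, mul_sub, div_mul_eq_mul_div, hζc]
        field_simp
      have e2 : 1 - ζ / μ = -(ζ - μ) / μ := by field_simp; ring
      rw [e1, e2, norm_div, norm_neg, norm_mul, RCLike.norm_conj, norm_div, norm_pow, hζn,
        Complex.norm_real, Real.norm_eq_abs, abs_of_pos hr]
      field_simp
    have hne : ‖1 - ζ / ν‖ ≠ 0 := by
      rw [norm_ne_zero_iff]
      intro h0
      rw [sub_eq_zero, eq_comm, div_eq_one_iff_eq hν0] at h0
      rw [← h0, hζn] at hν1
      exact lt_irrefl _ hν1
    rw [hval, Real.log_mul (by positivity) hne]; ring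
  simp_rw [hpt]
  rw [intervalIntegral.integral_add, h1, intervalIntegral.integral_const_mul, integral_cos]
  · have : (1 / ν).re = ‖μ‖ ^ 2 * (1 / μ).re / r ^ 2 := by
      have e1 : 1 / ν = ((‖μ‖ ^ 2 / r ^ 2 : ℝ) : ℂ) * (1 / μ) := by
        have hm : μ * (starRingEnd ℂ) μ = (‖μ‖ : ℂ) ^ 2 := by
          rw [Complex.mul_conj, Complex.normSq_eq_norm_sq]; push_cast; ring
        rw [hν]; push_cast; rw [← hm]; field_simp
      rw [e1, Complex.re_ofReal_mul]; ring
    rw [this]; simp; field_simp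
  · exact (continuous_const.mul Real.continuous_cos).intervalIntegrable _ _
  · exact ((continuous_log_one_sub_div hν0 hr hν1.ne').mul Real.continuous_cos).intervalIntegrable _ _

theorem integral_step {m r : ℝ} (hm : 0 ≤ m) (hmr : m ≤ r) (c : ℝ) :
    IntervalIntegrable (fun t => 2 * t * (if m < t then c else 0)) volume 0 r ∧
      ∫ t in (0 : ℝ)..r, 2 * t * (if m < t then c else 0) = c * (r ^ 2 - m ^ 2) := by
  have h1 : Set.EqOn (fun _ => (0 : ℝ)) (fun t => 2 * t * (if m < t then c else 0)) (Set.uIoc 0 m) := fun t ht => by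
    rw [Set.uIoc_of_le hm] at ht
    simp [not_lt.2 ht.2]
  have h2 : Set.EqOn (fun t => 2 * t * c) (fun t => 2 * t * (if m < t then c else 0)) (Set.uIoc m r) := fun t ht => by
    rw [Set.uIoc_of_le hmr] at ht
    simp [ht.1]
  have i1 : IntervalIntegrable (fun t => 2 * t * (if m < t then c else 0)) volume 0 m :=
    (intervalIntegrable_const (c := (0 : ℝ))).congr h1
  have i2 : IntervalIntegrable (fun t => 2 * t * (if m < t then c else 0)) volume m r :=
    (Continuous.intervalIntegrable (by fun_prop) m r).congr h2
  refine ⟨i1.trans i2, ?_⟩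
  rw [← intervalIntegral.integral_add_adjacent_intervals i1 i2,
    ← intervalIntegral.integral_congr_ae (ae_of_all _ fun t ht => h1 ht),
    ← intervalIntegral.integral_congr_ae (ae_of_all _ fun t ht => h2 ht)]
  rw [intervalIntegral.integral_mul_const, intervalIntegral.integral_const_mul, integral_id]
  simp
  ring

section

variable {Λ : Set ℂ} {E : ℂ → ℂ}

theorem IsGenerator.coeff_re_eq (hE : IsGenerator Λ E) {t r : ℝ} (htr : t ≤ r) :
    (hE.coeff t).re = (deriv E 0).re + ∑ μ ∈ hE.zerosIn r, if ‖μ‖ < t then (1 / μ).re else 0 := by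
  rw [IsGenerator.coeff, Complex.add_re, Complex.re_sum, ← Finset.sum_filter]
  congr 1
  refine Finset.sum_congr ?_ fun _ _ => rfl
  ext μ
  simp only [Finset.mem_filter, hE.mem_zerosIn]
  exact ⟨fun h => ⟨⟨h.1, h.2.trans_le htr⟩, h.2⟩, fun h => ⟨h.1.1, h.2⟩⟩

/-- As a function of t the coefficient is a finite sum of steps, and a step at |μ| integrates
against 2t to r² − |μ|², the weight with which a zero inside the circle enters the cosine moment. -/
theorem IsGenerator.integral_coeff (hE : IsGenerator Λ E) {r : ℝ} (hr : 0 ≤ r) :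
    IntervalIntegrable (fun t => 2 * t * (hE.coeff t).re) volume 0 r ∧
      ∫ t in (0 : ℝ)..r, 2 * t * (hE.coeff t).re =
        (deriv E 0).re * r ^ 2 + ∑ μ ∈ hE.zerosIn r, (1 / μ).re * (r ^ 2 - ‖μ‖ ^ 2) := by
  have heq : Set.EqOn (fun t => 2 * t * (deriv E 0).re + ∑ μ ∈ hE.zerosIn r,
      2 * t * (if ‖μ‖ < t then (1 / μ).re else 0)) (fun t => 2 * t * (hE.coeff t).re) (Set.uIoc 0 r) := by
    intro t ht
    rw [Set.uIoc_of_le hr] at ht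
    simp only
    rw [hE.coeff_re_eq ht.2, mul_add, Finset.mul_sum]
  have hst : ∀ μ ∈ hE.zerosIn r, _ := fun μ hμ =>
    integral_step (norm_nonneg μ) (hE.mem_zerosIn.1 hμ).2.le (1 / μ).re
  have i1 : IntervalIntegrable (fun t : ℝ => 2 * t * (deriv E 0).re) volume 0 r :=
    Continuous.intervalIntegrable (by fun_prop) _ _
  have i2 : IntervalIntegrable (fun t : ℝ => ∑ μ ∈ hE.zerosIn r,
      2 * t * (if ‖μ‖ < t then (1 / μ).re else 0)) volume 0 r := by
    have := IntervalIntegrable.sum (hE.zerosIn r) fun μ hμ => (hst μ hμ).1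
    simpa only [Finset.sum_fn] using this
  refine ⟨(i1.add i2).congr heq, ?_⟩
  rw [← intervalIntegral.integral_congr_ae (ae_of_all _ fun t ht => heq ht),
    intervalIntegral.integral_add i1 i2, intervalIntegral.integral_finsetSum fun μ hμ => (hst μ hμ).1]
  congr 1
  · rw [intervalIntegral.integral_mul_const, intervalIntegral.integral_const_mul, integral_id]
    simp; ring
  · exact Finset.sum_congr rfl fun μ hμ => (hst μ hμ).2

/-- The first cosine moment of `log |E|` on a circle free of zeros. -/
theorem IsGenerator.integral_log_mul_cos (hE : IsGenerator Λ E) {r : ℝ} (hr : 0 < r)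
    (hrΛ : ∀ μ, E μ = 0 → ‖μ‖ ≠ r) :
    ∫ θ in (0 : ℝ)..2 * Real.pi, Real.log ‖E (circleMap 0 r θ)‖ * Real.cos θ =
      Real.pi / r * ∫ t in (0 : ℝ)..r, 2 * t * (hE.coeff t).re := by
  obtain ⟨K, -, hK⟩ := hE.exists_factor
  obtain ⟨g, hg, hgd, hEg, -, -⟩ := hK (r + 1) (by linarith)
  have hne : ∀ μ ∈ hE.zerosIn (r + 1), μ ≠ 0 ∧ ‖μ‖ ≠ r := fun μ hμ =>
    ⟨hE.ne_zero_of_mem_zerosIn hμ, hrΛ μ (hE.mem_zerosIn.1 hμ).1⟩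
  have hpt : ∀ θ : ℝ, Real.log ‖E (circleMap 0 r θ)‖ * Real.cos θ =
      (∑ μ ∈ hE.zerosIn (r + 1), Real.log ‖1 - circleMap 0 r θ / μ‖ * Real.cos θ) +
        (g (circleMap 0 r θ)).re * Real.cos θ := fun θ => by
    have hζ : ‖circleMap 0 r θ‖ = r := by simp [abs_of_pos hr]
    rw [hEg _ (by simp [abs_of_pos hr]), norm_mul, norm_prod, Complex.norm_exp, Real.log_mul,
      Real.log_exp, Real.log_prod, add_mul, Finset.sum_mul]
    · intro μ hμ
      rw [norm_ne_zero_iff]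
      intro h0
      rw [sub_eq_zero, eq_comm, div_eq_one_iff_eq (hne μ hμ).1] at h0
      exact (hne μ hμ).2 (h0 ▸ hζ)
    · refine Finset.prod_ne_zero_iff.2 fun μ hμ => ?_
      rw [norm_ne_zero_iff]
      intro h0
      rw [sub_eq_zero, eq_comm, div_eq_one_iff_eq (hne μ hμ).1] at h0
      exact (hne μ hμ).2 (h0 ▸ hζ)
    · positivity
  simp_rw [hpt]
  have hci : ∀ μ ∈ hE.zerosIn (r + 1), IntervalIntegrable
      (fun θ : ℝ => Real.log ‖1 - circleMap 0 r θ / μ‖ * Real.cos θ) volume 0 (2 * Real.pi) := fun μ hμ =>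
    ((continuous_log_one_sub_div (hne μ hμ).1 hr (hne μ hμ).2).mul Real.continuous_cos).intervalIntegrable _ _
  rw [intervalIntegral.integral_add, intervalIntegral.integral_finsetSum hci,
    integral_re_mul_cos hr (by linarith) hg, (hE.integral_coeff hr.le).2, hgd, IsGenerator.coeff,
    Complex.add_re, Complex.re_sum]
  -- The factorisation is taken at radius r + 1 to be analytic beyond the circle. Zeros outside the
  -- circle cancel against the coefficient of radius r + 1; those inside leave (π/r) Re(1/μ)(r² −
  -- |μ|²).
  · have hsum : (∑ μ ∈ hE.zerosIn (r + 1),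
          ∫ θ in (0 : ℝ)..2 * Real.pi, Real.log ‖1 - circleMap 0 r θ / μ‖ * Real.cos θ) +
        Real.pi * r * ∑ μ ∈ hE.zerosIn (r + 1), (1 / μ).re =
        ∑ μ ∈ hE.zerosIn r, Real.pi / r * ((1 / μ).re * (r ^ 2 - ‖μ‖ ^ 2)) := by
      rw [Finset.mul_sum, ← Finset.sum_add_distrib]
      symm
      apply Finset.sum_subset_zero_on_sdiff
      · intro μ hμ
        rw [hE.mem_zerosIn] at hμ ⊢
        exact ⟨hμ.1, by linarith [hμ.2]⟩
      · intro μ hμ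
        rw [Finset.mem_sdiff, hE.mem_zerosIn, hE.mem_zerosIn] at hμ
        have h1 : r < ‖μ‖ := lt_of_le_of_ne (not_lt.1 fun h => hμ.2 ⟨hμ.1.1, h⟩) (hrΛ μ hμ.1.1).symm
        rw [integral_log_one_sub_div_mul_cos_of_lt hr h1]; ring
      · intro μ hμ
        rw [integral_log_one_sub_div_mul_cos_of_gt (hE.ne_zero_of_mem_zerosIn hμ) (hE.mem_zerosIn.1 hμ).2]
        field_simp
        ring
    rw [← Finset.mul_sum] at hsum
    rw [mul_add, mul_add, ← hsum]
    field_simp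
    ring
  · have := IntervalIntegrable.sum (hE.zerosIn (r + 1)) hci
    simpa only [Finset.sum_fn] using this
  · refine Continuous.intervalIntegrable ?_ _ _
    have hsub : Metric.closedBall (0 : ℂ) r ⊆ Metric.ball 0 (r + 1) := Metric.closedBall_subset_ball (by linarith)
    have := (hg.continuousOn.mono hsub).comp_continuous (continuous_circleMap 0 r)
      fun θ => circleMap_mem_closedBall 0 hr.le θ
    exact (Complex.continuous_re.comp this).mul Real.continuous_cos

/-- The averages `r⁻² ∫₀ʳ 2 t f(t) dt` have the same limit as `f`. -/
theorem eventually_le_abs_integral {f : ℝ → ℝ} {β : ℝ} (hf : Tendsto f atTop (𝓝 β)) (hβ : β ≠ 0)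
    (hi : ∀ r, 0 ≤ r → IntervalIntegrable (fun t => 2 * t * f t) volume 0 r) :
    ∀ᶠ r in atTop, |β| / 2 * r ^ 2 ≤ |∫ t in (0 : ℝ)..r, 2 * t * f t| := by
  have hβ' : 0 < |β| := abs_pos.2 hβ
  obtain ⟨T, hT⟩ := eventually_atTop.1 (hf (Metric.closedBall_mem_nhds β (by positivity : 0 < |β| / 4)))
  set T' := max T 0
  have hT'0 : 0 ≤ T' := le_max_right _ _
  set Q := |∫ t in (0 : ℝ)..T', 2 * t * f t| + |β| * T' ^ 2
  have hev : ∀ᶠ r : ℝ in atTop, Q ≤ |β| / 4 * r ^ 2 :=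
    ((tendsto_pow_atTop two_ne_zero).const_mul_atTop (by positivity)).eventually_ge_atTop Q
  filter_upwards [hev, eventually_ge_atTop T'] with r hr hrT
  have hr0 : 0 ≤ r := hT'0.trans hrT
  have i1 := hi T' hT'0
  have i2 : IntervalIntegrable (fun t => 2 * t * f t) volume T' r := (hi T' hT'0).symm.trans (hi r hr0)
  have i3 : IntervalIntegrable (fun t : ℝ => 2 * t * β) volume T' r :=
    Continuous.intervalIntegrable (by fun_prop) _ _
  have hI : ∀ c : ℝ, ∫ t in T'..r, 2 * t * c = c * (r ^ 2 - T' ^ 2) := fun c => by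
    rw [intervalIntegral.integral_mul_const, intervalIntegral.integral_const_mul, integral_id]; ring
  have hb : |(∫ t in T'..r, 2 * t * f t) - β * (r ^ 2 - T' ^ 2)| ≤ |β| / 4 * (r ^ 2 - T' ^ 2) := by
    rw [← hI β, ← hI (|β| / 4), ← intervalIntegral.integral_sub i2 i3, ← Real.norm_eq_abs]
    refine intervalIntegral.norm_integral_le_of_norm_le hrT (ae_of_all _ fun t ht => ?_)
      (Continuous.intervalIntegrable (by fun_prop) _ _)
    have ht0 : 0 ≤ t := hT'0.trans ht.1.le
    have := hT t ((le_max_left _ _).trans ht.1.le)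
    rw [Metric.mem_closedBall, Real.dist_eq] at this
    rw [← mul_sub, norm_mul, Real.norm_eq_abs, Real.norm_eq_abs, abs_of_nonneg (by positivity)]
    gcongr
  rw [← intervalIntegral.integral_add_adjacent_intervals i1 i2]
  have h1 : |β * (r ^ 2 - T' ^ 2)| = |β| * (r ^ 2 - T' ^ 2) := by
    rw [abs_mul, abs_of_nonneg (by nlinarith : 0 ≤ r ^ 2 - T' ^ 2)]
  have h2 := abs_sub_abs_le_abs_sub (β * (r ^ 2 - T' ^ 2)) (∫ t in T'..r, 2 * t * f t)
  rw [abs_sub_comm, h1] at h2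
  have h3 := abs_sub_abs_le_abs_sub (∫ t in T'..r, 2 * t * f t) (-∫ t in (0 : ℝ)..T', 2 * t * f t)
  rw [sub_neg_eq_add, abs_neg, add_comm (∫ t in T'..r, 2 * t * f t)] at h3
  have : 0 ≤ |β| * T' ^ 2 := by positivity
  simp only [Q] at hr
  linarith

end

/-! ### The exponential type of the generator cannot be lowered -/

/-- A function bounded by `1` on the upper half-plane which is small on a disc is dominated by a
power of a Blaschke factor outside that disc. -/
theorem norm_mul_pow_le_of_small_on_disc {f : ℂ → ℂ} {w : ℂ} {s q δ : ℝ} {m : ℕ}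
    (hf : ∀ z : ℂ, 0 ≤ z.im → DifferentiableAt ℂ f z) (hf1 : ∀ z : ℂ, 0 ≤ z.im → ‖f z‖ ≤ 1)
    (hs : 0 < s) (hsm : ∀ z : ℂ, ‖z - w‖ = s → ‖f z‖ ≤ δ)
    (hq : ∀ z : ℂ, ‖z - w‖ = s → ‖z - (starRingEnd ℂ) w‖ ≤ q * ‖z - w‖) (hδ : δ * q ^ m ≤ 1)
    {z : ℂ} (hz : 0 < z.im) (hzw : s < ‖z - w‖) :
    ‖f z‖ * (‖z - (starRingEnd ℂ) w‖ / ‖z - w‖) ^ m ≤ 1 := by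
  set h : ℂ → ℂ := fun z => f z * ((z - (starRingEnd ℂ) w) / (z - w)) ^ m with hh
  have hn : ∀ z, ‖h z‖ = ‖f z‖ * (‖z - (starRingEnd ℂ) w‖ / ‖z - w‖) ^ m := fun z => by
    simp [hh]
  rw [← hn]
  -- Maximum principle on the half disc of radius ρ with the small disc removed: the quotient has
  -- modulus 1 on the real axis, `hδ` handles the small circle, and the large arc costs a factor
  -- tending to 1.
  have hlim : Tendsto (fun ρ : ℝ => ((ρ + ‖w‖) / (ρ - ‖w‖)) ^ m) atTop (𝓝 1) := by
    have h1 : Tendsto (fun ρ : ℝ => 1 + 2 * ‖w‖ / (ρ - ‖w‖)) atTop (𝓝 (1 + 0)) :=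
      tendsto_const_nhds.add (tendsto_const_nhds.div_atTop (tendsto_atTop_add_const_right _ _ tendsto_id))
    have h2 : Tendsto (fun ρ : ℝ => (ρ + ‖w‖) / (ρ - ‖w‖)) atTop (𝓝 1) := by
      rw [add_zero] at h1
      refine h1.congr' ?_
      filter_upwards [eventually_gt_atTop ‖w‖] with ρ hρ
      have : ρ - ‖w‖ ≠ 0 := by linarith
      field_simp
      ring
    simpa using h2.pow m
  refine ge_of_tendsto hlim ?_
  filter_upwards [eventually_gt_atTop ‖w‖, eventually_gt_atTop ‖z‖] with ρ hρw hρz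
  set U : Set ℂ := {z | 0 < z.im ∧ ‖z‖ < ρ ∧ s < ‖z - w‖} with hU
  have hUo : IsOpen U := by
    have h1 : IsOpen {z : ℂ | 0 < z.im} := isOpen_lt continuous_const Complex.continuous_im
    have h2 : IsOpen {z : ℂ | ‖z‖ < ρ} := isOpen_lt continuous_norm continuous_const
    have h3 : IsOpen {z : ℂ | s < ‖z - w‖} := isOpen_lt continuous_const (by fun_prop)
    exact h1.inter (h2.inter h3)
  have hUc : closure U ⊆ {z | 0 ≤ z.im ∧ ‖z‖ ≤ ρ ∧ s ≤ ‖z - w‖} := by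
    have h1 : IsClosed {z : ℂ | 0 ≤ z.im} := isClosed_le continuous_const Complex.continuous_im
    have h2 : IsClosed {z : ℂ | ‖z‖ ≤ ρ} := isClosed_le continuous_norm continuous_const
    have h3 : IsClosed {z : ℂ | s ≤ ‖z - w‖} := isClosed_le continuous_const (by fun_prop)
    exact closure_minimal (fun z hz => ⟨hz.1.le, hz.2.1.le, hz.2.2.le⟩) (h1.inter (h2.inter h3))
  have hUb : Bornology.IsBounded U := (Metric.isBounded_ball (x := (0 : ℂ)) (r := ρ)).subset
    fun z hz => by simpa using hz.2.1
  have hκ : 1 ≤ (ρ + ‖w‖) / (ρ - ‖w‖) := by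
    rw [le_div_iff₀ (by linarith)]
    linarith [norm_nonneg w]
  have hκm : 1 ≤ ((ρ + ‖w‖) / (ρ - ‖w‖)) ^ m := one_le_pow₀ hκ
  refine Complex.norm_le_of_forall_mem_frontier_norm_le hUb (f := h) ?_ (fun ζ hζ => ?_)
    (subset_closure (show z ∈ U from ⟨hz, hρz, hzw⟩))
  · refine DifferentiableOn.diffContOnCl fun ζ hζ => ?_
    obtain ⟨h1, -, h3⟩ := hUc hζ
    have hne : ζ - w ≠ 0 := norm_pos_iff.1 (hs.trans_le h3)
    have hd : DifferentiableAt ℂ (fun z => ((z - (starRingEnd ℂ) w) / (z - w)) ^ m) ζ :=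
      DifferentiableAt.fun_pow (DifferentiableAt.fun_div (c := fun z => z - (starRingEnd ℂ) w)
        (d := fun z => z - w) (by fun_prop) (by fun_prop) hne) m
    exact ((hf ζ h1).mul hd).differentiableWithinAt
  · rw [hUo.frontier_eq] at hζ
    obtain ⟨h1, h2, h3⟩ := hUc hζ.1
    have hpos : 0 < ‖ζ - w‖ := hs.trans_le h3
    rw [hn]
    rcases h1.eq_or_lt with h1' | h1'
    · have : ‖ζ - (starRingEnd ℂ) w‖ = ‖ζ - w‖ := by
        have : ζ - (starRingEnd ℂ) w = (starRingEnd ℂ) (ζ - w) := by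
          rw [map_sub, Complex.conj_eq_iff_im.2 h1'.symm]
        rw [this, RCLike.norm_conj]
      rw [this, div_self hpos.ne', one_pow, mul_one]
      exact (hf1 ζ h1).trans hκm
    rcases h3.eq_or_lt with h3' | h3'
    · refine le_trans ?_ hκm
      have hle : ‖ζ - (starRingEnd ℂ) w‖ / ‖ζ - w‖ ≤ q := by
        rw [div_le_iff₀ hpos]; exact hq ζ h3'.symm
      have hδ0 : 0 ≤ δ := (norm_nonneg _).trans (hsm ζ h3'.symm)
      calc _ ≤ δ * q ^ m := by gcongr; exact hsm ζ h3'.symm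
        _ ≤ 1 := hδ
    · have h2' : ‖ζ‖ = ρ := by
        by_contra hne
        exact hζ.2 ⟨h1', lt_of_le_of_ne h2 hne, h3'⟩
      have e1 : ‖ζ - (starRingEnd ℂ) w‖ ≤ ρ + ‖w‖ := by
        have := norm_sub_le ζ ((starRingEnd ℂ) w)
        rwa [RCLike.norm_conj, h2'] at this
      have e2 : ρ - ‖w‖ ≤ ‖ζ - w‖ := by
        have := norm_sub_norm_le ζ w
        rwa [h2'] at this
      calc _ ≤ 1 * ((ρ + ‖w‖) / (ρ - ‖w‖)) ^ m := by
            gcongr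
            · exact hf1 ζ h1
            · linarith [norm_nonneg w]
        _ = _ := one_mul _

/-- From |z − w|² = |z − conj w|² − 4R Im z and |z − conj w| ≤ 2R, the squared ratio is at most 1 −
Im z/R ≤ e^{−Im z/R}. -/
theorem div_norm_sub_conj_le {w z : ℂ} {R : ℝ} (hw : w = R * Complex.I) (hR : 0 < R) (hzR : ‖z‖ ≤ R)
    (hz : 0 < z.im) : ‖z - w‖ ≤ Real.exp (-(z.im / (2 * R))) * ‖z - (starRingEnd ℂ) w‖ := by
  have h1 : ‖z - w‖ ^ 2 = ‖z - (starRingEnd ℂ) w‖ ^ 2 - 4 * z.im * R := by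
    rw [← Complex.normSq_eq_norm_sq, ← Complex.normSq_eq_norm_sq, hw]
    simp [Complex.normSq_apply]
    ring
  have h2 : ‖z - (starRingEnd ℂ) w‖ ≤ 2 * R := by
    have := norm_sub_le z ((starRingEnd ℂ) w)
    rw [RCLike.norm_conj, hw] at this
    simp [abs_of_pos hR] at this
    rw [hw]
    simp
    linarith
  have h3 : ‖z - (starRingEnd ℂ) w‖ ^ 2 ≤ (2 * R) ^ 2 := by gcongr
  have h4 : ‖z - w‖ ^ 2 ≤ (1 - z.im / R) * ‖z - (starRingEnd ℂ) w‖ ^ 2 := by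
    rw [h1]
    have : z.im / R * ‖z - (starRingEnd ℂ) w‖ ^ 2 ≤ z.im / R * (2 * R) ^ 2 := by gcongr
    have e : z.im / R * (2 * R) ^ 2 = 4 * z.im * R := by field_simp; ring
    linarith
  have h5 : 1 - z.im / R ≤ Real.exp (-(z.im / (2 * R))) ^ 2 := by
    rw [← Real.exp_nat_mul]
    have := Real.add_one_le_exp (-(z.im / R))
    have e : ((2 : ℕ) : ℝ) * -(z.im / (2 * R)) = -(z.im / R) := by push_cast; field_simp
    rw [e]; linarith
  refine abs_le_of_sq_le_sq' ?_ (by positivity) |>.2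
  rw [mul_pow]
  exact h4.trans (by gcongr)

/-- If the exponential type `π` in the upper half-plane cannot be lowered, then `E` is almost as large
as its type allows near every point `iR` with `R` large. -/
theorem eventually_exists_exp_le_norm {E : ℂ → ℂ} (hE : Differentiable ℂ E) {C : ℝ} (hC : 1 ≤ C)
    (hb : ∀ z, ‖E z‖ ≤ C * (1 + ‖z‖) * Real.exp (Real.pi * |z.im|))
    (hsharp : ∀ σ > 0, ∀ C' : ℝ, ¬ ∀ z : ℂ, 0 < z.im →
      ‖E z‖ ≤ C' * (1 + ‖z‖) * Real.exp ((Real.pi - σ) * z.im))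
    {η ε : ℝ} (hη : 0 < η) (hη1 : η < 1) (hε : 0 < ε) :
    ∀ᶠ R : ℝ in atTop, ∃ z : ℂ, ‖z - R * Complex.I‖ ≤ η * R ∧
      Real.exp (Real.pi * z.im - ε * R) ≤ ‖E z‖ := by
  by_contra hcon
  rw [not_eventually] at hcon
  set L := Real.log (3 / η) with hL
  have hL0 : 0 < L := Real.log_pos (by rw [lt_div_iff₀ hη]; linarith)
  have hone : ∀ z : ℂ, 0 ≤ z.im → 1 + ‖z‖ ≤ 2 * ‖z + Complex.I‖ ∧ 1 ≤ ‖z + Complex.I‖ := fun z hz => by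
    have h1 : ‖z + Complex.I‖ ^ 2 = ‖z‖ ^ 2 + 2 * z.im + 1 := by
      rw [← Complex.normSq_eq_norm_sq, ← Complex.normSq_eq_norm_sq]
      simp [Complex.normSq_apply]; ring
    constructor
    · refine abs_le_of_sq_le_sq' ?_ (by positivity) |>.2
      nlinarith [sq_nonneg (‖z‖ - 1), sq_nonneg ‖z‖]
    · refine abs_le_of_sq_le_sq' ?_ (by positivity) |>.2
      nlinarith [sq_nonneg ‖z‖]
  -- Normalised to |f| ≤ 1 in the closed upper half-plane, since 1 + |z| ≤ 2|z + i| there.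
  set f : ℂ → ℂ := fun z => E z * Complex.exp (Complex.I * Real.pi * z) / (2 * C * (z + Complex.I)) with hf
  have hfn : ∀ z, ‖f z‖ = ‖E z‖ * Real.exp (-(Real.pi * z.im)) / (2 * C * ‖z + Complex.I‖) := fun z => by
    simp [hf, Complex.norm_exp, abs_of_pos (by linarith : 0 < C)]
  have hfd : ∀ z : ℂ, 0 ≤ z.im → DifferentiableAt ℂ f z := fun z hz => by
    have hne : (2 * C * (z + Complex.I) : ℂ) ≠ 0 := by
      have : z + Complex.I ≠ 0 := norm_pos_iff.1 (by linarith [(hone z hz).2])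
      have : (C : ℂ) ≠ 0 := by exact_mod_cast (by linarith : C ≠ 0)
      exact mul_ne_zero (mul_ne_zero two_ne_zero ‹_›) ‹_›
    exact DifferentiableAt.fun_div ((hE z).mul (by fun_prop)) (by fun_prop) hne
  have hf1 : ∀ z : ℂ, 0 ≤ z.im → ‖f z‖ ≤ 1 := fun z hz => by
    obtain ⟨h1, h2⟩ := hone z hz
    rw [hfn, div_le_one (by positivity), Real.exp_neg, ← div_eq_mul_inv, div_le_iff₀ (Real.exp_pos _)]
    have := hb z
    rw [abs_of_nonneg hz] at this
    refine this.trans (mul_le_mul_of_nonneg_right ?_ (Real.exp_nonneg _))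
    nlinarith
  -- If E is small on discs about iR for arbitrarily large R, its type drops by ε/(4L). The power m
  -- = ⌊εR/L⌋ is the largest with e^{−εR}(3/η)^m ≤ 1; since m ≥ εR/(2L), the gain e^{m Im z/(2R)} is
  -- at least e^{ε Im z/(4L)}, uniformly in R.
  refine hsharp (ε / (4 * L)) (by positivity) (2 * C) fun z hz => ?_
  have hev : ∀ᶠ R : ℝ in atTop, 0 < R ∧ ‖z‖ ≤ R ∧ 1 ≤ ε * R / (2 * L) ∧ 2 * ‖z‖ < (1 - η) * R := by
    have h1 : ∀ᶠ R : ℝ in atTop, 2 * L / ε ≤ R := eventually_ge_atTop _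
    have h2 : ∀ᶠ R : ℝ in atTop, 2 * ‖z‖ / (1 - η) < R := eventually_gt_atTop _
    filter_upwards [eventually_gt_atTop 0, eventually_ge_atTop ‖z‖, h1, h2] with R a b c d
    refine ⟨a, b, ?_, ?_⟩
    · rw [div_le_iff₀ hε] at c
      rw [le_div_iff₀ (by positivity)]; linarith
    · rw [div_lt_iff₀ (by linarith)] at d; linarith
  obtain ⟨R, hR, hR0, hzR, hRL, hzη⟩ := (hcon.and_eventually hev).exists
  push Not at hR
  set w : ℂ := R * Complex.I with hw
  have hwn : ‖w‖ = R := by simp [hw, abs_of_pos hR0]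
  set m := ⌊ε * R / L⌋₊ with hm
  have hm1 : (m : ℝ) * L ≤ ε * R := by
    have := Nat.floor_le (by positivity : 0 ≤ ε * R / L)
    rwa [le_div_iff₀ hL0] at this
  have hm2 : ε * R / (2 * L) ≤ m := by
    have h1 := Nat.lt_floor_add_one (ε * R / L)
    have h2 : ε * R / L = 2 * (ε * R / (2 * L)) := by field_simp
    rw [← hm] at h1
    linarith
  have hzw : η * R < ‖z - w‖ := by
    have := norm_sub_norm_le w z
    rw [hwn, norm_sub_rev] at this
    nlinarith [norm_nonneg z]
  have hcirc : ∀ ζ : ℂ, ‖ζ - w‖ = η * R → ‖ζ - (starRingEnd ℂ) w‖ ≤ 3 / η * ‖ζ - w‖ := fun ζ hζ => by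
    have h1 : ‖ζ - (starRingEnd ℂ) w‖ ≤ ‖ζ - w‖ + ‖w - (starRingEnd ℂ) w‖ := norm_sub_le_norm_sub_add_norm_sub _ _ _
    have h2 := norm_sub_le w ((starRingEnd ℂ) w)
    rw [RCLike.norm_conj, hwn] at h2
    rw [hζ] at h1 ⊢
    have : 3 / η * (η * R) = 3 * R := by field_simp
    nlinarith
  have hsm : ∀ ζ : ℂ, ‖ζ - w‖ = η * R → ‖f ζ‖ ≤ Real.exp (-(ε * R)) := fun ζ hζ => by
    have hζ0 : 0 ≤ ζ.im := by
      have h1 := Complex.abs_im_le_norm (ζ - w)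
      rw [hζ] at h1
      have h2 : (ζ - w).im = ζ.im - R := by simp [hw]
      rw [h2] at h1
      nlinarith [(abs_le.1 h1).1]
    have h1 := (hR ζ hζ.le).le
    rw [hfn, div_le_iff₀ (by nlinarith [(hone ζ hζ0).2])]
    calc ‖E ζ‖ * Real.exp (-(Real.pi * ζ.im)) ≤ Real.exp (Real.pi * ζ.im - ε * R) * Real.exp (-(Real.pi * ζ.im)) := by gcongr
      _ = Real.exp (-(ε * R)) * 1 := by rw [← Real.exp_add]; ring_nf
      _ ≤ _ := by
        gcongr
        nlinarith [(hone ζ hζ0).2]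
  have hδ : Real.exp (-(ε * R)) * (3 / η) ^ m ≤ 1 := by
    have : (3 / η) = Real.exp L := (Real.exp_log (by positivity)).symm
    rw [this, ← Real.exp_nat_mul, ← Real.exp_add, Real.exp_le_one_iff]
    linarith
  have key := norm_mul_pow_le_of_small_on_disc hfd hf1 (by positivity : 0 < η * R) hsm hcirc hδ hz hzw
  have hB := div_norm_sub_conj_le hw hR0 hzR hz
  have hzwp : 0 < ‖z - w‖ := lt_trans (by positivity) hzw
  have h1 : Real.exp (z.im / (2 * R)) ≤ ‖z - (starRingEnd ℂ) w‖ / ‖z - w‖ := by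
    rw [le_div_iff₀ hzwp]
    calc _ ≤ Real.exp (z.im / (2 * R)) * (Real.exp (-(z.im / (2 * R))) * ‖z - (starRingEnd ℂ) w‖) := by gcongr
      _ = _ := by rw [← mul_assoc, ← Real.exp_add]; simp
  have h2 : Real.exp (ε / (4 * L) * z.im) ≤ (‖z - (starRingEnd ℂ) w‖ / ‖z - w‖) ^ m := by
    calc Real.exp (ε / (4 * L) * z.im) ≤ Real.exp (m * (z.im / (2 * R))) := by
          rw [Real.exp_le_exp]
          calc ε / (4 * L) * z.im = ε * R / (2 * L) * (z.im / (2 * R)) := by field_simp; ring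
            _ ≤ _ := by gcongr
      _ = Real.exp (z.im / (2 * R)) ^ m := Real.exp_nat_mul _ _
      _ ≤ _ := by gcongr
  have h3 : ‖f z‖ * Real.exp (ε / (4 * L) * z.im) ≤ 1 := le_trans (by gcongr) key
  rw [hfn, div_mul_eq_mul_div, div_le_one (by nlinarith [(hone z hz.le).2])] at h3
  have h4 : ‖z + Complex.I‖ ≤ 1 + ‖z‖ := by
    have := norm_add_le z Complex.I
    rw [Complex.norm_I] at this; linarith
  calc ‖E z‖ = (‖E z‖ * Real.exp (-(Real.pi * z.im)) * Real.exp (ε / (4 * L) * z.im)) *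
        Real.exp ((Real.pi - ε / (4 * L)) * z.im) := by
        rw [mul_assoc, mul_assoc, ← Real.exp_add, ← Real.exp_add]
        ring_nf; simp
    _ ≤ 2 * C * ‖z + Complex.I‖ * Real.exp ((Real.pi - ε / (4 * L)) * z.im) := by gcongr
    _ ≤ _ := by gcongr

section

variable {Λ : Set ℂ} {E : ℂ → ℂ}

/-- The product vanishes on Λ and equals 1 at 0, so by uniqueness it is E itself, and e^{iσz} = 1
near 0. -/
theorem IsGenerator.eq_zero_of_isPaleyWienerOne_mul_exp (hE : IsGenerator Λ E) {σ : ℝ}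
    (hW : IsPaleyWienerOne fun z => E z * Complex.exp (Complex.I * σ * z)) : σ = 0 := by
  have h := hE.unique _ hW fun z hz => by rw [(hE.eq_zero_iff z).2 hz, zero_mul]
  have hne : ∀ᶠ z in 𝓝 (0 : ℂ), E z ≠ 0 :=
    hE.isPaleyWienerOne.differentiable.continuous.continuousAt.eventually_ne
      (by rw [hE.map_zero]; exact one_ne_zero)
  have heq : (fun z => Complex.exp (Complex.I * σ * z)) =ᶠ[𝓝 0] fun _ => 1 := by
    filter_upwards [hne] with z hz
    have := h z
    simp only [hE.map_zero, mul_zero, Complex.exp_zero, one_mul] at this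
    exact (mul_eq_left₀ hz).1 this
  have h1 : HasDerivAt (fun z => Complex.exp (Complex.I * σ * z)) (Complex.I * σ) 0 := by
    simpa using (((hasDerivAt_id (0 : ℂ)).const_mul (Complex.I * σ)).cexp)
  have := h1.unique ((hasDerivAt_const (0 : ℂ) (1 : ℂ)).congr_of_eventuallyEq heq)
  simpa using this

theorem norm_exp_I_mul_ofReal (σ : ℝ) (z : ℂ) : ‖Complex.exp (Complex.I * σ * z)‖ = Real.exp (-(σ * z.im)) := by
  rw [Complex.norm_exp]; simp

theorem summable_mul_exp (hE : IsPaleyWienerOne E) (σ : ℝ) :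
    Summable fun n : ℤ => (‖E (((n : ℝ) + 1 / 2 : ℝ) : ℂ) *
      Complex.exp (Complex.I * σ * (((n : ℝ) + 1 / 2 : ℝ) : ℂ))‖ / (1 + |(n : ℝ)|)) ^ 2 := by
  refine hE.summable.congr fun n => ?_
  rw [norm_mul, norm_exp_I_mul_ofReal, Complex.ofReal_im]
  simp

/-- The exponential type of a generator in the upper half-plane cannot be lowered. -/
theorem IsGenerator.sharp (hE : IsGenerator Λ E) : ∀ σ > 0, ∀ C' : ℝ, ¬ ∀ z : ℂ, 0 < z.im →
    ‖E z‖ ≤ C' * (1 + ‖z‖) * Real.exp ((Real.pi - σ) * z.im) := by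
  intro σ hσ C' h
  have hP := hE.isPaleyWienerOne
  obtain ⟨C, hC⟩ := hP.bound
  -- Only half of σ is used: the other half provides the decay required on the positive imaginary
  -- axis.
  have hW : IsPaleyWienerOne fun z => E z * Complex.exp (Complex.I * ((-(σ / 2) : ℝ) : ℂ) * z) := by
    refine ⟨hP.differentiable.mul (by fun_prop), ⟨max C C', fun z => ?_⟩, summable_mul_exp hP _, ?_⟩
    · rw [norm_mul, norm_exp_I_mul_ofReal]
      rcases lt_or_ge 0 z.im with hz | hz
      · calc _ ≤ C' * (1 + ‖z‖) * Real.exp ((Real.pi - σ) * z.im) * Real.exp (-(-(σ / 2) * z.im)) := by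
              gcongr; exact h z hz
          _ ≤ max C C' * (1 + ‖z‖) * Real.exp ((Real.pi - σ) * z.im) * Real.exp (-(-(σ / 2) * z.im)) := by
              gcongr; exact le_max_right _ _
          _ ≤ _ := by
              have h0 : 0 ≤ max C C' * (1 + ‖z‖) := by
                have := (norm_nonneg _).trans (hC z)
                have h1 : 0 ≤ C * (1 + ‖z‖) := nonneg_of_mul_nonneg_left this (Real.exp_pos _)
                exact h1.trans (by gcongr; exact le_max_left _ _)
              rw [mul_assoc (max C C' * (1 + ‖z‖)), ← Real.exp_add, abs_of_pos hz]
              gcongr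
              nlinarith
      · calc _ ≤ C * (1 + ‖z‖) * Real.exp (Real.pi * |z.im|) * 1 := by
              gcongr
              · exact (norm_nonneg _).trans (hC z)
              · exact hC z
              · rw [Real.exp_le_one_iff]; nlinarith
          _ ≤ _ := by rw [mul_one]; gcongr; exact le_max_left _ _
    · have hlim : Tendsto (fun y : ℝ => C' * (2 * Real.exp (-(σ / 2 * y)))) atTop (𝓝 0) := by
        have : Tendsto (fun y : ℝ => Real.exp (-(σ / 2 * y))) atTop (𝓝 0) :=
          Real.tendsto_exp_neg_atTop_nhds_zero.comp (tendsto_id.const_mul_atTop (by positivity))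
        simpa using (this.const_mul 2).const_mul C'
      refine squeeze_zero' ?_ ?_ hlim
      · filter_upwards [eventually_gt_atTop 0] with y hy
        positivity
      · filter_upwards [eventually_ge_atTop 1] with y hy
        have hy0 : 0 < y := by linarith
        have hb := h (Complex.I * y) (by simpa using hy0)
        rw [norm_mul, norm_exp_I_mul_ofReal, div_le_iff₀ hy0]
        simp only [norm_mul, Complex.norm_I, one_mul, Complex.norm_real, Real.norm_eq_abs,
          abs_of_pos hy0, Complex.mul_im, Complex.I_re, Complex.I_im, zero_mul, zero_add,
          Complex.ofReal_re] at hb ⊢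
        have hC'0 : 0 ≤ C' := by
          have := (norm_nonneg _).trans hb
          have h1 : 0 ≤ C' * (1 + y) := nonneg_of_mul_nonneg_left this (Real.exp_pos _)
          exact nonneg_of_mul_nonneg_left h1 (by linarith)
        calc _ ≤ C' * (1 + y) * Real.exp ((Real.pi - σ) * y) * Real.exp (-(-(σ / 2) * y)) * Real.exp (-(Real.pi * y)) := by
              gcongr
          _ = C' * (1 + y) * Real.exp (-(σ / 2 * y)) := by
              rw [mul_assoc, mul_assoc, ← Real.exp_add, ← Real.exp_add]; ring_nf
          _ ≤ C' * (2 * y) * Real.exp (-(σ / 2 * y)) := by gcongr; linarith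
          _ = _ := by ring
  have := hE.eq_zero_of_isPaleyWienerOne_mul_exp hW
  linarith

/-- The exponential type of a generator in the lower half-plane cannot be lowered. -/
theorem IsGenerator.sharp_neg (hE : IsGenerator Λ E) : ∀ σ > 0, ∀ C' : ℝ, ¬ ∀ z : ℂ, 0 < z.im →
    ‖E (-z)‖ ≤ C' * (1 + ‖z‖) * Real.exp ((Real.pi - σ) * z.im) := by
  intro σ hσ C' h
  have hP := hE.isPaleyWienerOne
  obtain ⟨C, hC⟩ := hP.bound
  -- Here all of σ may be used, because this factor decays in the upper half-plane and the limit on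
  -- the imaginary axis is inherited from E.
  have hW : IsPaleyWienerOne fun z => E z * Complex.exp (Complex.I * (σ : ℂ) * z) := by
    refine ⟨hP.differentiable.mul (by fun_prop), ⟨max C C', fun z => ?_⟩, summable_mul_exp hP _, ?_⟩
    · rw [norm_mul, norm_exp_I_mul_ofReal]
      rcases lt_or_ge z.im 0 with hz | hz
      · have hb := h (-z) (by simpa using hz)
        rw [neg_neg, norm_neg, Complex.neg_im] at hb
        calc _ ≤ C' * (1 + ‖z‖) * Real.exp ((Real.pi - σ) * -z.im) * Real.exp (-(σ * z.im)) := by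
              gcongr
          _ = C' * (1 + ‖z‖) * Real.exp (Real.pi * |z.im|) := by
              rw [mul_assoc, ← Real.exp_add, abs_of_neg hz]; ring_nf
          _ ≤ _ := by gcongr; exact le_max_right _ _
      · calc _ ≤ C * (1 + ‖z‖) * Real.exp (Real.pi * |z.im|) * 1 := by
              gcongr
              · exact (norm_nonneg _).trans (hC z)
              · exact hC z
              · rw [Real.exp_le_one_iff]; nlinarith
          _ ≤ _ := by rw [mul_one]; gcongr; exact le_max_left _ _
    · refine squeeze_zero' ?_ ?_ hP.tendsto
      · filter_upwards [eventually_gt_atTop 0] with y hy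
        positivity
      · filter_upwards [eventually_gt_atTop 0] with y hy
        rw [norm_mul, norm_exp_I_mul_ofReal]
        gcongr
        refine mul_le_of_le_one_right (norm_nonneg _) ?_
        rw [Real.exp_le_one_iff]
        simp
        positivity
  have := hE.eq_zero_of_isPaleyWienerOne_mul_exp hW
  linarith

end

/-! ### Subharmonicity and the area integral of the deficit -/

/-- Subharmonicity of `log |F|`. -/
theorem log_norm_le_circleAverage {F : ℂ → ℂ} (hF : Differentiable ℂ F) {c : ℂ} (hc : F c ≠ 0) {r : ℝ}
    (hr : 0 < r) : Real.log ‖F c‖ ≤ Real.circleAverage (fun z => Real.log ‖F z‖) c r := by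
  have han : AnalyticOnNhd ℂ F (Metric.closedBall c |r|) := fun z _ => hF.analyticAt z
  rw [MeromorphicOn.circleAverage_log_norm hr.ne' han.meromorphicOn,
    (hF.analyticAt c).meromorphicTrailingCoeffAt_of_ne_zero hc]
  have h1 : MeromorphicOn.divisor F (Metric.closedBall c |r|) c = 0 := by
    rw [MeromorphicOn.divisor_apply han.meromorphicOn (Metric.mem_closedBall_self (abs_nonneg r)),
      (hF.analyticAt c).meromorphicNFAt.meromorphicOrderAt_eq_zero_iff.2 hc]
    rfl
  rw [h1]
  simp only [Int.cast_zero, zero_mul, add_zero, le_add_iff_nonneg_left]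
  refine finsum_nonneg fun u => ?_
  by_cases hu : u ∈ Metric.closedBall c |r|
  · refine mul_nonneg (by exact_mod_cast (MeromorphicOn.AnalyticOnNhd.divisor_nonneg han) u) ?_
    rcases eq_or_ne u c with rfl | huc
    · simp
    · refine Real.log_nonneg ?_
      have h2 : 0 < ‖c - u‖ := norm_pos_iff.2 (sub_ne_zero.2 huc.symm)
      rw [← div_eq_mul_inv, le_div_iff₀ h2, one_mul, ← dist_eq_norm, dist_comm]
      simpa [abs_of_pos hr] using hu
  · have : MeromorphicOn.divisor F (Metric.closedBall c |r|) u = 0 := by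
      rw [MeromorphicOn.divisor_def, if_neg (fun h => hu h.2)]
    simp [this]

theorem circleIntegrable_log_norm {F : ℂ → ℂ} (hF : Differentiable ℂ F) (c : ℂ) (r : ℝ) :
    CircleIntegrable (fun z => Real.log ‖F z‖) c r :=
  MeromorphicOn.circleIntegrable_log_norm fun z _ => (hF.analyticAt z).meromorphicAt

/-- Integration over a disc as an integral of circle averages. -/
theorem lintegral_ball_eq {f : ℂ → ℝ} {c : ℂ} (hf : Measurable f) (h0 : ∀ z, 0 ≤ f z)
    (hi : ∀ r, CircleIntegrable f c r) (ρ : ℝ) :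
    ∫⁻ z in Metric.ball c ρ, ENNReal.ofReal (f z) =
      ∫⁻ r in Set.Ioo 0 ρ, ENNReal.ofReal (2 * Real.pi * r * Real.circleAverage f c r) := by
  have hm : Measurable fun z => ENNReal.ofReal (f z) := hf.ennreal_ofReal
  have h1 : ∫⁻ z in Metric.ball c ρ, ENNReal.ofReal (f z) =
      ∫⁻ z, (Metric.ball (0 : ℂ) ρ).indicator (fun z => ENNReal.ofReal (f (c + z))) z := by
    rw [← lintegral_indicator measurableSet_ball, ← lintegral_add_left_eq_self _ c]
    congr 1
    ext z
    simp only [Set.indicator, Metric.mem_ball, dist_eq_norm, add_sub_cancel_left, sub_zero]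
  have hinner : ∀ r : ℝ, ∫⁻ θ in Set.Ioo (-Real.pi) Real.pi, ENNReal.ofReal (f (circleMap c r θ)) =
      ENNReal.ofReal (2 * Real.pi * Real.circleAverage f c r) := fun r => by
    have hper : (fun θ => f (circleMap c r θ)).Periodic (2 * Real.pi) := fun θ => by
      simp [periodic_circleMap c r θ]
    have hii : IntervalIntegrable (fun θ => f (circleMap c r θ)) volume (-Real.pi) Real.pi :=
      hper.intervalIntegrable₀ Real.two_pi_pos.ne' (hi r) _ _
    have hle : -Real.pi ≤ Real.pi := by linarith [Real.pi_pos]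
    have e1 := hper.intervalIntegral_add_eq (-Real.pi) 0
    have e2 : -Real.pi + 2 * Real.pi = Real.pi := by ring
    rw [e2, zero_add] at e1
    rw [Real.circleAverage_def, ← e1, smul_eq_mul, ← mul_assoc, mul_inv_cancel₀ Real.two_pi_pos.ne', one_mul,
      intervalIntegral.integral_of_le hle, ← ofReal_integral_eq_lintegral_ofReal, integral_Ioc_eq_integral_Ioo]
    · exact ((intervalIntegrable_iff_integrableOn_Ioo_of_le hle).1 hii)
    · exact ae_of_all _ fun θ => h0 _
  rw [h1, ← Complex.lintegral_comp_polarCoord_symm, polarCoord_target, Measure.volume_eq_prod,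
    ← Measure.prod_restrict, lintegral_prod]
  · rw [← lintegral_indicator measurableSet_Ioi, ← lintegral_indicator measurableSet_Ioo]
    refine lintegral_congr fun r => ?_
    by_cases hr : 0 < r
    · rw [Set.indicator_of_mem (Set.mem_Ioi.2 hr)]
      have hz : ∀ θ : ℝ, c + Complex.polarCoord.symm (r, θ) = circleMap c r θ := fun θ => by
        rw [Complex.polarCoord_symm_apply, circleMap, Complex.exp_mul_I]
        push_cast; ring
      by_cases hrρ : r < ρ
      · rw [Set.indicator_of_mem (show r ∈ Set.Ioo 0 ρ from ⟨hr, hrρ⟩)]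
        have : ∀ θ : ℝ, (Metric.ball (0 : ℂ) ρ).indicator (fun z => ENNReal.ofReal (f (c + z)))
            (Complex.polarCoord.symm (r, θ)) = ENNReal.ofReal (f (circleMap c r θ)) := fun θ => by
          rw [Set.indicator_of_mem, hz]
          rw [mem_ball_zero_iff, Complex.norm_polarCoord_symm, abs_of_pos hr]
          exact hrρ
        simp_rw [this, smul_eq_mul]
        rw [lintegral_const_mul', hinner, ← ENNReal.ofReal_mul hr.le]
        · congr 1; ring
        · exact ENNReal.ofReal_ne_top
      · rw [Set.indicator_of_notMem (fun h => hrρ h.2)]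
        have : ∀ θ : ℝ, (Metric.ball (0 : ℂ) ρ).indicator (fun z => ENNReal.ofReal (f (c + z)))
            (Complex.polarCoord.symm (r, θ)) = 0 := fun θ => by
          rw [Set.indicator_of_notMem]
          rw [mem_ball_zero_iff, Complex.norm_polarCoord_symm, abs_of_pos hr]
          exact hrρ
        simp_rw [this]
        simp
    · rw [Set.indicator_of_notMem (by simpa using hr), Set.indicator_of_notMem (fun h => hr h.1)]
  · have hpm : Measurable fun p : ℝ × ℝ => Complex.polarCoord.symm p := by
      have : (fun p : ℝ × ℝ => Complex.polarCoord.symm p) =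
          fun p : ℝ × ℝ => (p.1 : ℂ) * (Real.cos p.2 + Real.sin p.2 * Complex.I) := by
        ext p; exact Complex.polarCoord_symm_apply p
      rw [this]
      have : Continuous fun p : ℝ × ℝ => (p.1 : ℂ) * (Real.cos p.2 + Real.sin p.2 * Complex.I) := by fun_prop
      exact this.measurable
    refine Measurable.aemeasurable ?_
    refine (measurable_fst.ennreal_ofReal).smul ?_
    refine Measurable.comp (g := (Metric.ball (0 : ℂ) ρ).indicator (fun z => ENNReal.ofReal (f (c + z)))) ?_ hpm
    exact (hm.comp (measurable_const_add c)).indicator measurableSet_ball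

/-- On every circle about c the mean of log |F| is at least log |F(c)|, so the mean of L − log |F|
is at most B; integrate in polar coordinates. The term p only keeps the integrand nonnegative. -/
theorem lintegral_ball_sub_log_le {F : ℂ → ℂ} (hF : Differentiable ℂ F) {c : ℂ} (hc : F c ≠ 0)
    {p L : ℂ → ℝ} (hp : Continuous p) (hL : Continuous L) (hp0 : ∀ z, 0 ≤ p z)
    (h0 : ∀ z, 0 ≤ p z + (L z - Real.log ‖F z‖)) {ρ A B : ℝ} (hρ : 0 ≤ ρ) (hB : 0 ≤ B)
    (hA : ∀ z ∈ Metric.ball c ρ, L z ≤ A) (hAB : A - Real.log ‖F c‖ ≤ B) :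
    ∫⁻ z in Metric.ball c ρ, ENNReal.ofReal (p z + (L z - Real.log ‖F z‖)) ≤
      ENNReal.ofReal (2 * Real.pi * B * ρ ^ 2) + ∫⁻ z in Metric.ball c ρ, ENNReal.ofReal (p z) := by
  have hlog : ∀ r, CircleIntegrable (fun z => Real.log ‖F z‖) c r := circleIntegrable_log_norm hF c
  have hpi : ∀ r, CircleIntegrable p c r := fun r => hp.continuousOn.circleIntegrable'
  have hLi : ∀ r, CircleIntegrable L c r := fun r => hL.continuousOn.circleIntegrable'
  have hm : Measurable fun z => p z + (L z - Real.log ‖F z‖) :=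
    hp.measurable.add (hL.measurable.sub (Real.measurable_log.comp hF.continuous.norm.measurable))
  rw [lintegral_ball_eq hm h0 (fun r => (hpi r).add ((hLi r).sub (hlog r))) ρ,
    lintegral_ball_eq hp.measurable hp0 hpi ρ]
  have hconst : ENNReal.ofReal (2 * Real.pi * B * ρ ^ 2) =
      ∫⁻ _ in Set.Ioo 0 ρ, ENNReal.ofReal (2 * Real.pi * ρ * B) := by
    rw [setLIntegral_const, Real.volume_Ioo, sub_zero, ← ENNReal.ofReal_mul (by positivity)]
    congr 1; ring
  rw [hconst, ← lintegral_add_left measurable_const]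
  refine setLIntegral_mono' measurableSet_Ioo fun r hr => ?_
  have hr0 : 0 < r := hr.1
  rw [← ENNReal.ofReal_add (by positivity) (by
    have := Real.circleAverage_nonneg_of_nonneg (f := p) (c := c) (R := r) fun z _ => hp0 z
    positivity)]
  refine ENNReal.ofReal_le_ofReal ?_
  have e1 : Real.circleAverage (fun z => p z + (L z - Real.log ‖F z‖)) c r =
      Real.circleAverage p c r + (Real.circleAverage L c r - Real.circleAverage (fun z => Real.log ‖F z‖) c r) := by
    have e0 : CircleIntegrable (fun z => L z - Real.log ‖F z‖) c r := (hLi r).sub (hlog r)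
    rw [Real.circleAverage_fun_add (hpi r) e0, Real.circleAverage_fun_sub (hLi r) (hlog r)]
  have e2 : Real.circleAverage L c r ≤ A := Real.circleAverage_mono_on_of_le_circle (hLi r) fun z hz => by
    refine hA z ?_
    rw [Metric.mem_sphere, abs_of_pos hr0] at hz
    rw [Metric.mem_ball, hz]; exact hr.2
  have e3 := log_norm_le_circleAverage hF hc hr0
  rw [e1]
  have e4 : Real.circleAverage L c r - Real.circleAverage (fun z => Real.log ‖F z‖) c r ≤ B := by linarith
  have hπ := Real.pi_pos
  have e5 : 2 * Real.pi * r * (Real.circleAverage L c r - Real.circleAverage (fun z => Real.log ‖F z‖) c r) ≤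
      2 * Real.pi * ρ * B := by
    calc _ ≤ 2 * Real.pi * r * B := by gcongr
      _ ≤ _ := by gcongr; exact hr.2.le
  rw [mul_add]; linarith

/-- The gap between `log |E|` and its majorant `log (C (1 + |z|)) + π |Im z|`. -/
def deficit (E : ℂ → ℂ) (C : ℝ) (z : ℂ) : ℝ :=
  Real.log (C * (1 + ‖z‖)) + Real.pi * |z.im| - Real.log ‖E z‖

theorem log_majorant_nonneg {C : ℝ} (hC : 1 ≤ C) (z : ℂ) : 0 ≤ Real.log (C * (1 + ‖z‖)) :=
  Real.log_nonneg (by nlinarith [norm_nonneg z])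

theorem deficit_nonneg {E : ℂ → ℂ} {C : ℝ} (hC : 1 ≤ C)
    (hb : ∀ z, ‖E z‖ ≤ C * (1 + ‖z‖) * Real.exp (Real.pi * |z.im|)) (z : ℂ) : 0 ≤ deficit E C z := by
  have hπ := Real.pi_pos
  have h0 := log_majorant_nonneg hC z
  rcases eq_or_ne (E z) 0 with h | h
  -- At a zero of E the convention log 0 = 0 leaves the majorant, which is nonnegative since C ≥ 1.
  · simp only [deficit, h, norm_zero, Real.log_zero, sub_zero]
    positivity
  · have h1 := Real.log_le_log (norm_pos_iff.2 h) (hb z)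
    rw [Real.log_mul (by positivity) (Real.exp_pos _).ne', Real.log_exp] at h1
    simp only [deficit]; linarith

theorem continuous_log_majorant {C : ℝ} (hC : 1 ≤ C) : Continuous fun z : ℂ => Real.log (C * (1 + ‖z‖)) := by
  refine Continuous.log (by fun_prop) fun z => ?_
  positivity

/-- A disc centred near iMρ looks almost like a half-plane at scale ρ: for Im z ≥ 0, |z − iMρ|² ≤
|z|² + (Mρ)² < (Mρ + ρ/M)². -/
theorem mem_ball_of_norm_lt {z z₁ : ℂ} {M ρ : ℝ} (hM : 0 < M) (hρ : 0 < ρ)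
    (hz₁ : ‖z₁ - (M * ρ : ℝ) * Complex.I‖ ≤ ρ / M) (hz : ‖z‖ < ρ) (hz0 : 0 ≤ z.im) :
    z ∈ Metric.ball z₁ (M * ρ + 2 * (ρ / M)) := by
  rw [Metric.mem_ball, dist_eq_norm]
  have h1 : ‖z - (M * ρ : ℝ) * Complex.I‖ ^ 2 = ‖z‖ ^ 2 - 2 * z.im * (M * ρ) + (M * ρ) ^ 2 := by
    rw [← Complex.normSq_eq_norm_sq, ← Complex.normSq_eq_norm_sq]
    simp [Complex.normSq_apply]; ring
  have h2 : ‖z - (M * ρ : ℝ) * Complex.I‖ < M * ρ + ρ / M := by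
    refine lt_of_pow_lt_pow_left₀ 2 (by positivity) ?_
    rw [h1]
    have e : (M * ρ + ρ / M) ^ 2 = (M * ρ) ^ 2 + 2 * ρ ^ 2 + (ρ / M) ^ 2 := by field_simp; ring
    have h3 : ‖z‖ ^ 2 < ρ ^ 2 := by gcongr
    have h4 : 0 ≤ z.im * (M * ρ) := by positivity
    rw [e]; nlinarith [sq_nonneg (ρ / M), sq_nonneg ρ]
  have h3 := norm_sub_le_norm_sub_add_norm_sub z ((M * ρ : ℝ) * Complex.I) z₁
  rw [norm_sub_rev ((M * ρ : ℝ) * Complex.I) z₁] at h3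
  linarith

/-- The part of that disc below the real axis is a thin sliver; this makes the correction for the
lower half-plane of order ρ³/M. -/
theorem norm_lt_of_mem_ball {z z₁ : ℂ} {M ρ : ℝ} (hM : 1 ≤ M) (hρ : 0 < ρ)
    (hz₁ : ‖z₁ - (M * ρ : ℝ) * Complex.I‖ ≤ ρ / M) (hz : z ∈ Metric.ball z₁ (M * ρ + 2 * (ρ / M)))
    (hz0 : z.im < 0) : ‖z‖ < 4 * ρ ∧ -z.im ≤ 3 * (ρ / M) := by
  have hM0 : 0 < M := by linarith
  rw [Metric.mem_ball, dist_eq_norm] at hz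
  have h3 := norm_sub_le_norm_sub_add_norm_sub z z₁ ((M * ρ : ℝ) * Complex.I)
  have h4 : ‖z - (M * ρ : ℝ) * Complex.I‖ < M * ρ + 3 * (ρ / M) := by linarith
  constructor
  · have h1 : ‖z - (M * ρ : ℝ) * Complex.I‖ ^ 2 = ‖z‖ ^ 2 - 2 * z.im * (M * ρ) + (M * ρ) ^ 2 := by
      rw [← Complex.normSq_eq_norm_sq, ← Complex.normSq_eq_norm_sq]
      simp [Complex.normSq_apply]; ring
    refine lt_of_pow_lt_pow_left₀ 2 (by positivity) ?_
    have h5 : ‖z - (M * ρ : ℝ) * Complex.I‖ ^ 2 < (M * ρ + 3 * (ρ / M)) ^ 2 := by gcongr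
    have e : (M * ρ + 3 * (ρ / M)) ^ 2 = (M * ρ) ^ 2 + 6 * ρ ^ 2 + 9 * (ρ / M) ^ 2 := by field_simp; ring
    have h6 : (ρ / M) ^ 2 ≤ ρ ^ 2 := by
      gcongr; exact div_le_self hρ.le hM
    have h7 : 0 < -z.im * (M * ρ) := mul_pos (by linarith) (by positivity)
    rw [h1, e] at h5
    nlinarith
  · have h1 := (Complex.abs_im_le_norm (z - (M * ρ : ℝ) * Complex.I)).trans h4.le
    have e : (z - (M * ρ : ℝ) * Complex.I).im = z.im - M * ρ := by simp
    rw [e] at h1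
    linarith [(abs_le.1 h1).1]

theorem eventually_log_le {C a ε : ℝ} (hC : 1 ≤ C) (ha : 0 < a) (hε : 0 < ε) :
    ∀ᶠ ρ : ℝ in atTop, Real.log (C * (1 + a * ρ)) ≤ ε * ρ := by
  have hC0 : 0 < C := by linarith
  have h1 : Tendsto (fun ρ : ℝ => C * (1 + a * ρ)) atTop atTop :=
    (tendsto_atTop_add_const_left _ _ (tendsto_id.const_mul_atTop ha)).const_mul_atTop hC0
  have h2 := h1.eventually (Real.isLittleO_log_id_atTop.bound (show 0 < ε / (2 * C * a) by positivity))
  filter_upwards [h2, eventually_ge_atTop (1 / a)] with ρ h hρ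
  have hρ' : 1 ≤ a * ρ := by rwa [div_le_iff₀ ha, mul_comm] at hρ
  simp only [id, Real.norm_eq_abs] at h
  rw [abs_of_pos (by positivity : 0 < C * (1 + a * ρ))] at h
  calc _ ≤ _ := (le_abs_self _).trans h
    _ ≤ ε / (2 * C * a) * (C * (2 * (a * ρ))) := by gcongr; linarith
    _ = ε * ρ := by field_simp

/-- In the upper half-plane the deficit is log(C(1 + |z|)) − log |F| almost everywhere, with F = E
e^{iπz}. The submean inequality about a point z₁ near iMρ where |F| ≥ e^{−εMρ} bounds its integral
over a disc covering the upper half disc of radius ρ; below the axis the deficit differs by −2π Im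
z, felt only on the sliver. -/
theorem eventually_lintegral_deficit_le {E : ℂ → ℂ} (hE : Differentiable ℂ E) {C : ℝ} (hC : 1 ≤ C)
    (hb : ∀ z, ‖E z‖ ≤ C * (1 + ‖z‖) * Real.exp (Real.pi * |z.im|)) (hcount : (E ⁻¹' {0}).Countable)
    (hsharp : ∀ σ > 0, ∀ C' : ℝ, ¬ ∀ z : ℂ, 0 < z.im →
      ‖E z‖ ≤ C' * (1 + ‖z‖) * Real.exp ((Real.pi - σ) * z.im)) {κ : ℝ} (hκ : 0 < κ) :
    ∀ᶠ ρ : ℝ in atTop, ∫⁻ z in Metric.ball (0 : ℂ) ρ ∩ {z | 0 ≤ z.im}, ENNReal.ofReal (deficit E C z) ≤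
      ENNReal.ofReal (κ * ρ ^ 3) := by
  have hπ := Real.pi_pos
  -- M makes the sliver term 6π(ρ/M) · 16πρ² at most κρ³/2, and ε below makes 2π · 2εMρ · (3Mρ)²
  -- equal to κρ³/2.
  set M : ℝ := 2 + 192 * Real.pi ^ 2 / κ with hM
  have hM2 : 2 ≤ M := by
    rw [hM]
    exact le_add_of_nonneg_right (by positivity)
  have hM0 : 0 < M := by linarith
  have hMκ : 96 * Real.pi ^ 2 / M ≤ κ / 2 := by
    rw [div_le_iff₀ hM0, hM]
    have : κ / 2 * (2 + 192 * Real.pi ^ 2 / κ) = κ + 96 * Real.pi ^ 2 := by field_simp; ring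
    rw [this]; linarith
  set ε : ℝ := κ / (72 * Real.pi * M ^ 3) with hε
  have hε0 : 0 < ε := by positivity
  have hη1 : 1 / M ^ 2 < 1 := by rw [div_lt_one (by positivity)]; nlinarith
  have hz := eventually_exists_exp_le_norm hE hC hb hsharp (show 0 < 1 / M ^ 2 by positivity) hη1 hε0
  have hz' := (tendsto_id.const_mul_atTop hM0).eventually hz
  filter_upwards [hz', eventually_log_le hC (show 0 < 5 * M by positivity) (show 0 < ε * M by positivity),
    eventually_gt_atTop 0] with ρ hρz hlog hρ
  simp only [id] at hρz
  obtain ⟨z₁, hz₁, hz₁E⟩ := hρz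
  have hz₁' : ‖z₁ - (M * ρ : ℝ) * Complex.I‖ ≤ ρ / M := hz₁.trans (le_of_eq (by field_simp))
  set F : ℂ → ℂ := fun z => E z * Complex.exp (Complex.I * Real.pi * z) with hF
  have hFd : Differentiable ℂ F := hE.mul (by fun_prop)
  have hFlog : ∀ z, E z ≠ 0 → Real.log ‖F z‖ = Real.log ‖E z‖ - Real.pi * z.im := fun z hz => by
    rw [hF]
    simp only
    rw [norm_mul, norm_exp_I_mul_ofReal, Real.log_mul (norm_ne_zero_iff.2 hz) (Real.exp_pos _).ne', Real.log_exp]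
    ring
  have hE₁ : E z₁ ≠ 0 := norm_pos_iff.1 ((Real.exp_pos _).trans_le hz₁E)
  have hF₁ : F z₁ ≠ 0 := mul_ne_zero hE₁ (Complex.exp_ne_zero _)
  set p : ℂ → ℝ := fun z => 2 * Real.pi * max (-z.im) 0 with hp
  set L : ℂ → ℝ := fun z => Real.log (C * (1 + ‖z‖)) with hL
  have hpc : Continuous p := by
    have := Complex.continuous_im
    fun_prop
  have hp0 : ∀ z, 0 ≤ p z := fun z => by positivity
  have hpL : ∀ z, E z ≠ 0 → p z + (L z - Real.log ‖F z‖) = deficit E C z := fun z hz => by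
    rw [hFlog z hz]
    simp only [hp, hL, deficit]
    rcases le_total 0 z.im with h | h
    · rw [max_eq_right (by linarith), abs_of_nonneg h]; ring
    · rw [max_eq_left (by linarith), abs_of_nonpos h]; ring
  have h0 : ∀ z, 0 ≤ p z + (L z - Real.log ‖F z‖) := fun z => by
    rcases eq_or_ne (E z) 0 with h | h
    · have : F z = 0 := by simp [hF, h]
      rw [this, norm_zero, Real.log_zero, sub_zero]
      exact add_nonneg (hp0 z) (log_majorant_nonneg hC z)
    · rw [hpL z h]; exact deficit_nonneg hC hb z
  set r := M * ρ + 2 * (ρ / M) with hr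
  have hρM : ρ / M ≤ M * ρ / 4 := by
    rw [div_le_iff₀ hM0]; nlinarith [mul_pos hM0 hρ, mul_le_mul hM2 hM2 (by norm_num) hM0.le]
  have hr0 : 0 ≤ r := by positivity
  have hr3 : r ≤ 3 * (M * ρ) := by rw [hr]; nlinarith [mul_pos hM0 hρ]
  have key := lintegral_ball_sub_log_le hFd hF₁ hpc (continuous_log_majorant hC) hp0 h0 hr0
    (B := 2 * (ε * M * ρ)) (A := Real.log (C * (1 + 5 * M * ρ))) (by positivity) (fun z hz => by
      refine Real.log_le_log (by positivity) ?_
      have h1 : ‖z‖ ≤ ‖z - z₁‖ + ‖z₁ - (M * ρ : ℝ) * Complex.I‖ + ‖((M * ρ : ℝ) : ℂ) * Complex.I‖ := by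
        have e : z = (z - z₁) + (z₁ - (M * ρ : ℝ) * Complex.I) + (M * ρ : ℝ) * Complex.I := by ring
        calc ‖z‖ = ‖(z - z₁) + (z₁ - (M * ρ : ℝ) * Complex.I) + (M * ρ : ℝ) * Complex.I‖ := by rw [← e]
          _ ≤ _ := norm_add₃_le
      rw [Metric.mem_ball, dist_eq_norm] at hz
      have h2 : ‖((M * ρ : ℝ) : ℂ) * Complex.I‖ = M * ρ := by
        rw [norm_mul, Complex.norm_I, mul_one, Complex.norm_real, Real.norm_eq_abs, abs_of_pos (by positivity)]
      gcongr
      nlinarith [mul_pos hM0 hρ]) (by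
      have h1 := Real.log_le_log (Real.exp_pos _) hz₁E
      rw [Real.log_exp] at h1
      rw [hFlog z₁ hE₁]
      linarith)
  have hpint : ∫⁻ z in Metric.ball z₁ r, ENNReal.ofReal (p z) ≤ ENNReal.ofReal (96 * Real.pi ^ 2 / M * ρ ^ 3) := by
    calc ∫⁻ z in Metric.ball z₁ r, ENNReal.ofReal (p z)
        ≤ ∫⁻ z in Metric.ball z₁ r, (Metric.ball (0 : ℂ) (4 * ρ)).indicator
            (fun _ => ENNReal.ofReal (6 * Real.pi * (ρ / M))) z := by
          refine setLIntegral_mono' measurableSet_ball fun z hz => ?_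
          rcases lt_or_ge z.im 0 with h | h
          · obtain ⟨h1, h2⟩ := norm_lt_of_mem_ball (by linarith) hρ hz₁' hz h
            rw [Set.indicator_of_mem (by simpa using h1)]
            refine ENNReal.ofReal_le_ofReal ?_
            simp only [hp]
            rw [max_eq_left (by linarith)]
            nlinarith
          · have : p z = 0 := by simp only [hp]; rw [max_eq_right (by linarith), mul_zero]
            rw [this]; simp
      _ ≤ ∫⁻ z, (Metric.ball (0 : ℂ) (4 * ρ)).indicator
            (fun _ => ENNReal.ofReal (6 * Real.pi * (ρ / M))) z := setLIntegral_le_lintegral _ _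
      _ = _ := by
          rw [lintegral_indicator measurableSet_ball, setLIntegral_const, Complex.volume_ball,
            ← ENNReal.ofReal_pow (by positivity)]
          have : ((NNReal.pi : NNReal) : ENNReal) = ENNReal.ofReal Real.pi := by
            rw [← NNReal.coe_real_pi, ENNReal.ofReal_coe_nnreal]
          rw [this, ← ENNReal.ofReal_mul (by positivity), ← ENNReal.ofReal_mul (by positivity)]
          congr 1
          field_simp; ring
  calc ∫⁻ z in Metric.ball (0 : ℂ) ρ ∩ {z | 0 ≤ z.im}, ENNReal.ofReal (deficit E C z)
      ≤ ∫⁻ z in Metric.ball z₁ r, ENNReal.ofReal (deficit E C z) :=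
        lintegral_mono_set fun z hz => mem_ball_of_norm_lt hM0 hρ hz₁' (by simpa using hz.1) hz.2
    _ ≤ ∫⁻ z in Metric.ball z₁ r, ENNReal.ofReal (p z + (L z - Real.log ‖F z‖)) := by
        refine lintegral_mono_ae (ae_restrict_of_ae ?_)
        filter_upwards [hcount.ae_notMem volume] with z hz
        rw [hpL z hz]
    _ ≤ _ := key
    _ ≤ ENNReal.ofReal (κ / 2 * ρ ^ 3) + ENNReal.ofReal (κ / 2 * ρ ^ 3) := by
        refine add_le_add (ENNReal.ofReal_le_ofReal ?_) (hpint.trans (ENNReal.ofReal_le_ofReal (by gcongr)))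
        calc 2 * Real.pi * (2 * (ε * M * ρ)) * r ^ 2 ≤ 2 * Real.pi * (2 * (ε * M * ρ)) * (3 * (M * ρ)) ^ 2 := by gcongr
          _ = κ / 2 * ρ ^ 3 := by rw [hε]; field_simp; ring
    _ = _ := by
        rw [← ENNReal.ofReal_add (by positivity) (by positivity)]
        congr 1; ring

/-! ### Equality of the moduli of G and E on the real line -/

section

variable {Λ : Set ℂ} {E : ℂ → ℂ}

theorem integral_abs_sin_mul_cos : ∫ θ in (0 : ℝ)..2 * Real.pi, |Real.sin θ| * Real.cos θ = 0 := by
  have hc : Continuous fun θ : ℝ => |Real.sin θ| * Real.cos θ := by fun_prop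
  have h1 := intervalIntegral.integral_comp_add_right (a := 0) (b := Real.pi)
    (fun θ : ℝ => |Real.sin θ| * Real.cos θ) Real.pi
  rw [zero_add, ← two_mul] at h1
  rw [← intervalIntegral.integral_add_adjacent_intervals (hc.intervalIntegrable 0 Real.pi)
    (hc.intervalIntegrable Real.pi _), ← h1]
  simp [Real.sin_add_pi, Real.cos_add_pi]

theorem measurable_deficit (hE : Differentiable ℂ E) {C : ℝ} (hC : 1 ≤ C) : Measurable (deficit E C) := by
  have h1 := (continuous_log_majorant hC).measurable
  have h2 : Measurable fun z : ℂ => Real.log ‖E z‖ := Real.measurable_log.comp hE.continuous.norm.measurable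
  have h3 : Measurable fun z : ℂ => Real.pi * |z.im| := by
    have := Complex.continuous_im
    exact Continuous.measurable (by fun_prop)
  exact (h1.add h3).sub h2

theorem circleIntegrable_deficit (hE : Differentiable ℂ E) {C : ℝ} (hC : 1 ≤ C) (c : ℂ) (r : ℝ) :
    CircleIntegrable (deficit E C) c r := by
  have h1 : Continuous fun z : ℂ => Real.log (C * (1 + ‖z‖)) + Real.pi * |z.im| := by
    have := continuous_log_majorant hC
    have := Complex.continuous_im
    fun_prop
  exact h1.continuousOn.circleIntegrable'.sub (circleIntegrable_log_norm hE c r)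

/-- On the circle the majorant is a constant plus πr|sin θ|, both orthogonal to cos θ. The moment of
log |E| is therefore minus that of the nonnegative deficit. -/
theorem abs_integral_log_mul_cos_le (hE : Differentiable ℂ E) {C : ℝ} (hC : 1 ≤ C)
    (hb : ∀ z, ‖E z‖ ≤ C * (1 + ‖z‖) * Real.exp (Real.pi * |z.im|)) {r : ℝ} (hr : 0 < r) :
    |∫ θ in (0 : ℝ)..2 * Real.pi, Real.log ‖E (circleMap 0 r θ)‖ * Real.cos θ| ≤
      2 * Real.pi * Real.circleAverage (deficit E C) 0 r := by
  have hcos : ∀ {f : ℝ → ℝ}, IntervalIntegrable f volume 0 (2 * Real.pi) →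
      IntervalIntegrable (fun θ => f θ * Real.cos θ) volume 0 (2 * Real.pi) := fun hf =>
    hf.mul_continuousOn Real.continuous_cos.continuousOn
  have hlog : IntervalIntegrable (fun θ => Real.log ‖E (circleMap 0 r θ)‖) volume 0 (2 * Real.pi) :=
    circleIntegrable_log_norm hE 0 r
  have hdef : IntervalIntegrable (fun θ => deficit E C (circleMap 0 r θ)) volume 0 (2 * Real.pi) :=
    circleIntegrable_deficit hE hC 0 r
  have hpt : ∀ θ, Real.log ‖E (circleMap 0 r θ)‖ * Real.cos θ =
      (Real.log (C * (1 + r)) * Real.cos θ + Real.pi * r * (|Real.sin θ| * Real.cos θ)) -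
        deficit E C (circleMap 0 r θ) * Real.cos θ := fun θ => by
    have h1 : ‖circleMap 0 r θ‖ = r := by simp [abs_of_pos hr]
    have h2 : (circleMap 0 r θ).im = r * Real.sin θ := by
      simp [circleMap, Complex.exp_ofReal_mul_I_im]
    rw [deficit, h1, h2, abs_mul, abs_of_pos hr]; ring
  have hI : ∫ θ in (0 : ℝ)..2 * Real.pi, Real.log ‖E (circleMap 0 r θ)‖ * Real.cos θ =
      -∫ θ in (0 : ℝ)..2 * Real.pi, deficit E C (circleMap 0 r θ) * Real.cos θ := by
    have i1 : IntervalIntegrable (fun θ => Real.log (C * (1 + r)) * Real.cos θ) volume 0 (2 * Real.pi) :=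
      Continuous.intervalIntegrable (by fun_prop) _ _
    have i2 : IntervalIntegrable (fun θ => Real.pi * r * (|Real.sin θ| * Real.cos θ)) volume 0 (2 * Real.pi) :=
      Continuous.intervalIntegrable (by fun_prop) _ _
    simp_rw [hpt]
    rw [intervalIntegral.integral_sub (i1.add i2) (hcos hdef), intervalIntegral.integral_add i1 i2,
      intervalIntegral.integral_const_mul, intervalIntegral.integral_const_mul, integral_cos,
      integral_abs_sin_mul_cos]
    simp
  rw [hI, abs_neg, Real.circleAverage_def, smul_eq_mul, ← mul_assoc, mul_inv_cancel₀ Real.two_pi_pos.ne', one_mul,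
    ← Real.norm_eq_abs]
  refine intervalIntegral.norm_integral_le_of_norm_le Real.two_pi_pos.le (ae_of_all _ fun θ _ => ?_) hdef
  rw [norm_mul, Real.norm_eq_abs, Real.norm_eq_abs, abs_of_nonneg (deficit_nonneg hC hb _)]
  exact mul_le_of_le_one_right (deficit_nonneg hC hb _) (Real.abs_cos_le_one θ)

theorem IsGenerator.countable (hE : IsGenerator Λ E) : (E ⁻¹' {0}).Countable := by
  have : E ⁻¹' {0} ⊆ ⋃ n : ℕ, {μ : ℂ | μ ∈ Λ ∧ ‖μ‖ < n} := fun z hz => by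
    obtain ⟨n, hn⟩ := exists_nat_gt ‖z‖
    exact Set.mem_iUnion.2 ⟨n, (hE.eq_zero_iff z).1 hz, hn⟩
  exact (Set.countable_iUnion fun n : ℕ => (hE.finite n).countable).mono this

/-- The deficit of a generator is small on average over large discs. -/
theorem IsGenerator.eventually_lintegral_ball_deficit_le (hE : IsGenerator Λ E) {C : ℝ} (hC : 1 ≤ C)
    (hb : ∀ z, ‖E z‖ ≤ C * (1 + ‖z‖) * Real.exp (Real.pi * |z.im|)) {κ : ℝ} (hκ : 0 < κ) :
    ∀ᶠ ρ : ℝ in atTop, ∫⁻ z in Metric.ball (0 : ℂ) ρ, ENNReal.ofReal (deficit E C z) ≤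
      ENNReal.ofReal (2 * κ * ρ ^ 3) := by
  have hEd := hE.isPaleyWienerOne.differentiable
  have hEn : Differentiable ℂ fun z => E (-z) := hEd.comp differentiable_neg
  have hcount : ((fun z => E (-z)) ⁻¹' {0}).Countable := hE.countable.preimage neg_injective
  filter_upwards [eventually_lintegral_deficit_le hEd hC hb hE.countable hE.sharp hκ,
    eventually_lintegral_deficit_le hEn hC (fun z => by simpa using hb (-z)) hcount hE.sharp_neg hκ,
    eventually_gt_atTop 0] with ρ h1 h2 hρ
  have hneg : ∫⁻ z in Metric.ball (0 : ℂ) ρ ∩ {z | z.im ≤ 0}, ENNReal.ofReal (deficit E C z) =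
      ∫⁻ z in Metric.ball (0 : ℂ) ρ ∩ {z | 0 ≤ z.im}, ENNReal.ofReal (deficit (fun z => E (-z)) C z) := by
    have hs : MeasurableSet (Metric.ball (0 : ℂ) ρ ∩ {z | z.im ≤ 0}) :=
      measurableSet_ball.inter (isClosed_le Complex.continuous_im continuous_const).measurableSet
    rw [← (Measure.measurePreserving_neg (volume : Measure ℂ)).setLIntegral_comp_preimage hs
      (measurable_deficit hEd hC).ennreal_ofReal]
    congr 2
    · ext z; simp
    · ext z; simp [deficit]
  calc ∫⁻ z in Metric.ball (0 : ℂ) ρ, ENNReal.ofReal (deficit E C z)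
      ≤ ∫⁻ z in (Metric.ball (0 : ℂ) ρ ∩ {z | 0 ≤ z.im}) ∪ (Metric.ball (0 : ℂ) ρ ∩ {z | z.im ≤ 0}),
          ENNReal.ofReal (deficit E C z) := lintegral_mono_set fun z hz => by
        rcases le_total 0 z.im with h | h
        · exact Or.inl ⟨hz, h⟩
        · exact Or.inr ⟨hz, h⟩
    _ ≤ _ := lintegral_union_le _ _ _
    _ ≤ ENNReal.ofReal (κ * ρ ^ 3) + ENNReal.ofReal (κ * ρ ^ 3) := add_le_add h1 (hneg ▸ h2)
    _ = _ := by
        rw [← ENNReal.ofReal_add (by positivity) (by positivity)]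
        congr 1; ring

/-- If Re α ≠ 0, the cosine moment is at least π|Re α|r/2 in modulus for large r, hence so is 2π
times the mean deficit on that circle. Integration over ρ/2 < r < ρ gives π|Re α|ρ³/16, twice what
the area estimate allows. Circles through zeros of E are a null set of radii. -/
theorem IsGenerator.re_eq_zero (hE : IsGenerator Λ E) {α : ℂ} (hα : Tendsto hE.coeff atTop (𝓝 α)) :
    α.re = 0 := by
  by_contra hβ
  have hβ' : 0 < |α.re| := abs_pos.2 hβ
  have hπ := Real.pi_pos
  have hEd := hE.isPaleyWienerOne.differentiable
  obtain ⟨C₀, hC₀⟩ := hE.isPaleyWienerOne.bound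
  set C := max C₀ 1
  have hC : 1 ≤ C := le_max_right _ _
  have hb : ∀ z, ‖E z‖ ≤ C * (1 + ‖z‖) * Real.exp (Real.pi * |z.im|) := fun z => (hC₀ z).trans (by
    gcongr; exact le_max_left _ _)
  have hlow := eventually_le_abs_integral ((Complex.continuous_re.tendsto α).comp hα) hβ
    fun r hr => (hE.integral_coeff hr).1
  obtain ⟨T, hT⟩ := eventually_atTop.1 hlow
  have hup := hE.eventually_lintegral_ball_deficit_le hC hb
    (show 0 < Real.pi * |α.re| / 64 by positivity)
  obtain ⟨ρ, hρ, hρ0, hρT⟩ := (hup.and ((eventually_gt_atTop 0).and (eventually_ge_atTop (2 * T)))).exists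
  rw [lintegral_ball_eq (measurable_deficit hEd hC) (deficit_nonneg hC hb)
    (circleIntegrable_deficit hEd hC 0)] at hρ
  have hae : ∀ᵐ r : ℝ, r ∉ norm '' (E ⁻¹' {0}) := (hE.countable.image _).ae_notMem volume
  have hge : ENNReal.ofReal (Real.pi * |α.re| / 16 * ρ ^ 3) ≤
      ∫⁻ r in Set.Ioo 0 ρ, ENNReal.ofReal (2 * Real.pi * r * Real.circleAverage (deficit E C) 0 r) := by
    calc ENNReal.ofReal (Real.pi * |α.re| / 16 * ρ ^ 3)
        = ∫⁻ _ in Set.Ioo (ρ / 2) ρ, ENNReal.ofReal (Real.pi * |α.re| / 8 * ρ ^ 2) := by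
          rw [setLIntegral_const, Real.volume_Ioo, ← ENNReal.ofReal_mul (by positivity)]
          congr 1; ring
      _ ≤ ∫⁻ r in Set.Ioo (ρ / 2) ρ, ENNReal.ofReal (2 * Real.pi * r * Real.circleAverage (deficit E C) 0 r) := by
          refine lintegral_mono_ae ?_
          filter_upwards [ae_restrict_mem measurableSet_Ioo, ae_restrict_of_ae hae] with r hr hrE
          refine ENNReal.ofReal_le_ofReal ?_
          have hr0 : 0 < r := by linarith [hr.1]
          have h1 := abs_integral_log_mul_cos_le hEd hC hb hr0
          rw [hE.integral_log_mul_cos hr0 fun μ hμ h => hrE ⟨μ, hμ, h⟩, abs_mul, abs_of_pos (by positivity)] at h1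
          have h2 := hT r (by linarith [hr.1])
          simp only [Function.comp_apply] at h2
          have h3 : Real.pi / r * (|α.re| / 2 * r ^ 2) ≤ 2 * Real.pi * Real.circleAverage (deficit E C) 0 r :=
            le_trans (by gcongr) h1
          have h4 : Real.pi / r * (|α.re| / 2 * r ^ 2) = Real.pi * |α.re| / 2 * r := by field_simp
          rw [h4] at h3
          have h5 : ρ / 2 < r := hr.1
          calc Real.pi * |α.re| / 8 * ρ ^ 2 = Real.pi * |α.re| / 2 * (ρ / 2) * (ρ / 2) := by ring
            _ ≤ Real.pi * |α.re| / 2 * r * r := by gcongr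
            _ ≤ 2 * Real.pi * Real.circleAverage (deficit E C) 0 r * r := by gcongr
            _ = _ := by ring
      _ ≤ _ := lintegral_mono_set (Set.Ioo_subset_Ioo_left (by positivity))
  have := (ENNReal.ofReal_le_ofReal_iff (by positivity)).1 (hge.trans hρ)
  have : 0 < Real.pi * |α.re| * ρ ^ 3 := by positivity
  linarith

/-- On the real line the generating function and the generator have the same modulus. -/
theorem IsGenerator.norm_eq (hE : IsGenerator Λ E) {G : ℂ → ℂ} (hG : IsGeneratingFunction Λ G) (x : ℝ) :
    ‖G x‖ = ‖E x‖ := by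
  obtain ⟨α, hα, hGE⟩ := hE.exists_tendsto_coeff hG
  rw [← hGE x, norm_mul, Complex.norm_exp, Complex.re_mul_ofReal, hE.re_eq_zero hα]
  simp

end

/-! ### Reduction of the theorem to the estimates -/

section

variable {E : ℂ → ℂ}

/-- Off the interval |n − ρ| is comparable to |n| + 1. Hence the sum in (i) is a genuine one and not
the default value 0 of `tsum`. -/
theorem summable_off_interval
    (hsum : Summable fun n : ℤ => (‖E (n : ℂ)‖ ^ 2 + ‖E (n : ℂ)‖) / (|(n : ℝ)| + 1)) {ρ d : ℝ} (hρ : 0 < ρ)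
    (hd : 0 < d) : Summable fun n : {n : ℤ // (n : ℝ) ∉ Set.Icc (ρ - d) (ρ + d)} =>
      ‖E (n : ℤ)‖ ^ 2 / |((n : ℤ) : ℝ) - ρ| := by
  refine Summable.of_nonneg_of_le (fun n => by positivity) (fun n => ?_)
    ((hsum.comp_injective Subtype.val_injective).mul_left (1 + (ρ + 1) / d))
  obtain ⟨n, hn⟩ := n
  have h1 : d < |(n : ℝ) - ρ| := by
    by_contra h
    rw [not_lt, abs_le] at h
    exact hn ⟨by linarith, by linarith⟩
  have h2 : |(n : ℝ)| + 1 ≤ (1 + (ρ + 1) / d) * |(n : ℝ) - ρ| := by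
    have h3 : |(n : ℝ)| ≤ |(n : ℝ) - ρ| + ρ := by
      have := abs_add_le ((n : ℝ) - ρ) ρ
      rwa [sub_add_cancel, abs_of_pos hρ] at this
    have h4 : ρ + 1 ≤ (ρ + 1) / d * |(n : ℝ) - ρ| := by
      calc ρ + 1 = (ρ + 1) / d * d := by field_simp
        _ ≤ _ := by gcongr
    linarith
  have h0 : 0 < |(n : ℝ) - ρ| := hd.trans h1
  simp only [Function.comp_apply]
  rw [div_le_iff₀ h0, mul_comm (1 + (ρ + 1) / d), mul_assoc, div_mul_eq_mul_div, le_div_iff₀ (by positivity)]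
  gcongr
  linarith [norm_nonneg (E (n : ℂ))]

/-- The integer 0 lies outside the interval and E(0) ≠ 0, so the left side of (i) is positive. This
permits cancelling √(g/d) later. -/
theorem localMass_pos (h0 : E 0 ≠ 0) {ρ d C : ℝ} (hd : 0 < d) (hdρ : d < ρ) (hC : 0 < C)
    (hsum : Summable fun n : {n : ℤ // (n : ℝ) ∉ Set.Icc (ρ - d) (ρ + d)} =>
      ‖E (n : ℤ)‖ ^ 2 / |((n : ℤ) : ℝ) - ρ|)
    (hi : ∑' n : {n : ℤ // (n : ℝ) ∉ Set.Icc (ρ - d) (ρ + d)},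
      ‖E (n : ℤ)‖ ^ 2 / |((n : ℤ) : ℝ) - ρ| ≤ C * (localMass E ρ d / d)) : 0 < localMass E ρ d := by
  have hmem : ((0 : ℤ) : ℝ) ∉ Set.Icc (ρ - d) (ρ + d) := fun h => by
    have := h.1
    push_cast at this
    linarith
  have h1 := hsum.le_tsum ⟨0, hmem⟩ fun n _ => by positivity
  have h2 : 0 < ‖E ((0 : ℤ) : ℂ)‖ ^ 2 / |((0 : ℤ) : ℝ) - ρ| := by
    have hE : 0 < ‖E ((0 : ℤ) : ℂ)‖ := by simpa using h0
    have hρ : 0 < |((0 : ℤ) : ℝ) - ρ| := by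
      rw [abs_pos]; push_cast; linarith
    positivity
  have h3 := h2.trans_le (h1.trans hi)
  have h4 := pos_of_mul_pos_right h3 hC.le
  exact (div_pos_iff_of_pos_right hd).1 h4

theorem exists_expTransform_int_ne_zero {Λ : Set ℂ} (hΛ : IsComplete (Set.range (expSystem Λ))) {χ : L2}
    (hχ : χ ≠ 0) : ∃ n : ℤ, expTransform χ n ≠ 0 := by
  by_contra! h
  have hP := isPaleyWiener_expTransform χ
  obtain ⟨C, hC⟩ := hP.bound
  have h0 := eq_zero_of_eq_zero_on_lattice 0 hP.differentiable hC (fun n => by simpa using h n) hP.tendsto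
  refine hχ (isComplete_iff.1 hΛ χ ?_)
  rintro _ ⟨m, rfl⟩
  exact congrFun h0 m

end

end ExpSystem

end

theorem theorem3p1 (Λ : Set ℂ) (G : ℂ → ℂ)
    (hΛ : ExpSystem.IsCompleteMinimal (ExpSystem.expSystem Λ))
    (hG : ExpSystem.IsGeneratingFunction Λ G)
    (hΛℤ : ∀ n : ℤ, (n : ℂ) ∉ Λ)
    (hsum : Summable fun n : ℤ => (‖G (n : ℂ)‖ ^ 2 + ‖G (n : ℂ)‖) / (|(n : ℝ)| + 1))
    -- the lacunary intervals `I_k = [ρ k - d k, ρ k + d k]`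
    (ρ d : ℕ → ℝ)
    (hd : ∀ k, 0 < d k)
    (hρ : ∀ k, 2 * ρ k ≤ ρ (k + 1))
    (hdρ : ∀ k, d k ≤ 0.1 * ρ k)
    (hC : ∃ C : ℝ, 0 < C ∧ ∀ k,
      (∑' n : {n : ℤ // (n : ℝ) ∉ Set.Icc (ρ k - d k) (ρ k + d k)},
          ‖G ((n : ℤ) : ℂ)‖ ^ 2 / |((n : ℤ) : ℝ) - ρ k|
        ≤ C * (ExpSystem.localMass G (ρ k) (d k) / d k)) ∧
      ∀ x ∈ Set.Icc (ρ k - d k) (ρ k + d k),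
        √(ExpSystem.localMass G (ρ k) (d k) / d k) ≤ C * ‖G (x : ℂ)‖)
    (hlog : ¬ Summable fun k => d k / ρ k) :
    ExpSystem.IsHereditarilyComplete (ExpSystem.expSystem Λ) := by
  obtain ⟨E, hE⟩ := ExpSystem.exists_isGenerator hΛ (by simpa using hΛℤ 0)
  -- Conditions (i), (ii) and the summability hypothesis involve G only through its modulus at real
  -- points, so E may replace it.
  have hGx : ∀ x : ℝ, ‖G (x : ℂ)‖ = ‖E (x : ℂ)‖ := hE.norm_eq hG
  have hGn : ∀ n : ℤ, ‖G (n : ℂ)‖ = ‖E (n : ℂ)‖ := fun n => by simpa using hGx n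
  have hmass : ∀ k, ExpSystem.localMass G (ρ k) (d k) = ExpSystem.localMass E (ρ k) (d k) := fun k =>
    Finset.sum_congr rfl fun n _ => by rw [hGn]
  simp_rw [hmass, hGx, hGn] at hC
  simp_rw [hGn] at hsum
  obtain ⟨C, hC0, hC⟩ := hC
  have hρ0 : ∀ k, 0 < ρ k := fun k => by
    have := hd k
    have := hdρ k
    linarith
  have hs := fun k => ExpSystem.summable_off_interval hsum (hρ0 k) (hd k)
  have hmp : ∀ k, 0 < ExpSystem.localMass E (ρ k) (d k) := fun k =>
    ExpSystem.localMass_pos (by rw [hE.map_zero]; exact one_ne_zero) (hd k)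
      (by linarith [hdρ k, hρ0 k]) hC0 (hs k) (hC k).1
  obtain ⟨w, hw⟩ := hΛ.exists_isBiorthogonal
  refine ⟨hΛ, w, hw, fun A => ExpSystem.isComplete_iff.2 fun χ hχ => ?_⟩
  by_contra hne
  obtain ⟨n₀, hn₀⟩ := ExpSystem.exists_expTransform_int_ne_zero hΛ.1 hne
  obtain ⟨c, hc⟩ := hE.exists_const hΛ.1 hΛℤ hw (A := A) (χ := χ)
    (fun m hm => hχ _ (Or.inl ⟨m, hm, rfl⟩)) (fun m hm => hχ _ (Or.inr ⟨m, hm, rfl⟩))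
  exact hlog (ExpSystem.summable_of_identity (ExpSystem.differentiable_expTransform χ).continuous
    (ExpSystem.summable_norm_sq_expTransform_int χ) (ExpSystem.lintegral_norm_sq_expTransform_ne_top χ) hn₀
    (fun x hx => hc x fun n h => hx n (by exact_mod_cast h)) hρ0 hρ hd hdρ hC0 hmp hs
    (fun k => (hC k).1) (fun k => (hC k).2))
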